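/- Notation. A vector $x$ of a Euclidean space has norm $(x,x)$. For a lattice $X$, $O(X)$ is its isometry group; $A_2,E_6,E_8$ denote the root lattices, and $EE_8$ is a lattice isometric to $\sqrt2E_8$. For a sublattice $M$ of a Euclidean space $V$, $t_M$ is the orthogonal transformation of $V$ that is $-1$ on $M$ and $1$ on $M^\perp$. The central product $O(A_2)\circ O(E_6)$ is $(O(A_2)\times O(E_6))/\langle(-1,-1)\rangle$. A group has shape $A.B$ if it has a normal subgroup isomorphic to $A$ with quotient isomorphic to $B$. The Coxeter–Todd lattice $K_{12}$ is the set of $x\in\mathbb Z[\omega]^6$, $\omega=(-1+\sqrt{-3})/2$, whose reduction modulo $2$ lies in the hexacode over $\mathbb F_4=\mathbb Z[\omega]/2\mathbb Z[\omega]$, with the real part of the standard Hermitian form of $\mathbb C^6$. Theorem. Let $L$ be an integral lattice in a finite-dimensional Euclidean space, without nonzero vectors of norm at most $2$ (for example, the Leech lattice). Let $M,N\subseteq L$ be $EE_8$-sublattices such that $t_M,t_N$ generate a dihedral group of order $6$ and $Q:=M+N$ has rank $14$; that is, $Q\cong DIH_6(14)$. Put $g=t_Mt_N$, $\mathrm{Fix}_L(g)=\{x\in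 L: gx=x\}$ and $J=\{x\in L:(x,y)=0\text{ for all }y\in \mathrm{Fix}_L(g)\}$. Then $J\subseteq Q$, $J$ is isometric to $K_{12}$, and every isometry of $Q$ maps $J$ to itself, so that restriction is a homomorphism $\varphi:O(Q)\to O(J)$. Moreover $$\mathrm{Im}(\varphi)\cong O(A_2)\circ O(E_6),\qquad \mathrm{Ker}(\varphi)\cong Sym_3,$$ and hence $O(Q)$ has shape $Sym_3.(O(A_2)\circ O(E_6))$. -/

import Mathlib

namespace DihSix

/-! ### Isometry groups -/

section Isometry

/-- The group of `ℤ`-linear automorphisms of `X` that preserve the form `B`. -/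
def isometryGroup {X R : Type*} [AddCommGroup X] (B : X → X → R) : Subgroup (X ≃ₗ[ℤ] X) where
  carrier := {f | ∀ x y, B (f x) (f y) = B x y}
  one_mem' := fun _ _ => rfl
  mul_mem' := by
    intro f g hf hg x y
    exact (hf (g x) (g y)).trans (hg x y)
  inv_mem' := by
    intro f hf x y
    have h := hf (f⁻¹ x) (f⁻¹ y)
    rw [← LinearEquiv.mul_apply, ← LinearEquiv.mul_apply, mul_inv_cancel] at h
    exact h.symm

/-- `O(L)` for a lattice `L` in a Euclidean space. -/
abbrev latticeO {V : Type*} [NormedAddCommGroup V] [InnerProductSpace ℝ V]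
    (L : Submodule ℤ V) : Subgroup (L ≃ₗ[ℤ] L) :=
  isometryGroup fun x y : L => inner ℝ (x : V) (y : V)

/-- `O(L)` for the lattice `L = ℤⁿ` with Gram matrix `C`.  If `C` is the Cartan matrix of a
simply laced root system, this is the isometry group of the root lattice of that type. -/
abbrev gramO {n : ℕ} (C : Matrix (Fin n) (Fin n) ℤ) :
    Subgroup ((Fin n → ℤ) ≃ₗ[ℤ] (Fin n → ℤ)) :=
  isometryGroup fun x y : Fin n → ℤ => x ⬝ᵥ C.mulVec y

/-- The isometry `-1`. -/
def gramNeg {n : ℕ} (C : Matrix (Fin n) (Fin n) ℤ) : gramO C :=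
  ⟨LinearEquiv.neg ℤ, fun x y => by simp [Matrix.mulVec_neg]⟩

theorem gramNeg_comm {n : ℕ} (C : Matrix (Fin n) (Fin n) ℤ) (f : gramO C) :
    f * gramNeg C = gramNeg C * f := by
  apply Subtype.ext
  apply LinearEquiv.ext
  intro x
  exact map_neg (f : (Fin n → ℤ) ≃ₗ[ℤ] (Fin n → ℤ)) x

/-- The central subgroup of `O(L₁) × O(L₂)` generated by `(-1, -1)`. -/
abbrev negNeg {m n : ℕ} (C : Matrix (Fin m) (Fin m) ℤ) (D : Matrix (Fin n) (Fin n) ℤ) :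
    Subgroup (gramO C × gramO D) :=
  Subgroup.zpowers (gramNeg C, gramNeg D)

instance negNeg_normal {m n : ℕ} (C : Matrix (Fin m) (Fin m) ℤ) (D : Matrix (Fin n) (Fin n) ℤ) :
    (negNeg C D).Normal := by
  refine ⟨fun z hz f => ?_⟩
  obtain ⟨k, rfl⟩ := Subgroup.mem_zpowers_iff.mp hz
  have hc : Commute f (gramNeg C, gramNeg D) :=
    Prod.ext (gramNeg_comm C f.1) (gramNeg_comm D f.2)
  rw [(hc.zpow_right k).eq, mul_inv_cancel_right]
  exact hz

/-- The central product `O(L₁) ∘ O(L₂)`: the direct product with the two isometries `-1`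
identified. -/
abbrev CentralProductO {m n : ℕ} (C : Matrix (Fin m) (Fin m) ℤ)
    (D : Matrix (Fin n) (Fin n) ℤ) : Type :=
  (gramO C × gramO D) ⧸ negNeg C D

/-- `G` has shape `A.B`: it has a normal subgroup isomorphic to `A` with quotient isomorphic
to `B`. -/
def HasShape (G A B : Type*) [Group G] [Group A] [Group B] : Prop :=
  ∃ (K : Subgroup G) (_ : K.Normal), Nonempty (K ≃* A) ∧ Nonempty ((G ⧸ K) ≃* B)

end Isometry

/-! ### `EE₈`-pairs of type `DIH₆(14)` -/

section Pairs

variable {V : Type*} [NormedAddCommGroup V] [InnerProductSpace ℝ V]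

/-- `L` is an integral lattice without nonzero vectors of norm `(x, x) ≤ 2`. -/
structure IsRootlessIntegral (L : Submodule ℤ V) : Prop where
  integral : ∀ x ∈ L, ∀ y ∈ L, ∃ k : ℤ, inner ℝ x y = (k : ℝ)
  rootless : ∀ x ∈ L, x ≠ 0 → 2 < inner ℝ x x

/-- `M` is isometric to `√2` times the `E₈` root lattice. -/
def IsEE8 (M : Submodule ℤ V) : Prop :=
  ∃ b : Module.Basis (Fin 8) ℤ M,
    ∀ i j, inner ℝ (b i : V) (b j : V) = 2 * (CartanMatrix.E₈ i j : ℝ)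

/-- `t_M`: the orthogonal transformation that is `-1` on `M` and `1` on the orthogonal
complement of `M`. -/
noncomputable def tInv [FiniteDimensional ℝ V] (M : Submodule ℤ V) : V ≃ₗᵢ[ℝ] V :=
  (Submodule.span ℝ (M : Set V))ᗮ.reflection

/-- `(M, N)` is a pair of `EE₈`-lattices for which `t_M`, `t_N` generate a dihedral group of
order `6` and `M + N` has rank `14`; inside a rootless integral lattice this says that
`M + N` is a `DIH₆(14)`. -/
structure IsDih6Pair14 [FiniteDimensional ℝ V] (M N : Submodule ℤ V) : Prop where
  left : IsEE8 M
  right : IsEE8 N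
  dihedral : Nonempty
    ((Subgroup.closure {tInv M, tInv N} : Subgroup (V ≃ₗᵢ[ℝ] V)) ≃* DihedralGroup 3)
  rank : Module.finrank ℤ ↥(M ⊔ N) = 14

/-- `Fix_L(g)`. -/
def fixLattice (L : Submodule ℤ V) (g : V ≃ₗᵢ[ℝ] V) : Submodule ℤ V where
  carrier := {x | x ∈ L ∧ g x = x}
  zero_mem' := ⟨L.zero_mem, map_zero g⟩
  add_mem' := by
    rintro x y ⟨hx, hgx⟩ ⟨hy, hgy⟩
    exact ⟨L.add_mem hx hy, by rw [map_add, hgx, hgy]⟩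
  smul_mem' := by
    rintro k x ⟨hx, hgx⟩
    exact ⟨L.smul_mem k hx, by rw [map_zsmul, hgx]⟩

/-- `ann_L(X) = {x ∈ L | (x, y) = 0 for all y ∈ X}`. -/
def annLattice (L X : Submodule ℤ V) : Submodule ℤ V where
  carrier := {x | x ∈ L ∧ ∀ y ∈ X, inner ℝ x y = 0}
  zero_mem' := ⟨L.zero_mem, fun y _ => inner_zero_left y⟩
  add_mem' := by
    rintro x y ⟨hx, hxz⟩ ⟨hy, hyz⟩
    refine ⟨L.add_mem hx hy, fun z hz => ?_⟩
    rw [inner_add_left, hxz z hz, hyz z hz, add_zero]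
  smul_mem' := by
    rintro k x ⟨hx, hxz⟩
    refine ⟨L.smul_mem k hx, fun z hz => ?_⟩
    rw [← Int.cast_smul_eq_zsmul ℝ k x, real_inner_smul_left, hxz z hz, mul_zero]

/-- `J = ann_L(Fix_L(g))` with `g = t_M t_N`. -/
noncomputable def latticeJ [FiniteDimensional ℝ V] (L M N : Submodule ℤ V) : Submodule ℤ V :=
  annLattice L (fixLattice L (tInv M * tInv N))

end Pairs

/-! ### The Coxeter–Todd lattice -/

section CoxeterTodd

/-- `ω = (-1 + √-3) / 2`. -/
noncomputable def omega : ℂ := ⟨-1 / 2, Real.sqrt 3 / 2⟩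

/-- The additive group of the Eisenstein integers `ℤ[ω] = ℤ + ℤω`. -/
noncomputable def eisenstein : AddSubgroup ℂ where
  carrier := {z | ∃ a b : ℤ, z = a + b * omega}
  zero_mem' := ⟨0, 0, by simp⟩
  add_mem' := by
    rintro _ _ ⟨a, b, rfl⟩ ⟨c, d, rfl⟩
    exact ⟨a + c, b + d, by push_cast; ring⟩
  neg_mem' := by
    rintro _ ⟨a, b, rfl⟩
    exact ⟨-a, -b, by push_cast; ring⟩

/-- A lift to `ℤ[ω]` of a generator matrix of the hexacode, the `[6,3,4]` code over
`𝔽₄ = ℤ[ω]/2ℤ[ω]`. -/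
noncomputable def hexacodeGen : Matrix (Fin 3) (Fin 6) ℂ :=
  !![1, 1, 1, 1, 0, 0;
     0, 0, 1, 1, 1, 1;
     1, omega, 0, omega ^ 2, 0, omega ^ 2]

/-- The Coxeter–Todd lattice `K₁₂`: the vectors of `ℤ[ω]⁶` whose reduction modulo `2` lies in
the hexacode, that is, which are congruent modulo `2ℤ[ω]⁶` to a `ℤ[ω]`-combination of the rows
of `hexacodeGen`. -/
noncomputable def coxeterTodd : AddSubgroup (Fin 6 → ℂ) where
  carrier := {x | ∃ c : Fin 3 → ℂ, ∃ y : Fin 6 → ℂ, (∀ i, c i ∈ eisenstein) ∧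
    (∀ j, y j ∈ eisenstein) ∧ x = Matrix.vecMul c hexacodeGen + (2 : ℂ) • y}
  zero_mem' := ⟨0, 0, fun _ => eisenstein.zero_mem, fun _ => eisenstein.zero_mem, by simp⟩
  add_mem' := by
    rintro _ _ ⟨c, y, hc, hy, rfl⟩ ⟨d, z, hd, hz, rfl⟩
    refine ⟨c + d, y + z, fun i => eisenstein.add_mem (hc i) (hd i),
      fun j => eisenstein.add_mem (hy j) (hz j), ?_⟩
    rw [Matrix.add_vecMul, smul_add]
    abel
  neg_mem' := by
    rintro _ ⟨c, y, hc, hy, rfl⟩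
    refine ⟨-c, -y, fun i => eisenstein.neg_mem (hc i), fun j => eisenstein.neg_mem (hy j), ?_⟩
    rw [Matrix.neg_vecMul, smul_neg]
    abel

/-- The real part of the standard Hermitian inner product of `ℂ⁶`. -/
noncomputable def hermForm (x y : Fin 6 → ℂ) : ℝ :=
  (∑ i, x i * (starRingEnd ℂ) (y i)).re

/-- `J` is isometric to the Coxeter–Todd lattice. -/
def IsCoxeterTodd {V : Type*} [NormedAddCommGroup V] [InnerProductSpace ℝ V]
    (J : Submodule ℤ V) : Prop :=
  ∃ e : J ≃+ coxeterTodd,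
    ∀ x y : J, hermForm (e x : Fin 6 → ℂ) (e y : Fin 6 → ℂ) = inner ℝ (x : V) (y : V)

end CoxeterTodd

end DihSix

/-! Everything about `Q` is forced by a few inner products, so `Q` and `J` are identified with
explicit integral models and the group theory is done there.

Rigidity. Since `E₈` is unimodular, `x - t_M x` lies in `M` for every `x` in `L`
(`IsRootlessIntegral.sub_tInv_mem`), and likewise for `N`. Write `F` for the vectors of `M` fixed by
`g` (`fixedPart`); it has rank 2. The operator `1 + g + g²` maps `M` into `F` and multiplies inner
products with `F` by 3. As `F` is primitive in `M`, this gives `3F* ⊆ F` for the form of `E₈`, and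
an even binary form with this property has determinant 3. So `F` is a copy of `√2A₂`. By
transitivity of `O(E₈)` on pairs of roots with inner product 1, coordinates on `M` can be chosen so
that `F` is spanned by the highest root and the simple root next to it in the extended diagram; the
complement is `E₆`. Absence of short vectors gives `F ≤ N`, hence `gM ≤ N`, so `Q = M + gM`, with a
Gram matrix independent of all choices (`inner_pairMap`).

`J` lies in `Q`. If `z ∈ L` and `(1 + g + g²)z = 0`, then `3z` is expressed through two vectors of
`E₆` whose difference is isotropic modulo 3. A nonzero isotropic class modulo `3E₆*` is represented
by a difference of two roots with inner product `-1`, and would produce a vector of norm 2 in `L`.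
So the class is zero and `z ∈ Q`.

The model. `Q` is glued from an `A₂`-part and `J` along a group of order 3, and `J` is `A₂ ⊗ E₆ ∩
3(A₂ ⊗ E₆)*` with the form divided by 3. A basis with Hermitian Gram matrix `2E₆` inside the
Coxeter–Todd lattice identifies `J` with `K₁₂`.

The groups. Vectors of norm 4 in `Q` with even products with all of `Q` are orthogonal to `J` and
span its complement, so `O(Q)` preserves `J`. The sublattice `J ∩ 3Q*` is `√3(A₂ ⊗ E₆)` and is
preserved as well. Its minimal vectors lie in three copies of `√2E₆`, which every isometry permutes,
so every isometry is a tensor product. Conversely a tensor product acts by a sign on the glue group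
and extends to `Q`. This gives the image `O(A₂) ∘ O(E₆)`. An isometry that is trivial on `J`
permutes the three glue vectors of norm 4 over a fixed glue class, and this gives the kernel `Sym₃`.
-/

namespace DihSix

open Matrix

/-! ### Integral quadratic forms -/

/-- The bilinear form on `ℤⁿ` with Gram matrix `C`. -/
def gramForm {n : ℕ} (C : Matrix (Fin n) (Fin n) ℤ) (x y : Fin n → ℤ) : ℤ :=
  x ⬝ᵥ C *ᵥ y

section gramForm

variable {n : ℕ} (C : Matrix (Fin n) (Fin n) ℤ)

theorem gramForm_add_left (x y z : Fin n → ℤ) :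
    gramForm C (x + y) z = gramForm C x z + gramForm C y z := by
  simp [gramForm, add_dotProduct]

theorem gramForm_add_right (x y z : Fin n → ℤ) :
    gramForm C x (y + z) = gramForm C x y + gramForm C x z := by
  simp [gramForm, mulVec_add, dotProduct_add]

theorem gramForm_smul_left (k : ℤ) (x y : Fin n → ℤ) :
    gramForm C (k • x) y = k * gramForm C x y := by
  rw [gramForm, smul_dotProduct, smul_eq_mul, gramForm]

theorem gramForm_smul_right (k : ℤ) (x y : Fin n → ℤ) :
    gramForm C x (k • y) = k * gramForm C x y := by
  rw [gramForm, mulVec_smul, dotProduct_smul, smul_eq_mul, gramForm]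

theorem gramForm_neg_left (x y : Fin n → ℤ) : gramForm C (-x) y = -gramForm C x y := by
  simp [gramForm]

theorem gramForm_neg_right (x y : Fin n → ℤ) : gramForm C x (-y) = -gramForm C x y := by
  simp [gramForm, mulVec_neg]

theorem gramForm_sub_left (x y z : Fin n → ℤ) :
    gramForm C (x - y) z = gramForm C x z - gramForm C y z := by
  simp [gramForm, sub_dotProduct]

theorem gramForm_sub_right (x y z : Fin n → ℤ) :
    gramForm C x (y - z) = gramForm C x y - gramForm C x z := by
  simp [gramForm, mulVec_sub, dotProduct_sub]

@[simp]
theorem gramForm_zero_left (x : Fin n → ℤ) : gramForm C 0 x = 0 := by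
  simp [gramForm]

variable {C}

theorem gramForm_comm (hC : Cᵀ = C) (x y : Fin n → ℤ) : gramForm C x y = gramForm C y x := by
  rw [gramForm, dotProduct_comm, ← hC, mulVec_transpose, ← dotProduct_mulVec, hC, gramForm]

theorem gramForm_single_left (i : Fin n) (x : Fin n → ℤ) :
    gramForm C (Pi.single i 1) x = (C *ᵥ x) i := by
  simp [gramForm]

theorem gramForm_single_single (i j : Fin n) :
    gramForm C (Pi.single i 1) (Pi.single j 1) = C i j := by
  simp [gramForm]

theorem gramForm_gramO (f : gramO C) (x y : Fin n → ℤ) :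
    gramForm C (f.1 x) (f.1 y) = gramForm C x y :=
  f.2 x y

/-- The reflection in a vector of norm `2`. -/
def rootReflection (hC : Cᵀ = C) (r : Fin n → ℤ) (hr : gramForm C r r = 2) : gramO C :=
  ⟨LinearEquiv.ofInvolutive
    { toFun := fun x => x - gramForm C x r • r
      map_add' := fun x y => by rw [gramForm_add_left, add_smul]; abel
      map_smul' := fun k x => by
        simp only [gramForm_smul_left, RingHom.id_apply, smul_sub, smul_smul] }
    (fun x => by
      simp only [LinearMap.coe_mk, AddHom.coe_mk, gramForm_sub_left, gramForm_smul_left, hr]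
      module),
   fun x y => by
    change gramForm C (x - gramForm C x r • r) (y - gramForm C y r • r) = gramForm C x y
    rw [gramForm_sub_left, gramForm_sub_right, gramForm_sub_right, gramForm_smul_left,
      gramForm_smul_right, gramForm_smul_left, gramForm_smul_right, hr, gramForm_comm hC r y]
    ring⟩

theorem rootReflection_apply (hC : Cᵀ = C) (r : Fin n → ℤ) (hr : gramForm C r r = 2)
    (x : Fin n → ℤ) : (rootReflection hC r hr).1 x = x - gramForm C x r • r :=
  rfl

/-- No term of the double sum is negative, so a single diagonal term is a lower bound. Applied to
inverse Cartan matrices, this limits the dominant vectors of small norm. -/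
theorem diag_mul_sq_le {D : Matrix (Fin n) (Fin n) ℤ} (hD : ∀ i j, 0 ≤ D i j) {k : Fin n → ℤ}
    (hk : ∀ i, 0 ≤ k i) (i : Fin n) : D i i * k i ^ 2 ≤ gramForm D k k := by
  have h1 : ∀ a, 0 ≤ k a * (D *ᵥ k) a := fun a =>
    mul_nonneg (hk a) (by
      rw [mulVec, dotProduct]
      exact Finset.sum_nonneg fun b _ => mul_nonneg (hD a b) (hk b))
  calc D i i * k i ^ 2 = k i * (D i i * k i) := by ring
    _ ≤ k i * (D *ᵥ k) i := by
      refine mul_le_mul_of_nonneg_left ?_ (hk i)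
      exact Finset.single_le_sum (f := fun b => D i b * k b)
        (fun b _ => mul_nonneg (hD i b) (hk b)) (Finset.mem_univ i)
    _ ≤ _ := Finset.single_le_sum (f := fun a => k a * (D *ᵥ k) a) (fun a _ => h1 a)
        (Finset.mem_univ i)

theorem eq_zero_of_gramForm_lt {D : Matrix (Fin n) (Fin n) ℤ} (hD : ∀ i j, 0 ≤ D i j)
    {k : Fin n → ℤ} (hk : ∀ i, 0 ≤ k i) {i : Fin n} (h : gramForm D k k < D i i) : k i = 0 := by
  by_contra h0
  have h1 : 1 ≤ k i := by have := hk i; omega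
  have h2 := diag_mul_sq_le hD hk i
  have h3 := hD i i
  nlinarith [mul_nonneg h3 (by nlinarith : (0 : ℤ) ≤ k i ^ 2 - 1)]

theorem le_one_of_gramForm_lt {D : Matrix (Fin n) (Fin n) ℤ} (hD : ∀ i j, 0 ≤ D i j)
    {k : Fin n → ℤ} (hk : ∀ i, 0 ≤ k i) {i : Fin n} (h : gramForm D k k < 4 * D i i) :
    k i ≤ 1 := by
  by_contra h0
  have h1 : 2 ≤ k i := by omega
  have h2 := diag_mul_sq_le hD hk i
  have h3 := hD i i
  nlinarith [mul_nonneg h3 (by nlinarith : (0 : ℤ) ≤ k i ^ 2 - 4)]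

end gramForm

/-! ### The root lattice `E₈` -/

section E8

open CartanMatrix

theorem E₈_transpose : E₈ᵀ = E₈ := by decide

theorem E₆_transpose : E₆ᵀ = E₆ := by decide

theorem gramForm_E₈ (x y : Fin 8 → ℤ) : gramForm E₈ x y =
    x 0 * (2 * y 0 - y 2) + x 1 * (2 * y 1 - y 3) + x 2 * (2 * y 2 - y 0 - y 3)
    + x 3 * (2 * y 3 - y 1 - y 2 - y 4) + x 4 * (2 * y 4 - y 3 - y 5)
    + x 5 * (2 * y 5 - y 4 - y 6) + x 6 * (2 * y 6 - y 5 - y 7) + x 7 * (2 * y 7 - y 6) := by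
  simp [gramForm, E₈, dotProduct, mulVec, Fin.sum_univ_eight]
  ring

theorem gramForm_E₆ (x y : Fin 6 → ℤ) : gramForm E₆ x y =
    x 0 * (2 * y 0 - y 2) + x 1 * (2 * y 1 - y 3) + x 2 * (2 * y 2 - y 0 - y 3)
    + x 3 * (2 * y 3 - y 1 - y 2 - y 4) + x 4 * (2 * y 4 - y 3 - y 5)
    + x 5 * (2 * y 5 - y 4) := by
  simp [gramForm, E₆, dotProduct, mulVec, Fin.sum_univ_six]
  ring

theorem even_gramForm_E₈ (x : Fin 8 → ℤ) : Even (gramForm E₈ x x) := by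
  rw [gramForm_E₈]
  exact ⟨x 0 ^ 2 + x 1 ^ 2 + x 2 ^ 2 + x 3 ^ 2 + x 4 ^ 2 + x 5 ^ 2 + x 6 ^ 2 + x 7 ^ 2
    - x 0 * x 2 - x 1 * x 3 - x 2 * x 3 - x 3 * x 4 - x 4 * x 5 - x 5 * x 6 - x 6 * x 7, by ring⟩

theorem even_gramForm_E₆ (x : Fin 6 → ℤ) : Even (gramForm E₆ x x) := by
  rw [gramForm_E₆]
  exact ⟨x 0 ^ 2 + x 1 ^ 2 + x 2 ^ 2 + x 3 ^ 2 + x 4 ^ 2 + x 5 ^ 2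
    - x 0 * x 2 - x 1 * x 3 - x 2 * x 3 - x 3 * x 4 - x 4 * x 5, by ring⟩

/-- Squares are completed from the ends of the Dynkin diagram towards the branch node 3. -/
theorem gramForm_E₈_sos (x : Fin 8 → ℤ) : 60 * gramForm E₈ x x =
    30 * (2 * x 0 - x 2) ^ 2 + 30 * (2 * x 1 - x 3) ^ 2 + 10 * (3 * x 2 - 2 * x 3) ^ 2
    + 30 * (2 * x 7 - x 6) ^ 2 + 10 * (3 * x 6 - 2 * x 5) ^ 2 + 5 * (4 * x 5 - 3 * x 4) ^ 2
    + 3 * (5 * x 4 - 4 * x 3) ^ 2 + 2 * x 3 ^ 2 := by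
  rw [gramForm_E₈]; ring

theorem gramForm_E₆_sos (x : Fin 6 → ℤ) : 6 * gramForm E₆ x x =
    3 * (2 * x 0 - x 2) ^ 2 + 3 * (2 * x 1 - x 3) ^ 2 + (3 * x 2 - 2 * x 3) ^ 2
    + 3 * (2 * x 5 - x 4) ^ 2 + (3 * x 4 - 2 * x 3) ^ 2 + x 3 ^ 2 := by
  rw [gramForm_E₆]; ring

theorem gramForm_E₈_nonneg (x : Fin 8 → ℤ) : 0 ≤ gramForm E₈ x x := by
  have h : 0 ≤ 60 * gramForm E₈ x x := by rw [gramForm_E₈_sos]; positivity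
  omega

theorem gramForm_E₆_nonneg (x : Fin 6 → ℤ) : 0 ≤ gramForm E₆ x x := by
  have h : 0 ≤ 6 * gramForm E₆ x x := by rw [gramForm_E₆_sos]; positivity
  omega

theorem gramForm_E₆_eq_zero {x : Fin 6 → ℤ} (h : gramForm E₆ x x = 0) : x = 0 := by
  have h1 := gramForm_E₆_sos x
  rw [h] at h1
  have n0 := sq_nonneg (2 * x 0 - x 2)
  have n1 := sq_nonneg (2 * x 1 - x 3)
  have n2 := sq_nonneg (3 * x 2 - 2 * x 3)
  have n3 := sq_nonneg (x 3)
  have n4 := sq_nonneg (3 * x 4 - 2 * x 3)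
  have n5 := sq_nonneg (2 * x 5 - x 4)
  have h0 : (2 * x 0 - x 2) ^ 2 = 0 := by linarith
  have h2 : (2 * x 1 - x 3) ^ 2 = 0 := by linarith
  have h3 : (3 * x 2 - 2 * x 3) ^ 2 = 0 := by linarith
  have h4 : x 3 ^ 2 = 0 := by linarith
  have h5 : (3 * x 4 - 2 * x 3) ^ 2 = 0 := by linarith
  have h6 : (2 * x 5 - x 4) ^ 2 = 0 := by linarith
  rw [sq_eq_zero_iff] at h0 h2 h3 h4 h5 h6
  clear h h1 n0 n1 n2 n3 n4 n5
  ext i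
  fin_cases i <;> simp <;> omega

theorem two_le_gramForm_E₆ {x : Fin 6 → ℤ} (hx : x ≠ 0) : 2 ≤ gramForm E₆ x x := by
  obtain ⟨k, hk⟩ := even_gramForm_E₆ x
  have h0 := gramForm_E₆_nonneg x
  have h1 : gramForm E₆ x x ≠ 0 := fun h => hx (gramForm_E₆_eq_zero h)
  omega

/-- The inverse of the Cartan matrix of `E₈`. -/
def E₈Inv : Matrix (Fin 8) (Fin 8) ℤ :=
  !![4, 5, 7, 10, 8, 6, 4, 2;
     5, 8, 10, 15, 12, 9, 6, 3;
     7, 10, 14, 20, 16, 12, 8, 4;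
     10, 15, 20, 30, 24, 18, 12, 6;
     8, 12, 16, 24, 20, 15, 10, 5;
     6, 9, 12, 18, 15, 12, 8, 4;
     4, 6, 8, 12, 10, 8, 6, 3;
     2, 3, 4, 6, 5, 4, 3, 2]

theorem E₈Inv_mul : E₈Inv * E₈ = 1 := by decide +kernel

theorem E₈_mul_E₈Inv : E₈ * E₈Inv = 1 := by decide +kernel

/-- Twice the inverse of the Cartan matrix of `E₇`. -/
def E₇TwoInv : Matrix (Fin 7) (Fin 7) ℤ :=
  !![4, 4, 6, 8, 6, 4, 2;
     4, 7, 8, 12, 9, 6, 3;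
     6, 8, 12, 16, 12, 8, 4;
     8, 12, 16, 24, 18, 12, 6;
     6, 9, 12, 18, 15, 10, 5;
     4, 6, 8, 12, 10, 8, 4;
     2, 3, 4, 6, 5, 4, 3]

/-- The highest root of `E₈` in the basis of simple roots. -/
def E₈Highest : Fin 8 → ℤ := ![2, 3, 4, 6, 5, 4, 3, 2]

/-- The Weyl vector of `E₈` in the basis of simple roots. -/
def E₈Weyl : Fin 8 → ℤ := ![46, 68, 91, 135, 110, 84, 57, 29]

theorem gramForm_E₈Weyl (i : Fin 8) : gramForm E₈ E₈Weyl (Pi.single i 1) = 1 := by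
  revert i; decide +kernel

theorem E₈_diag (i : Fin 8) : gramForm E₈ (Pi.single i 1) (Pi.single i 1) = 2 := by
  revert i; decide +kernel

/-- In terms of the products `k` with the simple roots, the norm is the form of `E₈Inv` at `k`. All
its diagonal entries exceed 2 except the last, which equals 2, so `k` is the last unit vector. -/
theorem eq_E₈Highest_of_dominant {r : Fin 8 → ℤ} (hr : gramForm E₈ r r = 2)
    (hd : ∀ i, 0 ≤ (E₈ *ᵥ r) i) : r = E₈Highest := by
  have hD : ∀ i j : Fin 8, (0 : ℤ) ≤ E₈Inv i j := by
    intro i j; revert i; revert j; decide +kernel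
  have hinv : E₈Inv *ᵥ (E₈ *ᵥ r) = r := by rw [mulVec_mulVec, E₈Inv_mul, one_mulVec]
  set k := E₈ *ᵥ r with hkdef
  have hk : gramForm E₈Inv k k = 2 := by
    rw [gramForm, hinv, dotProduct_comm]; exact hr
  have hz : ∀ i, 2 < E₈Inv i i → k i = 0 := fun i hi =>
    eq_zero_of_gramForm_lt hD hd (by rw [hk]; exact hi)
  have h7 : k 7 ≤ 1 := le_one_of_gramForm_lt hD hd (by rw [hk]; decide)
  have hk' : k = k 7 • Pi.single 7 1 := by
    ext i
    by_cases hi : i = 7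
    · subst hi; simp
    · have hi' : 2 < E₈Inv i i := by revert i; decide +kernel
      simp [hz i hi', hi]
  have h70 := hd 7
  have h71 : k 7 = 1 := by
    by_contra hne
    have h0 : k 7 = 0 := by omega
    rw [h0, zero_smul] at hk'
    rw [hk'] at hk
    simp at hk
  rw [← hinv, hk', h71]
  decide +kernel

/-- The coefficient `s 7` is the product with the highest root. Projecting to its complement, of
type `E₇`, leaves norm `2 - 1/2`, so the form of `E₇TwoInv` takes the value 3. Only the last
diagonal entry is that small, and the projection is the minuscule weight. -/
theorem eq_E₈Highest_sub_of_dominant {s : Fin 8 → ℤ} (hs : gramForm E₈ s s = 2) (h7 : s 7 = 1)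
    (hd : ∀ i : Fin 7, 0 ≤ (E₈ *ᵥ s) i.castSucc) : s = E₈Highest - Pi.single 7 1 := by
  have hD : ∀ i j : Fin 7, (0 : ℤ) ≤ E₇TwoInv i j := by
    intro i j; revert i; revert j; decide +kernel
  set k : Fin 7 → ℤ := fun i => (E₈ *ᵥ s) i.castSucc with hkdef
  have hkv : k = ![2 * s 0 - s 2, 2 * s 1 - s 3, 2 * s 2 - s 0 - s 3,
      2 * s 3 - s 1 - s 2 - s 4, 2 * s 4 - s 3 - s 5, 2 * s 5 - s 4 - s 6,
      2 * s 6 - s 5 - s 7] := by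
    ext i
    fin_cases i <;> simp [hkdef, E₈, mulVec, dotProduct, Fin.sum_univ_eight] <;> ring
  have hk : gramForm E₇TwoInv k k = 3 := by
    have h : gramForm E₇TwoInv k k = 2 * gramForm E₈ s s - s 7 ^ 2 := by
      rw [hkv, gramForm_E₈]
      simp [gramForm, E₇TwoInv, dotProduct, mulVec, Fin.sum_univ_seven]
      ring
    rw [h, hs, h7]; norm_num
  have hz : ∀ i, 3 < E₇TwoInv i i → k i = 0 := fun i hi =>
    eq_zero_of_gramForm_lt hD hd (by rw [hk]; exact hi)
  have h6 : k 6 ≤ 1 := le_one_of_gramForm_lt hD hd (by rw [hk]; decide)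
  have h60 : 0 ≤ k 6 := hd 6
  have e0 := hz 0 (by decide)
  have e1 := hz 1 (by decide)
  have e2 := hz 2 (by decide)
  have e3 := hz 3 (by decide)
  have e4 := hz 4 (by decide)
  have e5 := hz 5 (by decide)
  have e6 : k 6 = 1 := by
    by_contra hne
    have h0 : k 6 = 0 := by omega
    have : k = 0 := by
      ext i
      fin_cases i
      exacts [e0, e1, e2, e3, e4, e5, h0]
    rw [this] at hk
    simp at hk
  have g0 := congrFun hkv 0
  have g1 := congrFun hkv 1
  have g2 := congrFun hkv 2
  have g3 := congrFun hkv 3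
  have g4 := congrFun hkv 4
  have g5 := congrFun hkv 5
  have g6 := congrFun hkv 6
  simp only [e0, e1, e2, e3, e4, e5, e6] at g0 g1 g2 g3 g4 g5 g6
  simp at g0 g1 g2 g3 g4 g5 g6
  clear hk hkv hz hs hD hd
  clear_value k
  have e : s = ![s 0, s 1, s 2, s 3, s 4, s 5, s 6, s 7] := by
    ext i; fin_cases i <;> rfl
  have f : s 0 = 2 ∧ s 1 = 3 ∧ s 2 = 4 ∧ s 3 = 6 ∧ s 4 = 5 ∧ s 5 = 4 ∧ s 6 = 3 := by omega
  obtain ⟨f0, f1, f2, f3, f4, f5, f6⟩ := f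
  rw [e, f0, f1, f2, f3, f4, f5, f6, h7]
  decide +kernel

/-- Reflecting in simple roots with index in `T`, a root can be made dominant with respect
to `T`. -/
theorem exists_dominant (T : Set (Fin 8)) (r : Fin 8 → ℤ) : ∃ k : gramO E₈,
    (∀ x, (∀ i ∈ T, (E₈ *ᵥ x) i = 0) → k.1 x = x) ∧ ∀ i ∈ T, 0 ≤ (E₈ *ᵥ (k.1 r)) i := by
  induction h : (gramForm E₈ (E₈Weyl - r) (E₈Weyl - r)).toNat using Nat.strong_induction_on
    generalizing r with
  | _ n ih =>
  by_cases hd : ∀ i ∈ T, 0 ≤ (E₈ *ᵥ r) i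
  · exact ⟨1, fun _ _ => rfl, hd⟩
  · push Not at hd
    obtain ⟨i, hi, hneg⟩ := hd
    set s := rootReflection E₈_transpose (Pi.single i 1) (E₈_diag i) with hs
    have hri : gramForm E₈ r (Pi.single i 1) = (E₈ *ᵥ r) i := by
      rw [gramForm_comm E₈_transpose, gramForm_single_left]
    -- The reflection keeps the norm of `r` and raises its product with the Weyl vector, because `r`
    -- pairs negatively with the simple root. So the distance to the Weyl vector drops.
    have hlt : gramForm E₈ (E₈Weyl - s.1 r) (E₈Weyl - s.1 r) <
        gramForm E₈ (E₈Weyl - r) (E₈Weyl - r) := by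
      have e1 : gramForm E₈ (s.1 r) (s.1 r) = gramForm E₈ r r := gramForm_gramO s r r
      have e2 : gramForm E₈ E₈Weyl (s.1 r) = gramForm E₈ E₈Weyl r - (E₈ *ᵥ r) i := by
        rw [hs, rootReflection_apply, gramForm_sub_right, gramForm_smul_right, gramForm_E₈Weyl,
          hri, mul_one]
      rw [gramForm_sub_left, gramForm_sub_right, gramForm_sub_right, e1,
        gramForm_comm E₈_transpose (s.1 r) E₈Weyl, e2, gramForm_sub_left, gramForm_sub_right,
        gramForm_sub_right, gramForm_comm E₈_transpose r E₈Weyl]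
      linarith
    have h0 := gramForm_E₈_nonneg (E₈Weyl - s.1 r)
    obtain ⟨k, hk1, hk2⟩ := ih _ (by omega) (s.1 r) rfl
    refine ⟨k * s, fun x hx => ?_, hk2⟩
    have : s.1 x = x := by
      rw [hs, rootReflection_apply, gramForm_comm E₈_transpose, gramForm_single_left, hx i hi,
        zero_smul, sub_zero]
    change k.1 (s.1 x) = x
    rw [this, hk1 x hx]

theorem E₈_mulVec_highest (i : Fin 7) : (E₈ *ᵥ E₈Highest) i.castSucc = 0 := by
  revert i; decide +kernel

theorem gramForm_E₈Highest (x : Fin 8 → ℤ) : gramForm E₈ E₈Highest x = x 7 := by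
  rw [gramForm_E₈]; simp [E₈Highest]; ring

/-- `O(E₈)` is transitive on ordered pairs of roots with inner product `1`. -/
theorem exists_gramO_E₈_map_eq {r s : Fin 8 → ℤ} (hr : gramForm E₈ r r = 2)
    (hs : gramForm E₈ s s = 2) (hrs : gramForm E₈ r s = 1) :
    ∃ k : gramO E₈, k.1 E₈Highest = r ∧ k.1 (E₈Highest - Pi.single 7 1) = s := by
  obtain ⟨k, -, hk⟩ := exists_dominant Set.univ r
  have hkr : k.1 r = E₈Highest :=
    eq_E₈Highest_of_dominant ((gramForm_gramO k r r).trans hr) fun i => hk i trivial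
  -- Only the simple roots of `E₇`, all orthogonal to the highest root, are used here, so the image
  -- of `r` is not disturbed.
  obtain ⟨l, hl1, hl2⟩ := exists_dominant (Set.range Fin.castSucc) (k.1 s)
  have hlθ : l.1 E₈Highest = E₈Highest := hl1 _ (by
    rintro _ ⟨i, rfl⟩
    exact E₈_mulVec_highest i)
  have h7 : (l.1 (k.1 s)) 7 = 1 := by
    rw [← gramForm_E₈Highest (l.1 (k.1 s)), ← hlθ, gramForm_gramO, ← hkr, gramForm_gramO, hrs]
  have hls : l.1 (k.1 s) = E₈Highest - Pi.single 7 1 :=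
    eq_E₈Highest_sub_of_dominant (by rw [gramForm_gramO, gramForm_gramO, hs]) h7
      fun i => hl2 _ ⟨i, rfl⟩
  refine ⟨(l * k)⁻¹, ?_, ?_⟩
  · change (l.1 * k.1)⁻¹ E₈Highest = r
    rw [← hlθ, ← hkr]
    exact (l.1 * k.1).symm_apply_apply r
  · rw [← hls]
    exact (l.1 * k.1).symm_apply_apply s

end E8

open CartanMatrix

/-! ### Isometries as matrices -/

section GramMatrix

variable {n : ℕ} {C : Matrix (Fin n) (Fin n) ℤ}

theorem eq_of_forall_gramForm {D : Matrix (Fin n) (Fin n) ℤ}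
    (h : ∀ x y, gramForm C x y = gramForm D x y) : C = D := by
  ext i j
  rw [← gramForm_single_single (C := C) i j, h, gramForm_single_single]

theorem gramForm_mulVec (M : Matrix (Fin n) (Fin n) ℤ) (x y : Fin n → ℤ) :
    gramForm C (M *ᵥ x) (M *ᵥ y) = gramForm (Mᵀ * C * M) x y := by
  simp only [gramForm, ← mulVec_mulVec, dotProduct_mulVec, vecMul_transpose]

theorem transpose_mul_mul_eq_of_forall {M : Matrix (Fin n) (Fin n) ℤ}
    (h : ∀ x y, gramForm C (M *ᵥ x) (M *ᵥ y) = gramForm C x y) : Mᵀ * C * M = C :=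
  eq_of_forall_gramForm fun x y => by rw [← gramForm_mulVec, h]

/-- The matrix of an isometry of `ℤⁿ`. -/
def gramOMatrix (C : Matrix (Fin n) (Fin n) ℤ) : gramO C →* Matrix (Fin n) (Fin n) ℤ where
  toFun f := LinearMap.toMatrix' f.1.toLinearMap
  map_one' := LinearMap.toMatrix'_id
  map_mul' f g := LinearMap.toMatrix'_comp f.1.toLinearMap g.1.toLinearMap

theorem gramOMatrix_mulVec (f : gramO C) (x : Fin n → ℤ) : gramOMatrix C f *ᵥ x = f.1 x :=
  LinearMap.toMatrix'_mulVec f.1.toLinearMap x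

theorem gramOMatrix_isometry (f : gramO C) : (gramOMatrix C f)ᵀ * C * gramOMatrix C f = C :=
  transpose_mul_mul_eq_of_forall fun x y => by
    rw [gramOMatrix_mulVec, gramOMatrix_mulVec, gramForm_gramO]

theorem gramOMatrix_injective : Function.Injective (gramOMatrix C) := by
  intro f g h
  apply Subtype.ext
  ext1 x
  rw [← gramOMatrix_mulVec, ← gramOMatrix_mulVec, h]

theorem gramOMatrix_mul_inv (f : gramO C) : gramOMatrix C f * gramOMatrix C f⁻¹ = 1 := by
  rw [← map_mul, mul_inv_cancel, map_one]

theorem gramOMatrix_gramNeg : gramOMatrix C (gramNeg C) = -1 := by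
  have h : ∀ x, gramOMatrix C (gramNeg C) *ᵥ x = -x := fun x => gramOMatrix_mulVec _ x
  ext i j
  have := congrFun (h (Pi.single j 1)) i
  simpa [Matrix.one_apply, Pi.single_apply] using this

theorem exists_gramO_of_matrix (hC : C.det ≠ 0) {M : Matrix (Fin n) (Fin n) ℤ}
    (hM : Mᵀ * C * M = C) : ∃ f : gramO C, gramOMatrix C f = M := by
  have hdet : IsUnit M.det := by
    have h := congrArg det hM
    rw [det_mul, det_mul, det_transpose] at h
    have h1 : M.det * M.det = 1 := by
      apply mul_left_cancel₀ hC
      linarith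
    exact IsUnit.of_mul_eq_one _ h1
  have hMM : M * M⁻¹ = 1 := mul_nonsing_inv M hdet
  have hMM' : M⁻¹ * M = 1 := nonsing_inv_mul M hdet
  let f : (Fin n → ℤ) ≃ₗ[ℤ] (Fin n → ℤ) := Matrix.toLin'OfInv hMM' hMM
  have hf : ∀ x, f x = M *ᵥ x := fun x => toLin'_apply M x
  refine ⟨⟨f, ?_⟩, ?_⟩
  · intro x y
    have := gramForm_mulVec (C := C) M x y
    rw [hM, ← hf, ← hf] at this
    exact this
  · have : f.toLinearMap = Matrix.toLin' M := LinearMap.ext hf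
    change LinearMap.toMatrix' f.toLinearMap = M
    rw [this, LinearMap.toMatrix'_toLin']

end GramMatrix

/-! ### The lattice `A₂ ⊗ E₆` -/

section Tensor

theorem A₂_eq : A 2 = !![2, -1; -1, 2] := by decide

theorem A₂_transpose : (A 2)ᵀ = A 2 := by decide

theorem det_A₂ : (A 2).det ≠ 0 := by decide

/-- Three times the inverse of the Cartan matrix of `E₆`. -/
def E₆ThreeInv : Matrix (Fin 6) (Fin 6) ℤ :=
  !![4, 3, 5, 6, 4, 2;
     3, 6, 6, 9, 6, 3;
     5, 6, 10, 12, 8, 4;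
     6, 9, 12, 18, 12, 6;
     4, 6, 8, 12, 10, 5;
     2, 3, 4, 6, 5, 4]

theorem E₆_mul_threeInv : E₆ * E₆ThreeInv = (3 : ℤ) • (1 : Matrix (Fin 6) (Fin 6) ℤ) := by
  decide +kernel

theorem E₆_threeInv_mul : E₆ThreeInv * E₆ = (3 : ℤ) • (1 : Matrix (Fin 6) (Fin 6) ℤ) := by
  decide +kernel

theorem det_E₆ : E₆.det ≠ 0 := by
  intro h
  have := congrArg det E₆_mul_threeInv
  rw [det_mul, h, zero_mul, det_smul, det_one] at this
  norm_num at this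

/-- The bilinear form of `A₂ ⊗ E₆`, with elements written as `2 × 6` matrices. -/
def tensorForm (Y Y' : Matrix (Fin 2) (Fin 6) ℤ) : ℤ := (Yᵀ * A 2 * Y' * E₆).trace

theorem tensorForm_eq_sum (Y Y' : Matrix (Fin 2) (Fin 6) ℤ) :
    tensorForm Y Y' = ∑ a, ∑ i, Y a i * (A 2 * Y' * E₆) a i := by
  rw [tensorForm, Matrix.mul_assoc, Matrix.mul_assoc, trace, Finset.sum_comm (s := Finset.univ)]
  refine Finset.sum_congr rfl fun i _ => ?_
  rw [diag_apply, Matrix.mul_apply, Matrix.mul_assoc]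
  rfl

theorem tensorForm_add_left (X Y Z : Matrix (Fin 2) (Fin 6) ℤ) :
    tensorForm (X + Y) Z = tensorForm X Z + tensorForm Y Z := by
  simp [tensorForm, Matrix.add_mul]

theorem tensorForm_add_right (X Y Z : Matrix (Fin 2) (Fin 6) ℤ) :
    tensorForm X (Y + Z) = tensorForm X Y + tensorForm X Z := by
  simp [tensorForm, Matrix.add_mul, Matrix.mul_add]

theorem tensorForm_smul_left (k : ℤ) (X Y : Matrix (Fin 2) (Fin 6) ℤ) :
    tensorForm (k • X) Y = k * tensorForm X Y := by
  rw [tensorForm, transpose_smul, Matrix.smul_mul, Matrix.smul_mul, Matrix.smul_mul, trace_smul,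
    smul_eq_mul, tensorForm]

theorem tensorForm_smul_right (k : ℤ) (X Y : Matrix (Fin 2) (Fin 6) ℤ) :
    tensorForm X (k • Y) = k * tensorForm X Y := by
  rw [tensorForm, Matrix.mul_smul, Matrix.smul_mul, trace_smul, smul_eq_mul, tensorForm]

theorem tensorForm_vecMulVec (e e' : Fin 2 → ℤ) (x x' : Fin 6 → ℤ) :
    tensorForm (vecMulVec e x) (vecMulVec e' x') = gramForm (A 2) e e' * gramForm E₆ x x' := by
  have h : (vecMulVec e x)ᵀ * A 2 * vecMulVec e' x' * E₆ =
      gramForm (A 2) e e' • vecMulVec x (x' ᵥ* E₆) := by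
    rw [transpose_vecMulVec, vecMulVec_mul, vecMulVec_mul_vecMulVec, vecMulVec_mul,
      ← dotProduct_mulVec]
    rw [smul_vecMul, vecMulVec_smul]
    rfl
  rw [tensorForm, h, trace_smul, trace_vecMulVec, smul_eq_mul, dotProduct_comm,
    ← dotProduct_mulVec, ← gramForm, gramForm_comm E₆_transpose]

theorem matrix_two_eq (Y : Matrix (Fin 2) (Fin 6) ℤ) :
    Y = vecMulVec ![1, 0] (Y 0) + vecMulVec ![0, 1] (Y 1) := by
  ext a i
  rw [Matrix.add_apply, vecMulVec_apply, vecMulVec_apply]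
  fin_cases a <;> simp

/-- The cross term of `A₂` completes to a third square. Short vectors are thereby governed by the
even form of `E₆` alone. -/
theorem tensorForm_self (Y : Matrix (Fin 2) (Fin 6) ℤ) : tensorForm Y Y =
    gramForm E₆ (Y 0) (Y 0) + gramForm E₆ (Y 1) (Y 1) +
      gramForm E₆ (Y 0 - Y 1) (Y 0 - Y 1) := by
  conv_lhs => rw [matrix_two_eq Y]
  have h1 : gramForm (A 2) ![1, 0] ![1, 0] = 2 := by decide
  have h2 : gramForm (A 2) ![1, 0] ![0, 1] = -1 := by decide
  have h3 : gramForm (A 2) ![0, 1] ![1, 0] = -1 := by decide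
  have h4 : gramForm (A 2) ![0, 1] ![0, 1] = 2 := by decide
  simp only [tensorForm_add_left, tensorForm_add_right, tensorForm_vecMulVec, h1, h2, h3, h4,
    gramForm_sub_left, gramForm_sub_right, gramForm_comm E₆_transpose (Y 1) (Y 0)]
  ring

theorem tensorForm_mul_mul {H : Matrix (Fin 2) (Fin 2) ℤ} {K : Matrix (Fin 6) (Fin 6) ℤ}
    (hH : Hᵀ * A 2 * H = A 2) (hK : Kᵀ * E₆ * K = E₆) (Y Y' : Matrix (Fin 2) (Fin 6) ℤ) :
    tensorForm (H * Y * Kᵀ) (H * Y' * Kᵀ) = tensorForm Y Y' := by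
  have h : (H * Y * Kᵀ)ᵀ * A 2 * (H * Y' * Kᵀ) * E₆ =
      K * (Yᵀ * (Hᵀ * A 2 * H) * Y' * (Kᵀ * E₆)) := by
    simp only [transpose_mul, transpose_transpose, Matrix.mul_assoc]
  rw [tensorForm, h, trace_mul_comm, hH, Matrix.mul_assoc, hK, tensorForm]

/-- Three vectors of norm `2` in `A₂` with sum zero. -/
def A₂Triple : Fin 3 → Fin 2 → ℤ := ![![1, 0], ![0, 1], ![-1, -1]]

theorem gramForm_A₂Triple (p q : Fin 3) :
    gramForm (A 2) (A₂Triple p) (A₂Triple q) = if p = q then 2 else -1 := by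
  revert p q; decide +kernel

theorem tensorForm_triple (p q : Fin 3) (x y : Fin 6 → ℤ) :
    tensorForm (vecMulVec (A₂Triple p) x) (vecMulVec (A₂Triple q) y) =
      (if p = q then 2 else -1) * gramForm E₆ x y := by
  rw [tensorForm_vecMulVec, gramForm_A₂Triple]

/-- The norm is a sum of three norms of `E₆`, each zero or at least 2, so the value 4 forces one of
them to vanish. Each vanishing puts `Y` into one of three copies of `√2E₆`. -/
theorem exists_triple_of_tensorForm_eq_four {Y : Matrix (Fin 2) (Fin 6) ℤ}
    (hY : tensorForm Y Y = 4) : ∃ p x, Y = vecMulVec (A₂Triple p) x := by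
  by_cases h0 : Y 0 = 0
  · refine ⟨1, Y 1, ?_⟩
    ext a i
    fin_cases a
    · simpa [vecMulVec_apply, A₂Triple] using congrFun h0 i
    · simp [vecMulVec_apply, A₂Triple]
  by_cases h1 : Y 1 = 0
  · refine ⟨0, Y 0, ?_⟩
    ext a i
    fin_cases a
    · simp [vecMulVec_apply, A₂Triple]
    · simpa [vecMulVec_apply, A₂Triple] using congrFun h1 i
  by_cases h2 : Y 0 - Y 1 = 0
  · refine ⟨2, -Y 0, ?_⟩
    ext a i
    fin_cases a
    · simp [vecMulVec_apply, A₂Triple]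
    · simpa [vecMulVec_apply, A₂Triple] using (congrFun (sub_eq_zero.mp h2) i).symm
  have := two_le_gramForm_E₆ h0
  have := two_le_gramForm_E₆ h1
  have := two_le_gramForm_E₆ h2
  rw [tensorForm_self] at hY
  omega

/-! ### Isometries of `A₂ ⊗ E₆` and the three copies of `√2E₆`. -/

section Isometry

variable {f : Matrix (Fin 2) (Fin 6) ℤ →ₗ[ℤ] Matrix (Fin 2) (Fin 6) ℤ}

theorem exists_map_triple_root (hf : ∀ X Y, tensorForm (f X) (f Y) = tensorForm X Y) (p : Fin 3)
    {x : Fin 6 → ℤ} (hx : gramForm E₆ x x = 2) :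
    ∃ q y, f (vecMulVec (A₂Triple p) x) = vecMulVec (A₂Triple q) y :=
  exists_triple_of_tensorForm_eq_four (by rw [hf, tensorForm_triple, if_pos rfl, hx]; norm_num)

/-- Products inside one copy are even, being twice those of `E₆`, while between different copies
they are minus those of `E₆`. An odd product therefore separates copies, before and after `f`. -/
theorem ne_of_odd_gramForm (hf : ∀ X Y, tensorForm (f X) (f Y) = tensorForm X Y)
    {p q p' q' : Fin 3} {x y x' y' : Fin 6 → ℤ} (hpq : p ≠ q) (hxy : Odd (gramForm E₆ x y))
    (hx : f (vecMulVec (A₂Triple p) x) = vecMulVec (A₂Triple p') x')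
    (hy : f (vecMulVec (A₂Triple q) y) = vecMulVec (A₂Triple q') y') : p' ≠ q' := by
  intro h
  have h1 := hf (vecMulVec (A₂Triple p) x) (vecMulVec (A₂Triple q) y)
  rw [hx, hy, tensorForm_triple, tensorForm_triple, if_pos h, if_neg hpq] at h1
  obtain ⟨k, hk⟩ := hxy
  omega

/-- Two orthogonal roots of one copy of `E₆` are mapped to the same copy, provided that they
have common neighbours with odd inner products. -/
theorem copy_eq_of_witness (hf : ∀ X Y, tensorForm (f X) (f Y) = tensorForm X Y) {p q r : Fin 3}
    {x y x' y' z w : Fin 6 → ℤ} (hz : gramForm E₆ z z = 2) (hw : gramForm E₆ w w = 2)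
    (hzx : Odd (gramForm E₆ z x)) (hzy : Odd (gramForm E₆ z y)) (hwx : Odd (gramForm E₆ w x))
    (hwy : Odd (gramForm E₆ w y)) (hzw : Odd (gramForm E₆ z w))
    (hx : f (vecMulVec (A₂Triple p) x) = vecMulVec (A₂Triple q) x')
    (hy : f (vecMulVec (A₂Triple p) y) = vecMulVec (A₂Triple r) y') : q = r := by
  -- Place `z` and `w` in the two other copies. Their images occupy two different copies, both
  -- avoided by the images of `x` and `y`, so only one copy remains for those.
  obtain ⟨s, t, hsp, htp, hst⟩ : ∃ s t : Fin 3, s ≠ p ∧ t ≠ p ∧ s ≠ t := by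
    exact (by decide : ∀ p : Fin 3, ∃ s t : Fin 3, s ≠ p ∧ t ≠ p ∧ s ≠ t) p
  obtain ⟨s', z', hs⟩ := exists_map_triple_root hf s hz
  obtain ⟨t', w', ht⟩ := exists_map_triple_root hf t hw
  have h1 := ne_of_odd_gramForm hf hsp hzx hs hx
  have h2 := ne_of_odd_gramForm hf hsp hzy hs hy
  have h3 := ne_of_odd_gramForm hf htp hwx ht hx
  have h4 := ne_of_odd_gramForm hf htp hwy ht hy
  have h5 := ne_of_odd_gramForm hf hst hzw hs ht
  omega

theorem E₆_diag (i : Fin 6) : gramForm E₆ (Pi.single i 1) (Pi.single i 1) = 2 := by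
  revert i; decide +kernel

theorem vecMulVec_eq_sum (e : Fin 2 → ℤ) (x : Fin 6 → ℤ) :
    vecMulVec e x = ∑ i, x i • vecMulVec e (Pi.single i 1) := by
  ext a j
  simp [vecMulVec_apply, Matrix.sum_apply, Pi.single_apply, mul_comm]

theorem exists_map_copy (hf : ∀ X Y, tensorForm (f X) (f Y) = tensorForm X Y) (p : Fin 3) :
    ∃ (q : Fin 3) (R : Matrix (Fin 6) (Fin 6) ℤ),
      ∀ x, f (vecMulVec (A₂Triple p) x) = vecMulVec (A₂Triple q) (x ᵥ* R) := by
  choose c r hcr using fun i => exists_map_triple_root hf p (E₆_diag i)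
  have key : ∀ i j : Fin 6, (∃ z w : Fin 6 → ℤ, gramForm E₆ z z = 2 ∧ gramForm E₆ w w = 2 ∧
      Odd (gramForm E₆ z (Pi.single i 1)) ∧ Odd (gramForm E₆ z (Pi.single j 1)) ∧
      Odd (gramForm E₆ w (Pi.single i 1)) ∧ Odd (gramForm E₆ w (Pi.single j 1)) ∧
      Odd (gramForm E₆ z w)) → c i = c j := by
    rintro i j ⟨z, w, h1, h2, h3, h4, h5, h6, h7⟩
    exact copy_eq_of_witness hf h1 h2 h3 h4 h5 h6 h7 (hcr i) (hcr j)
  -- Each pair consists of orthogonal simple roots, and the pairs link all six indices. Node 2 is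
  -- adjacent to node 0, so it is reached through node 1.
  have c1 : c 0 = c 1 := key 0 1 ⟨![0, 0, 1, 1, 0, 0], ![0, 0, 1, 1, 1, 0], by decide +kernel⟩
  have c3 : c 0 = c 3 := key 0 3 ⟨![0, 0, 1, 0, 0, 0], ![0, 0, 1, 1, 0, 0], by decide +kernel⟩
  have c4 : c 0 = c 4 := key 0 4 ⟨![0, 0, 1, 1, 0, 0], ![0, 0, 1, 1, 1, 0], by decide +kernel⟩
  have c5 : c 0 = c 5 := key 0 5 ⟨![0, 0, 1, 1, 1, 0], ![0, 0, 1, 1, 1, 1], by decide +kernel⟩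
  have c2 : c 1 = c 2 := key 1 2 ⟨![0, 0, 0, 1, 0, 0], ![0, 0, 0, 1, 1, 0], by decide +kernel⟩
  have hc : ∀ i, c i = c 0 := by
    intro i
    fin_cases i
    exacts [rfl, c1.symm, (c1.trans c2).symm, c3.symm, c4.symm, c5.symm]
  refine ⟨c 0, Matrix.of r, fun x => ?_⟩
  rw [vecMulVec_eq_sum, map_sum]
  simp only [map_zsmul, hcr, hc]
  ext a j
  simp [vecMulVec_apply, Matrix.sum_apply, vecMul, dotProduct, Finset.mul_sum]
  exact Finset.sum_congr rfl fun i _ => by ring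

theorem A₂Triple_sum : A₂Triple 0 + A₂Triple 1 + A₂Triple 2 = 0 := by decide

/-- Up to scaling, the vanishing sum is the only linear relation in the triple. Hence an isometry
acts on the `E₆`-factor of each copy by the same matrix. -/
theorem eq_of_triple_sum_eq_zero {p q r : Fin 3} (hpq : p ≠ q) (hpr : p ≠ r) (hqr : q ≠ r)
    {x y z : Fin 6 → ℤ} (h : vecMulVec (A₂Triple p) x + vecMulVec (A₂Triple q) y +
      vecMulVec (A₂Triple r) z = 0) : x = y := by
  ext i
  have h0 := congrFun (congrFun h 0) i
  have h1 := congrFun (congrFun h 1) i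
  simp only [Matrix.add_apply, vecMulVec_apply, Matrix.zero_apply] at h0 h1
  fin_cases p <;> fin_cases q <;> fin_cases r <;>
    simp_all [A₂Triple] <;> linarith

/-- Isometries of `A₂` realise every permutation of the triple. Signs are not needed, since they can
be absorbed in the `E₆`-factor. -/
theorem exists_matrix_A₂Triple {p q r : Fin 3} (hpq : p ≠ q) (hpr : p ≠ r) (hqr : q ≠ r) :
    ∃ H : Matrix (Fin 2) (Fin 2) ℤ, Hᵀ * A 2 * H = A 2 ∧ H *ᵥ ![1, 0] = A₂Triple p ∧
      H *ᵥ ![0, 1] = A₂Triple q := by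
  have key : ∀ p q r : Fin 3, p ≠ q → p ≠ r → q ≠ r →
      (!![A₂Triple p 0, A₂Triple q 0; A₂Triple p 1, A₂Triple q 1])ᵀ * A 2 *
        !![A₂Triple p 0, A₂Triple q 0; A₂Triple p 1, A₂Triple q 1] = A 2 := by
    decide +kernel
  refine ⟨_, key p q r hpq hpr hqr, ?_, ?_⟩
  · ext i; fin_cases i <;> simp
  · ext i; fin_cases i <;> simp

/-- Every isometry of `A₂ ⊗ E₆` is a tensor product of isometries of `A₂` and of `E₆`. -/
theorem exists_tensor_of_isometry (hf : ∀ X Y, tensorForm (f X) (f Y) = tensorForm X Y) :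
    ∃ (H : Matrix (Fin 2) (Fin 2) ℤ) (K : Matrix (Fin 6) (Fin 6) ℤ), Hᵀ * A 2 * H = A 2 ∧
      Kᵀ * E₆ * K = E₆ ∧ ∀ Y, f Y = H * Y * Kᵀ := by
  obtain ⟨p, R, hR⟩ := exists_map_copy hf 0
  obtain ⟨q, S, hS⟩ := exists_map_copy hf 1
  obtain ⟨r, T, hT⟩ := exists_map_copy hf 2
  have hodd : Odd (gramForm E₆ (Pi.single 0 1) (Pi.single 2 1)) := by decide +kernel
  have hpq := ne_of_odd_gramForm hf (by decide) hodd (hR _) (hS _)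
  have hpr := ne_of_odd_gramForm hf (by decide) hodd (hR _) (hT _)
  have hqr := ne_of_odd_gramForm hf (by decide) hodd (hS _) (hT _)
  obtain ⟨H, hH, hHp, hHq⟩ := exists_matrix_A₂Triple hpq hpr hqr
  have hRS : ∀ x, x ᵥ* R = x ᵥ* S := fun x => by
    refine eq_of_triple_sum_eq_zero hpq hpr hqr (z := x ᵥ* T) ?_
    rw [← hR, ← hS, ← hT, ← map_add, ← map_add, ← add_vecMulVec, ← add_vecMulVec, A₂Triple_sum,
      zero_vecMulVec, map_zero]
  refine ⟨H, Rᵀ, hH, transpose_mul_mul_eq_of_forall fun x y => ?_, fun Y => ?_⟩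
  · have h := hf (vecMulVec (A₂Triple 0) x) (vecMulVec (A₂Triple 0) y)
    rw [hR, hR, tensorForm_triple, tensorForm_triple, if_pos rfl, if_pos rfl] at h
    rw [mulVec_transpose, mulVec_transpose]
    linarith
  · have h0 := hR (Y 0)
    have h1 := hS (Y 1)
    rw [← hRS] at h1
    conv_lhs => rw [matrix_two_eq Y, map_add]
    conv_rhs => rw [matrix_two_eq Y, Matrix.mul_add, Matrix.add_mul, transpose_transpose,
      mul_vecMulVec, mul_vecMulVec, vecMulVec_mul, vecMulVec_mul, hHp, hHq]
    exact congrArg₂ (· + ·) h0 h1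

end Isometry

end Tensor

/-! ### Restriction and transport of isometry groups -/

section Transport

variable {X X' R R' : Type*} [AddCommGroup X] [AddCommGroup X']

/-- If every isometry of `X` preserves the image of `ι`, restriction is a homomorphism. -/
theorem exists_restriction {B : X → X → R} {B' : X' → X' → R'} (ι : X' →ₗ[ℤ] X)
    (hι : Function.Injective ι)
    (hB : ∀ x y x' y', B (ι x) (ι y) = B (ι x') (ι y') → B' x y = B' x' y')
    (h : ∀ (f : isometryGroup B) (y : X'), ∃ y', f.1 (ι y) = ι y') :
    ∃ φ : isometryGroup B →* isometryGroup B', ∀ f y, ι ((φ f).1 y) = f.1 (ι y) := by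
  choose r hr using h
  have hinv : ∀ (f : isometryGroup B) (x : X), f⁻¹.1 (f.1 x) = x :=
    fun f x => f.1.symm_apply_apply x
  have hinv' : ∀ (f : isometryGroup B) (x : X), f.1 (f⁻¹.1 x) = x :=
    fun f x => f.1.apply_symm_apply x
  let e (f : isometryGroup B) : X' ≃ₗ[ℤ] X' :=
    { toFun := r f
      invFun := r f⁻¹
      map_add' := fun x y => hι (by rw [← hr, map_add, map_add, map_add, hr, hr])
      map_smul' := fun k x => hι (by rw [← hr, map_smul, map_smul, map_smul, hr, RingHom.id_apply])
      left_inv := fun x => hι (by rw [← hr, ← hr, hinv])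
      right_inv := fun x => hι (by rw [← hr, ← hr, hinv']) }
  have he : ∀ f x, ι (e f x) = f.1 (ι x) := fun f x => (hr f x).symm
  refine ⟨⟨⟨fun f => ⟨e f, fun x y => hB _ _ _ _ ?_⟩, ?_⟩, ?_⟩, he⟩
  · rw [he, he]
    exact f.2 _ _
  · apply Subtype.ext
    apply LinearEquiv.ext
    intro x
    apply hι
    exact he 1 x
  · intro f g
    apply Subtype.ext
    apply LinearEquiv.ext
    intro x
    apply hι
    change ι (e (f * g) x) = ι (e f (e g x))
    rw [he, he, he]
    rfl

/-- A linear equivalence that identifies two forms up to scaling identifies the isometry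
groups. -/
def isometryGroupCongr {B : X → X → R} {B' : X' → X' → R'} (e : X ≃ₗ[ℤ] X')
    (h : ∀ x y x' y', B' (e x) (e y) = B' (e x') (e y') ↔ B x y = B x' y') :
    isometryGroup B ≃* isometryGroup B' where
  toFun f := ⟨(e.symm.trans f.1).trans e, fun x y => by
    have := (h (f.1 (e.symm x)) (f.1 (e.symm y)) (e.symm x) (e.symm y)).mpr (f.2 _ _)
    simpa using this⟩
  invFun f := ⟨(e.trans f.1).trans e.symm, fun x y => by
    refine (h _ _ _ _).mp ?_
    simpa using f.2 (e x) (e y)⟩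
  left_inv f := by
    apply Subtype.ext
    ext x
    simp
  right_inv f := by
    apply Subtype.ext
    ext x
    simp
  map_mul' f g := by
    apply Subtype.ext
    ext x
    simp

end Transport

/-! ### A model of `DIH₆(14)` -/

section Model

/-- A model of the Coxeter–Todd lattice, with the form scaled by `3`. -/
def modelJ : Submodule ℤ (Matrix (Fin 2) (Fin 6) ℤ) where
  carrier := {Y | ∃ Z, A 2 * Y * E₆ = (3 : ℤ) • Z}
  zero_mem' := ⟨0, by simp⟩
  add_mem' := by
    rintro X Y ⟨Z, hZ⟩ ⟨W, hW⟩
    exact ⟨Z + W, by rw [Matrix.mul_add, Matrix.add_mul, hZ, hW, smul_add]⟩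
  smul_mem' := by
    rintro k X ⟨Z, hZ⟩
    exact ⟨k • Z, by rw [Matrix.mul_smul, Matrix.smul_mul, hZ, smul_comm]⟩

/-- A model of `DIH₆(14)`, with the form scaled by `27`. -/
def modelQ : Submodule ℤ ((Fin 3 → ℤ) × Matrix (Fin 2) (Fin 6) ℤ) where
  carrier := {q | (q.1 0 + q.1 1 + q.1 2 = 0 ∧ ∀ i, 3 ∣ q.1 i - q.2 0 0) ∧
    ∃ Z, A 2 * q.2 * E₆ = (9 : ℤ) • Z}
  zero_mem' := ⟨by simp, 0, by simp⟩
  add_mem' := by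
    rintro ⟨c, X⟩ ⟨d, Y⟩ ⟨⟨h1, h2⟩, Z, hZ⟩ ⟨⟨g1, g2⟩, W, hW⟩
    refine ⟨⟨?_, fun i => ?_⟩, Z + W, ?_⟩
    · simp only [Prod.fst_add, Pi.add_apply] at *
      linarith
    · change 3 ∣ c i + d i - (X 0 0 + Y 0 0)
      rw [add_sub_add_comm]
      exact dvd_add (h2 i) (g2 i)
    · change A 2 * (X + Y) * E₆ = _
      rw [Matrix.mul_add, Matrix.add_mul, hZ, hW, smul_add]
  smul_mem' := by
    rintro k ⟨c, X⟩ ⟨⟨h1, h2⟩, Z, hZ⟩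
    refine ⟨⟨?_, fun i => ?_⟩, k • Z, ?_⟩
    · change k * c 0 + k * c 1 + k * c 2 = 0
      simp only at h1
      rw [← mul_add, ← mul_add, h1, mul_zero]
    · change 3 ∣ k * c i - k * X 0 0
      rw [← mul_sub]
      exact (h2 i).mul_left k
    · change A 2 * (k • X) * E₆ = _
      rw [Matrix.mul_smul, Matrix.smul_mul, hZ, smul_comm]

theorem mem_modelQ {c : Fin 3 → ℤ} {Y : Matrix (Fin 2) (Fin 6) ℤ} : (c, Y) ∈ modelQ ↔
    (c 0 + c 1 + c 2 = 0 ∧ ∀ i, 3 ∣ c i - Y 0 0) ∧ ∃ Z, A 2 * Y * E₆ = (9 : ℤ) • Z :=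
  Iff.rfl

/-- The form of `modelQ`. -/
def modelForm (q q' : (Fin 3 → ℤ) × Matrix (Fin 2) (Fin 6) ℤ) : ℤ :=
  6 * (q.1 ⬝ᵥ q'.1) + tensorForm q.2 q'.2

/-- The isometry group of `modelQ`. -/
abbrev modelOQ : Subgroup (modelQ ≃ₗ[ℤ] modelQ) :=
  isometryGroup fun x y : modelQ => modelForm x.1 y.1

/-- The isometry group of `modelJ`. -/
abbrev modelOJ : Subgroup (modelJ ≃ₗ[ℤ] modelJ) :=
  isometryGroup fun x y : modelJ => tensorForm x.1 y.1

/-- The inclusion of `modelJ` in `modelQ`. -/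
def modelIncl : modelJ →ₗ[ℤ] modelQ where
  toFun Y := ⟨(0, (3 : ℤ) • Y.1), mem_modelQ.mpr ⟨⟨by simp, fun i => by simp⟩, by
    obtain ⟨Z, hZ⟩ := Y.2
    exact ⟨Z, by rw [Matrix.mul_smul, Matrix.smul_mul, hZ, smul_smul]; norm_num⟩⟩⟩
  map_add' X Y := by
    apply Subtype.ext
    change ((0 : Fin 3 → ℤ), (3 : ℤ) • (X.1 + Y.1)) = (0 + 0, (3 : ℤ) • X.1 + (3 : ℤ) • Y.1)
    rw [smul_add, add_zero]
  map_smul' k X := by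
    apply Subtype.ext
    change ((0 : Fin 3 → ℤ), (3 : ℤ) • (k • X.1)) = (k • 0, k • (3 : ℤ) • X.1)
    rw [smul_comm, smul_zero]

theorem modelIncl_coe (Y : modelJ) : (modelIncl Y).1 = (0, (3 : ℤ) • Y.1) := rfl

theorem modelForm_modelIncl (X Y : modelJ) :
    modelForm (modelIncl X).1 (modelIncl Y).1 = 9 * tensorForm X.1 Y.1 := by
  rw [modelIncl_coe, modelIncl_coe, modelForm, tensorForm_smul_left, tensorForm_smul_right]
  simp
  ring

theorem matrix_smul_cancel {m n : Type*} {k : ℤ} (hk : k ≠ 0) {X Y : Matrix m n ℤ}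
    (h : k • X = k • Y) : X = Y := by
  ext a i
  exact mul_left_cancel₀ hk (congrFun (congrFun h a) i)

theorem modelIncl_injective : Function.Injective modelIncl := by
  intro X Y h
  have := congrArg (fun q : modelQ => q.1.2) h
  exact Subtype.ext (matrix_smul_cancel (by norm_num) this)

/-- Three times the inverse of the Cartan matrix of `A₂`. -/
def A₂ThreeInv : Matrix (Fin 2) (Fin 2) ℤ := !![2, 1; 1, 2]

theorem A₂_mul_threeInv : A 2 * A₂ThreeInv = (3 : ℤ) • (1 : Matrix (Fin 2) (Fin 2) ℤ) := by
  decide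

theorem A₂_threeInv_mul : A₂ThreeInv * A 2 = (3 : ℤ) • (1 : Matrix (Fin 2) (Fin 2) ℤ) := by
  decide

theorem A₂_mul_dual_mul_E₆ (Z : Matrix (Fin 2) (Fin 6) ℤ) :
    A 2 * (A₂ThreeInv * Z * E₆ThreeInv) * E₆ = (9 : ℤ) • Z := by
  rw [← Matrix.mul_assoc, ← Matrix.mul_assoc, A₂_mul_threeInv, Matrix.mul_assoc _ E₆ThreeInv,
    E₆_threeInv_mul, Matrix.smul_mul, Matrix.one_mul, Matrix.smul_mul, Matrix.mul_smul,
    Matrix.mul_one, smul_smul]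
  norm_num

/-- The hypothesis says that `Y` is 9 times an element of the dual of `A₂ ⊗ E₆`, with `Z` its
coordinates in the dual basis. -/
theorem eq_dual {Y Z : Matrix (Fin 2) (Fin 6) ℤ} (h : A 2 * Y * E₆ = (9 : ℤ) • Z) :
    Y = A₂ThreeInv * Z * E₆ThreeInv := by
  apply matrix_smul_cancel (k := 9) (by norm_num)
  have : A₂ThreeInv * (A 2 * Y * E₆) * E₆ThreeInv = (9 : ℤ) • Y := by
    rw [← Matrix.mul_assoc, ← Matrix.mul_assoc, A₂_threeInv_mul, Matrix.mul_assoc _ E₆,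
      E₆_mul_threeInv, Matrix.smul_mul, Matrix.one_mul, Matrix.smul_mul, Matrix.mul_smul,
      Matrix.mul_one, smul_smul]
    norm_num
  rw [← this, h, Matrix.mul_smul, Matrix.smul_mul]

/-- Modulo `3`, the elements of the projection of `modelQ` are multiples of this matrix. -/
def glueMatrix : Matrix (Fin 2) (Fin 6) ℤ := !![1, 0, -1, 0, 1, -1; -1, 0, 1, 0, -1, 1]

/-- Modulo 3 both rescaled inverse Cartan matrices have rank one, so `Y` is a multiple of one fixed
matrix, and the corner entry gives the factor. This is why the glue group has order 3 and is read
off at the corner. -/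
theorem three_dvd_sub_glue {Y Z : Matrix (Fin 2) (Fin 6) ℤ} (h : A 2 * Y * E₆ = (9 : ℤ) • Z)
    (a : Fin 2) (i : Fin 6) : 3 ∣ Y a i - Y 0 0 * glueMatrix a i := by
  rw [eq_dual h]
  simp only [Matrix.mul_apply, Fin.sum_univ_two, Fin.sum_univ_six]
  fin_cases a <;> fin_cases i <;> simp [A₂ThreeInv, E₆ThreeInv, glueMatrix] <;> omega

theorem exists_eq_three_smul {Y Z : Matrix (Fin 2) (Fin 6) ℤ} (h : A 2 * Y * E₆ = (9 : ℤ) • Z)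
    (h0 : 3 ∣ Y 0 0) : ∃ X ∈ modelJ, Y = (3 : ℤ) • X := by
  have h1 : ∀ a i, 3 ∣ Y a i := fun a i => by
    have h2 := three_dvd_sub_glue h a i
    have h3 : 3 ∣ Y 0 0 * glueMatrix a i := h0.mul_right _
    omega
  choose X hX using h1
  have hYX : Y = (3 : ℤ) • Matrix.of X := by
    ext a i
    exact hX a i
  refine ⟨Matrix.of X, ⟨Z, ?_⟩, hYX⟩
  apply matrix_smul_cancel (k := 3) (by norm_num)
  rw [← Matrix.smul_mul, ← Matrix.mul_smul, ← hYX, h, smul_smul]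
  norm_num

theorem exists_modelIncl_eq {q : modelQ} (hq : q.1.1 = 0) : ∃ Y, q = modelIncl Y := by
  obtain ⟨⟨c, Y⟩, ⟨_, h⟩, Z, hZ⟩ := q
  obtain rfl : c = 0 := hq
  obtain ⟨X, hX, rfl⟩ := exists_eq_three_smul hZ (by simpa using h 0)
  exact ⟨⟨X, hX⟩, rfl⟩

/-! ### Positivity of the model form and invariance of `modelJ`. -/

theorem tensorForm_nonneg (Y : Matrix (Fin 2) (Fin 6) ℤ) : 0 ≤ tensorForm Y Y := by
  rw [tensorForm_self]
  have := gramForm_E₆_nonneg (Y 0)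
  have := gramForm_E₆_nonneg (Y 1)
  have := gramForm_E₆_nonneg (Y 0 - Y 1)
  omega

theorem eq_zero_of_tensorForm {Y : Matrix (Fin 2) (Fin 6) ℤ} (h : tensorForm Y Y = 0) :
    Y = 0 := by
  rw [tensorForm_self] at h
  have h0 := gramForm_E₆_nonneg (Y 0)
  have h1 := gramForm_E₆_nonneg (Y 1)
  have h2 := gramForm_E₆_nonneg (Y 0 - Y 1)
  ext a i
  fin_cases a
  · exact congrFun (gramForm_E₆_eq_zero (x := Y 0) (by omega)) i
  · exact congrFun (gramForm_E₆_eq_zero (x := Y 1) (by omega)) i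

theorem eq_of_forall_tensorForm {X Y : Matrix (Fin 2) (Fin 6) ℤ}
    (h : ∀ W, tensorForm X W = tensorForm Y W) : X = Y := by
  rw [← sub_eq_zero]
  apply eq_zero_of_tensorForm
  have h1 := h (X - Y)
  have h2 := tensorForm_add_left (X - Y) Y (X - Y)
  rw [sub_add_cancel] at h2
  omega

theorem tensorForm_comm (X Y : Matrix (Fin 2) (Fin 6) ℤ) : tensorForm X Y = tensorForm Y X := by
  rw [tensorForm, ← trace_transpose]
  simp only [transpose_mul, transpose_transpose, E₆_transpose, A₂_transpose]
  rw [trace_mul_comm, tensorForm]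
  simp only [Matrix.mul_assoc]

theorem tensorForm_single (a : Fin 2) (i : Fin 6) (Y : Matrix (Fin 2) (Fin 6) ℤ) :
    tensorForm (Matrix.single a i 1) Y = (A 2 * Y * E₆) a i := by
  rw [tensorForm_eq_sum, Finset.sum_eq_single a, Finset.sum_eq_single i]
  · simp
  · intro j _ hj
    simp [Matrix.single_apply_of_col_ne _ _ hj.symm]
  · simp
  · intro b _ hb
    exact Finset.sum_eq_zero fun j _ => by simp [Matrix.single_apply_of_row_ne hb.symm]
  · simp

theorem modelForm_comm (q q' : (Fin 3 → ℤ) × Matrix (Fin 2) (Fin 6) ℤ) :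
    modelForm q q' = modelForm q' q := by
  rw [modelForm, dotProduct_comm, tensorForm_comm, modelForm]

theorem modelForm_modelOQ (f : modelOQ) (q q' : modelQ) :
    modelForm (f.1 q).1 (f.1 q').1 = modelForm q.1 q'.1 :=
  f.2 q q'

theorem modelForm_modelOQ_left (f : modelOQ) (q q' : modelQ) :
    modelForm (f.1 q).1 q'.1 = modelForm q.1 (f⁻¹.1 q').1 := by
  rw [← modelForm_modelOQ f q]
  congr 2
  exact (f.1.apply_symm_apply q').symm

/-- The sublattice `9 (ℤ² ⊗ ℤ⁶)` of `modelQ`. -/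
theorem nine_smul_mem (W : Matrix (Fin 2) (Fin 6) ℤ) : ((0 : Fin 3 → ℤ), (9 : ℤ) • W) ∈ modelQ :=
  mem_modelQ.mpr ⟨⟨by simp, fun i => by
    change 3 ∣ (0 : ℤ) - 9 * W 0 0
    omega⟩, A 2 * W * E₆, by rw [Matrix.mul_smul, Matrix.smul_mul]⟩

theorem six_le_gramForm_E₆ {z w : Fin 6 → ℤ} (h : E₆ *ᵥ z = (3 : ℤ) • w) (hz : z ≠ 0) :
    6 ≤ gramForm E₆ z z := by
  have h1 : gramForm E₆ z z = 3 * (z ⬝ᵥ w) := by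
    rw [gramForm, h, dotProduct_smul, smul_eq_mul]
  obtain ⟨k, hk⟩ := even_gramForm_E₆ z
  have := two_le_gramForm_E₆ hz
  omega

/-- Pulling out `A₂ThreeInv` turns the norm into 3 times a sum of norms of three vectors of `3E₆*`.
Each is zero or at least 6, and at most one is zero, so the value is at least 36. Unscaled, the
projection of `Q` to the span of `J` has no nonzero vector of norm at most 1. -/
theorem lt_tensorForm {Y Z : Matrix (Fin 2) (Fin 6) ℤ} (h : A 2 * Y * E₆ = (9 : ℤ) • Z)
    (hY : Y ≠ 0) : 27 < tensorForm Y Y := by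
  set X := Z * E₆ThreeInv with hX
  have hYX : Y = A₂ThreeInv * X := by rw [eq_dual h, Matrix.mul_assoc]
  have hXE : X * E₆ = (3 : ℤ) • Z := by
    rw [hX, Matrix.mul_assoc, E₆_threeInv_mul, Matrix.mul_smul, Matrix.mul_one]
  have hrow : ∀ a, E₆ *ᵥ X a = (3 : ℤ) • Z a := fun a => by
    rw [← E₆_transpose, mulVec_transpose]
    exact congrFun hXE a
  have h0 : Y 0 = (2 : ℤ) • X 0 + X 1 := by
    ext i
    rw [hYX, Matrix.mul_apply, Fin.sum_univ_two]
    simp [A₂ThreeInv]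
  have h1 : Y 1 = X 0 + (2 : ℤ) • X 1 := by
    ext i
    rw [hYX, Matrix.mul_apply, Fin.sum_univ_two]
    simp [A₂ThreeInv]
  have hform : tensorForm Y Y = 3 * gramForm E₆ (X 0) (X 0) + 3 * gramForm E₆ (X 1) (X 1) +
      3 * gramForm E₆ (X 0 + X 1) (X 0 + X 1) := by
    rw [tensorForm_self, h0, h1]
    simp only [gramForm_add_left, gramForm_add_right, gramForm_sub_left, gramForm_sub_right,
      gramForm_smul_left, gramForm_smul_right, gramForm_comm E₆_transpose (X 1) (X 0)]
    ring
  have n0 := gramForm_E₆_nonneg (X 0)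
  have n1 := gramForm_E₆_nonneg (X 1)
  have n2 := gramForm_E₆_nonneg (X 0 + X 1)
  have k0 := six_le_gramForm_E₆ (hrow 0)
  have k1 := six_le_gramForm_E₆ (hrow 1)
  have k2 : X 0 + X 1 ≠ 0 → 6 ≤ gramForm E₆ (X 0 + X 1) (X 0 + X 1) :=
    six_le_gramForm_E₆ (w := Z 0 + Z 1) (by rw [mulVec_add, hrow, hrow, smul_add])
  by_cases e0 : X 0 = 0
  · have e1 : X 1 ≠ 0 := by
      intro e1
      apply hY
      ext a i
      fin_cases a
      · have := congrFun h0 i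
        simpa [e0, e1] using this
      · have := congrFun h1 i
        simpa [e0, e1] using this
    have := k1 e1
    have := k2 (by rw [e0, zero_add]; exact e1)
    omega
  · have := k0 e0
    by_cases e1 : X 1 = 0
    · have := k2 (by rw [e1, add_zero]; exact e0)
      omega
    · have := k1 e1
      omega

/-- The vectors of norm `4` of `DIH₆(14)` that have even inner products with all vectors are
orthogonal to `J`. -/
theorem snd_eq_zero_of_even {q : modelQ} (h : ∀ q' : modelQ, 54 ∣ modelForm q.1 q'.1)
    (hq : modelForm q.1 q.1 = 108) : q.1.2 = 0 := by
  obtain ⟨⟨c, Y⟩, _, Z, hZ⟩ := q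
  change A 2 * Y * E₆ = _ at hZ
  change Y = 0
  -- Pairing with 9 times a matrix unit gives `81 * Z a i`, which must be divisible by 54. So `Y` is
  -- twice a vector of the same dual lattice, and if nonzero its norm exceeds `4 * 27 = 108`.
  have h1 : ∀ a i, 2 ∣ Z a i := fun a i => by
    have h2 := h ⟨_, nine_smul_mem (Matrix.single a i 1)⟩
    simp only [modelForm, dotProduct_zero, mul_zero, zero_add, tensorForm_smul_right] at h2
    rw [tensorForm_comm, tensorForm_single, hZ] at h2
    change 54 ∣ 9 * (9 * Z a i) at h2
    omega
  choose W hW using h1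
  have hZW : Z = (2 : ℤ) • Matrix.of W := by
    ext a i
    exact hW a i
  set X := A₂ThreeInv * Matrix.of W * E₆ThreeInv with hX
  have hYX : Y = (2 : ℤ) • X := by
    rw [eq_dual hZ, hZW, Matrix.mul_smul, Matrix.smul_mul]
  by_contra hY
  have hX0 : X ≠ 0 := fun h0 => hY (by rw [hYX, h0, smul_zero])
  have h2 := lt_tensorForm (A₂_mul_dual_mul_E₆ (Matrix.of W)) hX0
  rw [← hX] at h2
  simp only [modelForm] at hq
  rw [hYX, tensorForm_smul_left, tensorForm_smul_right] at hq
  have h3 : 0 ≤ c ⬝ᵥ c := Finset.sum_nonneg fun i _ => mul_self_nonneg (c i)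
  omega

theorem sub_single_mem (i : Fin 3) : ((3 : ℤ) • (Pi.single i 1 - Pi.single (i + 1) 1 : Fin 3 → ℤ),
    (0 : Matrix (Fin 2) (Fin 6) ℤ)) ∈ modelQ := by
  refine mem_modelQ.mpr ⟨⟨?_, fun j => ?_⟩, 0, by simp⟩
  · revert i; decide
  · simp

theorem modelForm_sub_single (i : Fin 3) :
    modelForm ((3 : ℤ) • (Pi.single i 1 - Pi.single (i + 1) 1 : Fin 3 → ℤ), 0)
      ((3 : ℤ) • (Pi.single i 1 - Pi.single (i + 1) 1 : Fin 3 → ℤ), 0) = 108 := by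
  revert i; decide +kernel

/-- The vectors `3(eᵢ - eᵢ₊₁)` have norm 108 and products divisible by 54 with all of `modelQ`, and
so do their images under `f⁻¹`, which are therefore orthogonal to `J`. Hence `f` maps `J` to vectors
orthogonal to them, whose three coordinates are equal with sum zero. -/
theorem fst_modelOQ_modelIncl (f : modelOQ) (Y : modelJ) : (f.1 (modelIncl Y)).1.1 = 0 := by
  have key : ∀ i : Fin 3, (f.1 (modelIncl Y)).1.1 i = (f.1 (modelIncl Y)).1.1 (i + 1) := by
    intro i
    set r : modelQ := ⟨_, sub_single_mem i⟩ with hr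
    have hrq : ∀ q : modelQ, modelForm r.1 q.1 = 18 * (q.1.1 i - q.1.1 (i + 1)) := by
      intro q
      simp only [hr, modelForm, smul_dotProduct, sub_dotProduct, single_dotProduct, one_mul,
        smul_eq_mul]
      simp [tensorForm]
      ring
    have h0 : (f⁻¹.1 r).1.2 = 0 := by
      apply snd_eq_zero_of_even
      · intro q
        rw [modelForm_modelOQ_left, hrq]
        obtain ⟨⟨-, h⟩, -⟩ := (f⁻¹⁻¹.1 q).2
        have h1 := h i
        have h2 := h (i + 1)
        omega
      · rw [modelForm_modelOQ]
        exact modelForm_sub_single i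
    have h1 := modelForm_modelOQ_left f (modelIncl Y) r
    rw [modelForm_comm, hrq, modelForm, h0, modelIncl_coe] at h1
    simp [tensorForm] at h1
    omega
  obtain ⟨⟨hs, -⟩, -⟩ := (f.1 (modelIncl Y)).2
  have k0 := key 0
  have k1 := key 1
  simp only [zero_add] at k0
  change _ = (f.1 (modelIncl Y)).1.1 2 at k1
  ext i
  fin_cases i <;> simp <;> omega

end Model

/-! ### The isometry group of the model -/

section ModelGroup

/-- The restriction homomorphism `O(Q) → O(J)` of the model. -/
theorem exists_modelRestriction : ∃ φ : modelOQ →* modelOJ,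
    ∀ f Y, modelIncl ((φ f).1 Y) = f.1 (modelIncl Y) :=
  exists_restriction modelIncl modelIncl_injective
    (fun x y x' y' h => by
      have h' : modelForm (modelIncl x).1 (modelIncl y).1 =
        modelForm (modelIncl x').1 (modelIncl y').1 := h
      rw [modelForm_modelIncl, modelForm_modelIncl] at h'
      exact mul_left_cancel₀ (by norm_num) h')
    fun f y => exists_modelIncl_eq (fst_modelOQ_modelIncl f y)

/-- The tensor product of two isometries. -/
def tensorMap (h : gramO (A 2)) (k : gramO E₆) :
    Matrix (Fin 2) (Fin 6) ℤ →ₗ[ℤ] Matrix (Fin 2) (Fin 6) ℤ where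
  toFun Y := gramOMatrix (A 2) h * Y * (gramOMatrix E₆ k)ᵀ
  map_add' X Y := by rw [Matrix.mul_add, Matrix.add_mul]
  map_smul' c Y := by rw [Matrix.mul_smul, Matrix.smul_mul, RingHom.id_apply]

theorem tensorMap_apply (h : gramO (A 2)) (k : gramO E₆) (Y : Matrix (Fin 2) (Fin 6) ℤ) :
    tensorMap h k Y = gramOMatrix (A 2) h * Y * (gramOMatrix E₆ k)ᵀ :=
  rfl

theorem tensorMap_mul (h h' : gramO (A 2)) (k k' : gramO E₆) (Y : Matrix (Fin 2) (Fin 6) ℤ) :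
    tensorMap (h * h') (k * k') Y = tensorMap h k (tensorMap h' k' Y) := by
  simp only [tensorMap_apply, map_mul, transpose_mul, Matrix.mul_assoc]

theorem tensorMap_one (Y : Matrix (Fin 2) (Fin 6) ℤ) : tensorMap 1 1 Y = Y := by
  rw [tensorMap_apply, map_one, map_one, Matrix.one_mul, transpose_one, Matrix.mul_one]

theorem tensorMap_inv_apply (h : gramO (A 2)) (k : gramO E₆) (Y : Matrix (Fin 2) (Fin 6) ℤ) :
    tensorMap h⁻¹ k⁻¹ (tensorMap h k Y) = Y := by
  rw [← tensorMap_mul, inv_mul_cancel, inv_mul_cancel, tensorMap_one]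

theorem tensorMap_apply_inv (h : gramO (A 2)) (k : gramO E₆) (Y : Matrix (Fin 2) (Fin 6) ℤ) :
    tensorMap h k (tensorMap h⁻¹ k⁻¹ Y) = Y := by
  rw [← tensorMap_mul, mul_inv_cancel, mul_inv_cancel, tensorMap_one]

theorem tensorForm_tensorMap (h : gramO (A 2)) (k : gramO E₆)
    (X Y : Matrix (Fin 2) (Fin 6) ℤ) :
    tensorForm (tensorMap h k X) (tensorMap h k Y) = tensorForm X Y :=
  tensorForm_mul_mul (gramOMatrix_isometry h) (gramOMatrix_isometry k) X Y

theorem mul_gramOMatrix {n : ℕ} {C : Matrix (Fin n) (Fin n) ℤ} (f : gramO C) :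
    C * gramOMatrix C f = (gramOMatrix C f⁻¹)ᵀ * C := by
  have h := congrArg ((gramOMatrix C f⁻¹)ᵀ * ·) (gramOMatrix_isometry f)
  simp only [← Matrix.mul_assoc, ← transpose_mul] at h
  rwa [gramOMatrix_mul_inv, transpose_one, Matrix.one_mul] at h

/-- Isometries of a lattice act on its dual; with `c = 3` this serves `modelJ`, with `c = 9` the
projection of `modelQ`. -/
theorem exists_tensorMap_dvd (h : gramO (A 2)) (k : gramO E₆) {c : ℤ}
    {Y Z : Matrix (Fin 2) (Fin 6) ℤ} (hY : A 2 * Y * E₆ = c • Z) :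
    ∃ Z', A 2 * tensorMap h k Y * E₆ = c • Z' := by
  have hk : (gramOMatrix E₆ k)ᵀ * E₆ = E₆ * gramOMatrix E₆ k⁻¹ := by
    rw [mul_gramOMatrix, inv_inv]
  refine ⟨(gramOMatrix (A 2) h⁻¹)ᵀ * Z * gramOMatrix E₆ k⁻¹, ?_⟩
  calc A 2 * tensorMap h k Y * E₆
      = A 2 * gramOMatrix (A 2) h * Y * ((gramOMatrix E₆ k)ᵀ * E₆) := by
        simp only [tensorMap_apply, Matrix.mul_assoc]
    _ = (gramOMatrix (A 2) h⁻¹)ᵀ * (A 2 * Y * E₆) * gramOMatrix E₆ k⁻¹ := by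
        rw [mul_gramOMatrix, hk]
        simp only [Matrix.mul_assoc]
    _ = _ := by rw [hY, Matrix.mul_smul, Matrix.smul_mul]

/-- The action of `O(A₂) × O(E₆)` on `J`. -/
def modelTensor : gramO (A 2) × gramO E₆ →* modelOJ where
  toFun p := ⟨
    { toFun := fun Y => ⟨tensorMap p.1 p.2 Y.1, exists_tensorMap_dvd p.1 p.2 Y.2.choose_spec⟩
      invFun := fun Y => ⟨tensorMap p.1⁻¹ p.2⁻¹ Y.1,
        exists_tensorMap_dvd p.1⁻¹ p.2⁻¹ Y.2.choose_spec⟩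
      map_add' := fun X Y => Subtype.ext (map_add (tensorMap p.1 p.2) X.1 Y.1)
      map_smul' := fun c Y => Subtype.ext (map_smul (tensorMap p.1 p.2) c Y.1)
      left_inv := fun Y => Subtype.ext (tensorMap_inv_apply p.1 p.2 Y.1)
      right_inv := fun Y => Subtype.ext (tensorMap_apply_inv p.1 p.2 Y.1) },
    fun X Y => tensorForm_tensorMap p.1 p.2 X.1 Y.1⟩
  map_one' := by
    apply Subtype.ext
    apply LinearEquiv.ext
    intro Y
    exact Subtype.ext (tensorMap_one Y.1)
  map_mul' p q := by
    apply Subtype.ext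
    apply LinearEquiv.ext
    intro Y
    exact Subtype.ext (tensorMap_mul p.1 q.1 p.2 q.2 Y.1)

theorem modelTensor_apply (p : gramO (A 2) × gramO E₆) (Y : modelJ) :
    ((modelTensor p).1 Y).1 = tensorMap p.1 p.2 Y.1 :=
  rfl

theorem three_smul_mem_modelJ (Y : Matrix (Fin 2) (Fin 6) ℤ) : (3 : ℤ) • Y ∈ modelJ :=
  ⟨A 2 * Y * E₆, by rw [Matrix.mul_smul, Matrix.smul_mul]⟩

theorem mem_negNeg_iff {p : gramO (A 2) × gramO E₆} :
    p ∈ negNeg (A 2) E₆ ↔ p = 1 ∨ p = (gramNeg (A 2), gramNeg E₆) := by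
  constructor
  · intro h
    have hsq : ((gramNeg (A 2), gramNeg E₆) : gramO (A 2) × gramO E₆) ^ 2 = 1 := by
      rw [sq]
      refine Prod.ext ?_ ?_ <;> apply Subtype.ext <;> apply LinearEquiv.ext <;> intro x <;>
        exact neg_neg x
    obtain ⟨n, rfl⟩ := Subgroup.mem_zpowers_iff.mp h
    rcases Int.even_or_odd' n with ⟨m, rfl | rfl⟩
    · left
      rw [_root_.zpow_mul]
      have : ((gramNeg (A 2), gramNeg E₆) : gramO (A 2) × gramO E₆) ^ (2 : ℤ) = 1 := by
        exact_mod_cast hsq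
      rw [this, _root_.one_zpow]
    · right
      rw [_root_.zpow_add, _root_.zpow_mul, zpow_one]
      have : ((gramNeg (A 2), gramNeg E₆) : gramO (A 2) × gramO E₆) ^ (2 : ℤ) = 1 := by
        exact_mod_cast hsq
      rw [this, _root_.one_zpow, one_mul]
  · rintro (rfl | rfl)
    · exact one_mem _
    · exact Subgroup.mem_zpowers _

theorem ker_modelTensor : modelTensor.ker = negNeg (A 2) E₆ := by
  ext ⟨h, k⟩
  rw [mem_negNeg_iff, MonoidHom.mem_ker]
  constructor
  · intro hp
    set H := gramOMatrix (A 2) h with hH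
    set K := gramOMatrix E₆ k with hK
    have hfix : ∀ Y : Matrix (Fin 2) (Fin 6) ℤ, H * Y * Kᵀ = Y := by
      intro Y
      have h1 := congrArg (fun f : modelOJ => (f.1 ⟨_, three_smul_mem_modelJ Y⟩).1) hp
      simp only [modelTensor_apply, map_smul] at h1
      exact matrix_smul_cancel (by norm_num) h1
    -- Evaluating at matrix units shows that the Kronecker product of `H` and `K` is the identity,
    -- so both are the same sign times the identity.
    have hent : ∀ a i b j, H b a * K j i = if b = a ∧ j = i then 1 else 0 := by
      intro a i b j
      have h1 := congrFun (congrFun (hfix (Matrix.single a i 1)) b) j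
      rw [Matrix.mul_apply, Finset.sum_eq_single i] at h1
      · rw [Matrix.mul_single_apply_same, transpose_apply, mul_one] at h1
        rw [h1, Matrix.single_apply]
        simp only [eq_comm]
      · intro l _ hl
        rw [Matrix.mul_single_apply_of_ne _ _ _ _ _ hl, zero_mul]
      · simp
    have h00 : H 0 0 * K 0 0 = 1 := by simpa using hent 0 0 0 0
    have hHK : H 0 0 = K 0 0 ∧ (H 0 0 = 1 ∨ H 0 0 = -1) := by
      rcases Int.mul_eq_one_iff_eq_one_or_neg_one.mp h00 with h1 | h1 <;> omega
    have hHe : H = H 0 0 • (1 : Matrix (Fin 2) (Fin 2) ℤ) := by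
      ext b a
      have h1 := hent a 0 b 0
      have h2 : H b a = H 0 0 * (H b a * K 0 0) := by linear_combination (-H b a) * h00
      rw [h2, h1]
      simp [Matrix.one_apply]
    have hKe : K = H 0 0 • (1 : Matrix (Fin 6) (Fin 6) ℤ) := by
      ext j i
      have h1 := hent 0 i 0 j
      have h2 : K j i = K 0 0 * (H 0 0 * K j i) := by linear_combination (-K j i) * h00
      rw [h2, h1, hHK.1]
      simp [Matrix.one_apply]
    rcases hHK.2 with h1 | h1
    · left
      refine Prod.ext ?_ ?_ <;> apply gramOMatrix_injective
      · change H = _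
        rw [hHe, h1, one_smul]
        exact (map_one _).symm
      · change K = _
        rw [hKe, h1, one_smul]
        exact (map_one _).symm
    · right
      refine Prod.ext ?_ ?_ <;> apply gramOMatrix_injective
      · change H = _
        rw [hHe, h1, gramOMatrix_gramNeg, neg_one_smul]
      · change K = _
        rw [hKe, h1, gramOMatrix_gramNeg, neg_one_smul]
  · rintro (hp | hp)
    · rw [hp, map_one]
    · obtain ⟨rfl, rfl⟩ := Prod.ext_iff.mp hp
      apply Subtype.ext
      apply LinearEquiv.ext
      intro Y
      apply Subtype.ext
      rw [modelTensor_apply, tensorMap_apply, gramOMatrix_gramNeg, gramOMatrix_gramNeg]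
      simp

/-- The component in the span of `J` of a generator of `Q` modulo the sum of `J` and its
annihilator. -/
def glueVector : Matrix (Fin 2) (Fin 6) ℤ :=
  !![-4, -6, -8, -12, -10, -8; -2, -3, -4, -6, -5, -4]

theorem glueVector_dual : ∃ Z, A 2 * glueVector * E₆ = (9 : ℤ) • Z :=
  ⟨!![0, 0, 0, 0, 0, -1; 0, 0, 0, 0, 0, 0], by decide +kernel⟩

/-- The glue group has order 3, is generated by `glueVector`, and has the corner entry modulo 3 as
its coordinate. A tensor product of isometries acts on it by an automorphism, that is, by a sign. -/
theorem exists_sign (h : gramO (A 2)) (k : gramO E₆) : ∃ ε : ℤ, (ε = 1 ∨ ε = -1) ∧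
    ∀ Y Z, A 2 * Y * E₆ = (9 : ℤ) • Z → 3 ∣ tensorMap h k Y 0 0 - ε * Y 0 0 := by
  obtain ⟨W, hW⟩ := glueVector_dual
  obtain ⟨W', hW'⟩ := exists_tensorMap_dvd h k hW
  set t := tensorMap h k glueVector 0 0 with ht
  have hY : ∀ Y Z, A 2 * Y * E₆ = (9 : ℤ) • Z → 3 ∣ tensorMap h k Y 0 0 + t * Y 0 0 := by
    intro Y Z hZ
    obtain ⟨X, -, hX⟩ := exists_eq_three_smul (Y := Y + Y 0 0 • glueVector)
      (Z := Z + Y 0 0 • W) (by rw [Matrix.mul_add, Matrix.add_mul, hZ, Matrix.mul_smul,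
        Matrix.smul_mul, hW, smul_add, smul_comm])
      (by
        change 3 ∣ Y 0 0 + Y 0 0 * (-4)
        omega)
    have h1 := congrArg (fun M => tensorMap h k M 0 0) hX
    simp only [map_add, map_smul] at h1
    change tensorMap h k Y 0 0 + Y 0 0 * t = 3 * tensorMap h k X 0 0 at h1
    exact ⟨_, by rw [← h1]; ring⟩
  have h3 : ¬ 3 ∣ t := by
    intro h3
    obtain ⟨X, -, hX⟩ := exists_eq_three_smul hW' h3
    have h1 := tensorMap_inv_apply h k glueVector
    rw [hX, map_smul] at h1
    have h2 : 3 * tensorMap h⁻¹ k⁻¹ X 0 0 = -4 := congrFun (congrFun h1 0) 0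
    omega
  -- The corner of `glueVector` is `-4`, which is `-1` modulo 3, so the sign is `-t` modulo 3.
  have hε : ∃ ε : ℤ, (ε = 1 ∨ ε = -1) ∧ 3 ∣ t + ε := by
    rcases (by omega : t % 3 = 1 ∨ t % 3 = 2) with h1 | h1
    · exact ⟨-1, Or.inr rfl, by omega⟩
    · exact ⟨1, Or.inl rfl, by omega⟩
  obtain ⟨ε, hε, hε3⟩ := hε
  refine ⟨ε, hε, fun Y Z hZ => ?_⟩
  have h1 := hY Y Z hZ
  have h2 := hε3.mul_right (Y 0 0)
  have h4 : tensorMap h k Y 0 0 - ε * Y 0 0 =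
      (tensorMap h k Y 0 0 + t * Y 0 0) - (t + ε) * Y 0 0 := by ring
  rw [h4]
  exact dvd_sub h1 h2

theorem smul_tensorMap_mem {h : gramO (A 2)} {k : gramO E₆} {ε : ℤ}
    (hε : ∀ Y Z, A 2 * Y * E₆ = (9 : ℤ) • Z → 3 ∣ tensorMap h k Y 0 0 - ε * Y 0 0)
    (q : modelQ) : (ε • q.1.1, tensorMap h k q.1.2) ∈ modelQ := by
  obtain ⟨⟨c, Y⟩, ⟨h1, h2⟩, Z, hZ⟩ := q
  refine mem_modelQ.mpr ⟨⟨?_, fun i => ?_⟩, exists_tensorMap_dvd h k hZ⟩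
  · change ε * c 0 + ε * c 1 + ε * c 2 = 0
    simp only at h1
    rw [← mul_add, ← mul_add, h1, mul_zero]
  · change 3 ∣ ε * c i - tensorMap h k Y 0 0
    have h3 := (h2 i).mul_left ε
    have h4 := hε Y Z hZ
    have h5 : ε * c i - tensorMap h k Y 0 0 =
      ε * (c i - Y 0 0) - (tensorMap h k Y 0 0 - ε * Y 0 0) := by ring
    rw [h5]
    exact dvd_sub h3 h4

/-- The isometries of `J` coming from `O(A₂) × O(E₆)` extend to `Q`. -/
theorem exists_extension (h : gramO (A 2)) (k : gramO E₆) :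
    ∃ f : modelOQ, ∀ Y, f.1 (modelIncl Y) = modelIncl ((modelTensor (h, k)).1 Y) := by
  obtain ⟨ε, hε1, hε⟩ := exists_sign h k
  have hεε : ε * ε = 1 := by rcases hε1 with rfl | rfl <;> norm_num
  have hε' : ∀ Y Z, A 2 * Y * E₆ = (9 : ℤ) • Z → 3 ∣ tensorMap h⁻¹ k⁻¹ Y 0 0 - ε * Y 0 0 := by
    intro Y Z hZ
    obtain ⟨Z', hZ'⟩ := exists_tensorMap_dvd h⁻¹ k⁻¹ hZ
    have h1 := hε _ _ hZ'
    rw [tensorMap_apply_inv] at h1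
    have h2 : tensorMap h⁻¹ k⁻¹ Y 0 0 - ε * Y 0 0 =
        -ε * (Y 0 0 - ε * tensorMap h⁻¹ k⁻¹ Y 0 0) := by
      linear_combination (-tensorMap h⁻¹ k⁻¹ Y 0 0) * hεε
    rw [h2]
    exact h1.mul_left _
  -- Multiplying the `A₂`-part by the same sign preserves the glue congruences.
  let f : modelQ ≃ₗ[ℤ] modelQ :=
    { toFun := fun q => ⟨_, smul_tensorMap_mem hε q⟩
      invFun := fun q => ⟨_, smul_tensorMap_mem hε' q⟩
      map_add' := fun q r => by
        apply Subtype.ext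
        refine Prod.ext ?_ ?_
        · exact smul_add ε q.1.1 r.1.1
        · exact map_add (tensorMap h k) q.1.2 r.1.2
      map_smul' := fun c q => by
        apply Subtype.ext
        refine Prod.ext ?_ ?_
        · exact smul_comm ε c q.1.1
        · exact map_smul (tensorMap h k) c q.1.2
      left_inv := fun q => by
        apply Subtype.ext
        refine Prod.ext ?_ ?_
        · change ε • ε • q.1.1 = q.1.1
          rw [smul_smul, hεε, one_smul]
        · exact tensorMap_inv_apply h k q.1.2
      right_inv := fun q => by
        apply Subtype.ext
        refine Prod.ext ?_ ?_
        · change ε • ε • q.1.1 = q.1.1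
          rw [smul_smul, hεε, one_smul]
        · exact tensorMap_apply_inv h k q.1.2 }
  refine ⟨⟨f, fun q r => ?_⟩, fun Y => ?_⟩
  · change 6 * ((ε • q.1.1) ⬝ᵥ (ε • r.1.1)) +
      tensorForm (tensorMap h k q.1.2) (tensorMap h k r.1.2) = _
    rw [tensorForm_tensorMap, smul_dotProduct, dotProduct_smul, smul_smul, hεε, one_smul]
    rfl
  · apply Subtype.ext
    refine Prod.ext ?_ ?_
    · exact smul_zero ε
    · exact map_smul (tensorMap h k) 3 Y.1

/-! ### Image and kernel of the restriction map. -/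

variable {φ : modelOQ →* modelOJ}

/-- In the unscaled form, the matrices `3Y` are exactly the vectors of `J` whose products with all
of `Q` are divisible by 3. This description is invariant under `O(Q)`, so a restricted isometry
preserves `√3(A₂ ⊗ E₆)`. -/
theorem exists_map_three_smul (hφ : ∀ f Y, modelIncl ((φ f).1 Y) = f.1 (modelIncl Y))
    (f : modelOQ) (Y : Matrix (Fin 2) (Fin 6) ℤ) (a : Fin 2) (i : Fin 6) :
    3 ∣ ((φ f).1 ⟨_, three_smul_mem_modelJ Y⟩).1 a i := by
  set X := (φ f).1 ⟨_, three_smul_mem_modelJ Y⟩ with hX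
  set Z : Matrix (Fin 2) (Fin 6) ℤ := Matrix.single a i 1 with hZ
  set W := A₂ThreeInv * Z * E₆ThreeInv with hW
  have hWZ : A 2 * W * E₆ = (9 : ℤ) • Z := A₂_mul_dual_mul_E₆ Z
  -- This test vector reads off one entry of `X`. The vector `![1, 1, -2]` has sum zero and all
  -- coordinates congruent to 1 modulo 3, as the glue congruences require.
  let q : modelQ := ⟨(W 0 0 • ![1, 1, -2], W), mem_modelQ.mpr ⟨⟨by simp; ring, fun j => by
    fin_cases j <;> (simp; try omega)⟩, Z, hWZ⟩⟩
  have h1 : modelForm (modelIncl X).1 q.1 = 27 * X.1 a i := by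
    rw [modelIncl_coe, modelForm, zero_dotProduct, mul_zero, zero_add, tensorForm_smul_left,
      tensorForm_eq_sum]
    change 3 * ∑ b, ∑ j, X.1 b j * (A 2 * W * E₆) b j = _
    rw [hWZ, Finset.sum_eq_single a, Finset.sum_eq_single i]
    · simp [hZ]
      ring
    · intro j _ hj
      simp [hZ, Matrix.single_apply_of_col_ne _ _ hj.symm]
    · simp
    · intro b _ hb
      exact Finset.sum_eq_zero fun j _ => by simp [hZ, Matrix.single_apply_of_row_ne hb.symm]
    · simp
  obtain ⟨_, Z', hZ'⟩ := (f⁻¹.1 q).2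
  have h2 : modelForm (modelIncl X).1 q.1 = 9 * tensorForm Y (f⁻¹.1 q).1.2 := by
    rw [hX, hφ, modelForm_modelOQ_left, modelIncl_coe, modelForm, zero_dotProduct]
    simp only [tensorForm_smul_left]
    ring
  have h3 : 9 ∣ tensorForm Y (f⁻¹.1 q).1.2 := by
    rw [tensorForm_eq_sum, hZ']
    refine Finset.dvd_sum fun b _ => Finset.dvd_sum fun j _ => ?_
    exact ⟨Y b j * Z' b j, by simp; ring⟩
  rw [h1] at h2
  omega

/-- Dividing the action on the matrices `3Y` by 3 gives an isometry of `A₂ ⊗ E₆`, hence a tensor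
product. It determines the action on `J`, since `3J` consists of such matrices. -/
theorem exists_modelTensor_eq (hφ : ∀ f Y, modelIncl ((φ f).1 Y) = f.1 (modelIncl Y))
    (f : modelOQ) : ∃ p, modelTensor p = φ f := by
  choose F hF using exists_map_three_smul hφ f
  have hF' : ∀ Y, ((φ f).1 ⟨_, three_smul_mem_modelJ Y⟩).1 = (3 : ℤ) • Matrix.of (F Y) := by
    intro Y
    ext a i
    exact hF Y a i
  let G : Matrix (Fin 2) (Fin 6) ℤ →ₗ[ℤ] Matrix (Fin 2) (Fin 6) ℤ :=
    { toFun := fun Y => Matrix.of (F Y)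
      map_add' := fun X Y => by
        apply matrix_smul_cancel (k := 3) (by norm_num)
        rw [smul_add, ← hF', ← hF', ← hF', ← Submodule.coe_add, ← map_add]
        congr 3
        exact smul_add (3 : ℤ) X Y
      map_smul' := fun c Y => by
        apply matrix_smul_cancel (k := 3) (by norm_num)
        rw [RingHom.id_apply, smul_comm, ← hF', ← hF', ← Submodule.coe_smul, ← map_smul]
        congr 3
        exact smul_comm (3 : ℤ) c Y }
  have hG : ∀ Y, ((φ f).1 ⟨_, three_smul_mem_modelJ Y⟩).1 = (3 : ℤ) • G Y := hF'
  obtain ⟨H, K, hH, hK, hHK⟩ := exists_tensor_of_isometry (f := G) fun X Y => by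
    have h1 := (φ f).2 ⟨_, three_smul_mem_modelJ X⟩ ⟨_, three_smul_mem_modelJ Y⟩
    simp only [hG, tensorForm_smul_left, tensorForm_smul_right] at h1
    omega
  obtain ⟨h, rfl⟩ := exists_gramO_of_matrix det_A₂ hH
  obtain ⟨k, rfl⟩ := exists_gramO_of_matrix det_E₆ hK
  refine ⟨(h, k), ?_⟩
  apply Subtype.ext
  apply LinearEquiv.ext
  intro Y
  apply Subtype.ext
  apply matrix_smul_cancel (k := 3) (by norm_num)
  rw [modelTensor_apply, tensorMap_apply, ← hHK]
  refine (hG Y.1).symm.trans ?_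
  exact congrArg Subtype.val (map_smul (φ f).1 (3 : ℤ) Y)

theorem range_modelTensor (hφ : ∀ f Y, modelIncl ((φ f).1 Y) = f.1 (modelIncl Y)) :
    modelTensor.range = φ.range := by
  apply le_antisymm
  · rintro _ ⟨⟨h, k⟩, rfl⟩
    obtain ⟨f, hf⟩ := exists_extension h k
    refine ⟨f, ?_⟩
    apply Subtype.ext
    apply LinearEquiv.ext
    intro Y
    apply modelIncl_injective
    rw [hφ, hf]
  · rintro _ ⟨f, rfl⟩
    exact exists_modelTensor_eq hφ f

/-- The action of the symmetric group on `Q` by permutation of coordinates. -/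
def modelPerm : Equiv.Perm (Fin 3) →* modelOQ where
  toFun σ := ⟨
    { toFun := fun q => ⟨(q.1.1 ∘ σ.symm, q.1.2), by
        obtain ⟨⟨c, Y⟩, ⟨h1, h2⟩, Z, hZ⟩ := q
        refine mem_modelQ.mpr ⟨⟨?_, fun i => h2 _⟩, Z, hZ⟩
        have := Equiv.sum_comp σ.symm c
        rw [Fin.sum_univ_three, Fin.sum_univ_three] at this
        exact this.trans h1⟩
      invFun := fun q => ⟨(q.1.1 ∘ σ, q.1.2), by
        obtain ⟨⟨c, Y⟩, ⟨h1, h2⟩, Z, hZ⟩ := q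
        refine mem_modelQ.mpr ⟨⟨?_, fun i => h2 _⟩, Z, hZ⟩
        have := Equiv.sum_comp σ c
        rw [Fin.sum_univ_three, Fin.sum_univ_three] at this
        exact this.trans h1⟩
      map_add' := fun _ _ => rfl
      map_smul' := fun _ _ => rfl
      left_inv := fun q => by
        apply Subtype.ext
        refine Prod.ext ?_ rfl
        funext i
        simp
      right_inv := fun q => by
        apply Subtype.ext
        refine Prod.ext ?_ rfl
        funext i
        simp },
    fun q r => by
      change 6 * ((q.1.1 ∘ σ.symm) ⬝ᵥ (r.1.1 ∘ σ.symm)) + tensorForm q.1.2 r.1.2 = _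
      rw [comp_equiv_dotProduct_comp_equiv]
      rfl⟩
  map_one' := rfl
  map_mul' _ _ := rfl

theorem modelPerm_apply (σ : Equiv.Perm (Fin 3)) (q : modelQ) :
    ((modelPerm σ).1 q).1 = (q.1.1 ∘ σ.symm, q.1.2) :=
  rfl

/-- Three elements of `Q` of norm `4` that generate `Q` together with `J`. -/
def modelGlue (i : Fin 3) : modelQ :=
  ⟨((3 : ℤ) • Pi.single i 1 - 1, glueVector), mem_modelQ.mpr ⟨⟨by revert i; decide, fun j => by
    revert i j; decide +kernel⟩, glueVector_dual⟩⟩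

theorem modelGlue_coe (i : Fin 3) :
    (modelGlue i).1 = ((3 : ℤ) • Pi.single i 1 - 1, glueVector) :=
  rfl

theorem fst_dotProduct_modelGlue (q : modelQ) (i : Fin 3) :
    q.1.1 ⬝ᵥ (modelGlue i).1.1 = 3 * q.1.1 i := by
  obtain ⟨⟨h, -⟩, -⟩ := q.2
  rw [modelGlue_coe, dotProduct_sub, dotProduct_smul, dotProduct_single, dotProduct_one,
    Fin.sum_univ_three, h]
  simp

theorem modelPerm_injective : Function.Injective modelPerm := by
  intro σ τ h
  apply Equiv.symm_bijective.injective
  ext1 i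
  have h1 : ∀ j, (modelGlue j).1.1 (σ.symm i) = (modelGlue j).1.1 (τ.symm i) := fun j =>
    congrFun (congrArg (fun f : modelOQ => (f.1 (modelGlue j)).1.1) h) i
  have h2 := h1 (σ.symm i)
  by_contra hne
  simp [modelGlue_coe, Ne.symm hne] at h2

/-- The congruence and the norm leave only `-1` and 2 as coordinates, and with sum zero exactly one
coordinate is 2. -/
theorem exists_eq_single {c : Fin 3 → ℤ} (h1 : c 0 + c 1 + c 2 = 0) (h2 : ∀ i, 3 ∣ c i + 4)
    (h3 : c ⬝ᵥ c = 6) : ∃ i : Fin 3, c = (3 : ℤ) • Pi.single i 1 - 1 := by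
  have h3' : c 0 * c 0 + c 1 * c 1 + c 2 * c 2 = 6 := by
    rw [← h3, dotProduct, Fin.sum_univ_three]
  have hb : ∀ i, c i = -1 ∨ c i = 2 := fun i => by
    have h4 : c i * c i ≤ 6 := by
      rw [← h3]
      exact Finset.single_le_sum (f := fun i => c i * c i) (fun j _ => mul_self_nonneg _)
        (Finset.mem_univ i)
    have h5 : c i ≤ 2 := by nlinarith
    have h6 : -2 ≤ c i := by nlinarith
    have := h2 i
    omega
  have b0 := hb 0
  have b1 := hb 1
  have b2 := hb 2
  have hcases : (c 0 = 2 ∧ c 1 = -1 ∧ c 2 = -1) ∨ (c 0 = -1 ∧ c 1 = 2 ∧ c 2 = -1) ∨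
      (c 0 = -1 ∧ c 1 = -1 ∧ c 2 = 2) := by omega
  have hc : c = ![c 0, c 1, c 2] := by
    ext i; fin_cases i <;> rfl
  rcases hcases with ⟨e0, e1, e2⟩ | ⟨e0, e1, e2⟩ | ⟨e0, e1, e2⟩
  · exact ⟨0, by rw [hc, e0, e1, e2]; decide⟩
  · exact ⟨1, by rw [hc, e0, e1, e2]; decide⟩
  · exact ⟨2, by rw [hc, e0, e1, e2]; decide⟩

theorem range_modelPerm (hφ : ∀ f Y, modelIncl ((φ f).1 Y) = f.1 (modelIncl Y)) :
    modelPerm.range = φ.ker := by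
  apply le_antisymm
  · rintro _ ⟨σ, rfl⟩
    rw [MonoidHom.mem_ker]
    apply Subtype.ext
    apply LinearEquiv.ext
    intro Y
    apply modelIncl_injective
    rw [hφ]
    apply Subtype.ext
    rw [modelPerm_apply, modelIncl_coe]
    rfl
  · intro f hf
    have hfJ : ∀ Y, f.1 (modelIncl Y) = modelIncl Y := fun Y => by
      rw [← hφ, MonoidHom.mem_ker.mp hf]
      rfl
    have hsnd : ∀ q, (f.1 q).1.2 = q.1.2 := fun q => by
      apply eq_of_forall_tensorForm
      intro W
      have h1 := modelForm_modelOQ f q (modelIncl ⟨_, three_smul_mem_modelJ W⟩)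
      rw [hfJ, modelIncl_coe] at h1
      simp only [modelForm, dotProduct_zero, mul_zero, zero_add, tensorForm_smul_right] at h1
      omega
    -- Norm and second component are preserved, and only three vectors of `modelQ` share those of a
    -- glue vector.
    have hglue : ∀ i, ∃ j, f.1 (modelGlue i) = modelGlue j := by
      intro i
      have h1 := modelForm_modelOQ f (modelGlue i) (modelGlue i)
      simp only [modelForm, hsnd] at h1
      have h2 : (modelGlue i).1.1 ⬝ᵥ (modelGlue i).1.1 = 6 := by
        rw [fst_dotProduct_modelGlue, modelGlue_coe]
        simp
      have h4 := hsnd (modelGlue i)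
      obtain ⟨⟨g1, g2⟩, -⟩ := (f.1 (modelGlue i)).2
      rw [h4] at g2
      obtain ⟨j, hj⟩ := exists_eq_single g1 (fun l => by
        have := g2 l
        change 3 ∣ _ - (-4) at this
        omega) (by omega)
      exact ⟨j, Subtype.ext (Prod.ext hj h4)⟩
    choose s hs using hglue
    have hinj : Function.Injective modelGlue := by
      intro i j h
      have h1 := congrArg (fun q : modelQ => q.1.1 i) h
      by_contra hne
      simp [modelGlue_coe, hne] at h1
    have hsinj : Function.Injective s := by
      intro i j h
      apply hinj
      apply f.1.injective
      rw [hs, hs, h]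
    refine ⟨Equiv.ofBijective s (Finite.injective_iff_bijective.mp hsinj), ?_⟩
    apply Subtype.ext
    apply LinearEquiv.ext
    intro q
    apply Subtype.ext
    rw [modelPerm_apply]
    refine Prod.ext ?_ (hsnd q).symm
    funext i
    obtain ⟨j, rfl⟩ := (Finite.injective_iff_bijective.mp hsinj).2 i
    -- Products with the glue vectors recover the coordinates of the first component, so `f` is
    -- determined by its permutation of them.
    have h1 := modelForm_modelOQ f q (modelGlue j)
    rw [hs, modelForm, modelForm, fst_dotProduct_modelGlue, fst_dotProduct_modelGlue, hsnd,
      modelGlue_coe, modelGlue_coe] at h1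
    have h2 : (Equiv.ofBijective s (Finite.injective_iff_bijective.mp hsinj)).symm (s j) = j :=
      Equiv.ofBijective_symm_apply_apply s _ j
    change q.1.1 (Equiv.symm _ (s j)) = _
    rw [h2]
    simp only at h1
    omega

end ModelGroup

/-! ### The Coxeter–Todd lattice -/

section CoxeterToddModel

/-- An integral vector generating the dual lattice of `E₆` modulo `E₆`, up to the factor `-3`. -/
def E₆Glue : Fin 6 → ℤ := ![2, 3, 4, 6, 5, 4]

/-- Modulo 3 the matrix `E₆ThreeInv` has rank one with column space spanned by `E₆Glue`. The first
entry 2 of `E₆Glue` makes `-x 0` a possible coefficient. -/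
theorem exists_eq_smul_glue_add {x z : Fin 6 → ℤ} (h : E₆ *ᵥ x = (3 : ℤ) • z) :
    ∃ (l : ℤ) (y : Fin 6 → ℤ), x = l • E₆Glue + (3 : ℤ) • y := by
  have hx : x = E₆ThreeInv *ᵥ z := by
    have h1 := congrArg (E₆ThreeInv *ᵥ ·) h
    simp only [mulVec_mulVec, E₆_threeInv_mul, mulVec_smul] at h1
    rw [smul_mulVec, one_mulVec] at h1
    ext i
    exact mul_left_cancel₀ (by norm_num : (3 : ℤ) ≠ 0) (congrFun h1 i)
  have h2 : ∀ i, 3 ∣ x i + x 0 * E₆Glue i := by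
    intro i
    rw [hx]
    simp only [mulVec, dotProduct, Fin.sum_univ_six]
    fin_cases i <;> simp [E₆ThreeInv, E₆Glue] <;> omega
  choose y hy using h2
  refine ⟨-x 0, y, ?_⟩
  ext i
  have := hy i
  simp only [Pi.add_apply, Pi.smul_apply, smul_eq_mul]
  linarith

/-- Both rows of `A 2 * Y` are congruent to `-(Y 0 + Y 1)` modulo 3, so the two divisibility
conditions collapse to one. -/
theorem mem_modelJ_iff {Y : Matrix (Fin 2) (Fin 6) ℤ} :
    Y ∈ modelJ ↔ ∃ z, E₆ *ᵥ (Y 0 + Y 1) = (3 : ℤ) • z := by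
  have hrow0 : (A 2 * Y * E₆) 0 = E₆ *ᵥ ((2 : ℤ) • Y 0 - Y 1) := by
    rw [← E₆_transpose, mulVec_transpose, E₆_transpose, Matrix.mul_apply_eq_vecMul]
    congr 1
    ext i
    rw [Matrix.mul_apply, Fin.sum_univ_two, A₂_eq]
    simp
    ring
  have hrow1 : (A 2 * Y * E₆) 1 = E₆ *ᵥ ((2 : ℤ) • Y 1 - Y 0) := by
    rw [← E₆_transpose, mulVec_transpose, E₆_transpose, Matrix.mul_apply_eq_vecMul]
    congr 1
    ext i
    rw [Matrix.mul_apply, Fin.sum_univ_two, A₂_eq]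
    simp
    ring
  constructor
  · rintro ⟨Z, hZ⟩
    refine ⟨Z 0 + Z 1, ?_⟩
    have h0 : E₆ *ᵥ ((2 : ℤ) • Y 0 - Y 1) = (3 : ℤ) • Z 0 := by
      rw [← hrow0, hZ]
      rfl
    have h1 : E₆ *ᵥ ((2 : ℤ) • Y 1 - Y 0) = (3 : ℤ) • Z 1 := by
      rw [← hrow1, hZ]
      rfl
    rw [smul_add, ← h0, ← h1, ← mulVec_add]
    congr 1
    module
  · rintro ⟨z, hz⟩
    refine ⟨![z + z - E₆ *ᵥ Y 1 , z + z - E₆ *ᵥ Y 0], ?_⟩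
    have h0 : (A 2 * Y * E₆) 0 = (3 : ℤ) • (z + z - E₆ *ᵥ Y 1) := by
      rw [hrow0, smul_sub, smul_add, ← hz, ← mulVec_smul, ← mulVec_add, ← mulVec_sub]
      congr 1
      module
    have h1 : (A 2 * Y * E₆) 1 = (3 : ℤ) • (z + z - E₆ *ᵥ Y 0) := by
      rw [hrow1, smul_sub, smul_add, ← hz, ← mulVec_smul, ← mulVec_add, ← mulVec_sub]
      congr 1
      module
    ext a i
    fin_cases a
    · exact congrFun h0 i
    · exact congrFun h1 i

/-! ### Matrices over `ℤ[ω]` and the embedding of `modelJ` in `ℂ⁶`. -/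

theorem omega_sq : omega ^ 2 = -1 - omega := by
  have h3 : Real.sqrt 3 * Real.sqrt 3 = 3 := Real.mul_self_sqrt (by norm_num)
  apply Complex.ext
  · simp [omega, sq]
    linarith
  · simp [omega, sq]
    ring

theorem star_omega : star omega = -1 - omega := by
  apply Complex.ext
  · simp [omega]
    norm_num
  · simp [omega]

/-- A matrix over `ℤ[ω]`, with given coordinates. -/
noncomputable def eis {m n : Type*} (P R : Matrix m n ℤ) : Matrix m n ℂ :=
  P.map (Int.castRingHom ℂ) + omega • R.map (Int.castRingHom ℂ)

theorem eis_apply {m n : Type*} (P R : Matrix m n ℤ) (i : m) (j : n) :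
    eis P R i j = P i j + omega * R i j :=
  rfl

theorem eis_mul {l m n : Type*} [Fintype m] (P R : Matrix l m ℤ) (S T : Matrix m n ℤ) :
    eis P R * eis S T = eis (P * S - R * T) (P * T + R * S - R * T) := by
  have h : ∀ i j k, (P i k + omega * R i k) * (S k j + omega * T k j) =
      ((P i k * S k j - R i k * T k j : ℤ) : ℂ) +
        omega * ((P i k * T k j + R i k * S k j - R i k * T k j : ℤ) : ℂ) := by
    intro i j k
    push_cast
    linear_combination (R i k : ℂ) * T k j * omega_sq
  ext i j
  rw [Matrix.mul_apply, eis_apply]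
  simp only [eis_apply, h, Finset.sum_add_distrib, ← Finset.mul_sum, Matrix.add_apply,
    Matrix.sub_apply, Matrix.mul_apply, Finset.sum_sub_distrib, Int.cast_sub, Int.cast_add,
    Int.cast_sum]

theorem eis_add {m n : Type*} (P R S T : Matrix m n ℤ) :
    eis P R + eis S T = eis (P + S) (R + T) := by
  ext i j
  simp only [Matrix.add_apply, eis_apply, Int.cast_add]
  ring

theorem intCast_smul_eis {m n : Type*} (k : ℤ) (P R : Matrix m n ℤ) :
    (k : ℂ) • eis P R = eis (k • P) (k • R) := by
  ext i j
  simp only [Matrix.smul_apply, eis_apply, smul_eq_mul, Int.cast_mul]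
  ring

theorem one_sub_omega_smul_eis {m n : Type*} (P R : Matrix m n ℤ) :
    (1 - omega) • eis P R = eis (P + R) ((2 : ℤ) • R - P) := by
  ext i j
  simp only [Matrix.smul_apply, Matrix.sub_apply, Matrix.add_apply, eis_apply, smul_eq_mul,
    Int.cast_sub, Int.cast_add, Int.cast_mul]
  push_cast
  linear_combination (-(R i j : ℂ)) * omega_sq

theorem eis_mem {m n : Type*} (P R : Matrix m n ℤ) (i : m) (j : n) :
    eis P R i j ∈ eisenstein :=
  ⟨P i j, R i j, by rw [eis_apply, mul_comm omega]⟩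

theorem omega_mul_mem {z : ℂ} (hz : z ∈ eisenstein) : omega * z ∈ eisenstein := by
  obtain ⟨a, b, rfl⟩ := hz
  exact ⟨-b, a - b, by push_cast; linear_combination (b : ℂ) * omega_sq⟩

theorem vecMul_mem {n : ℕ} {S : AddSubgroup (Fin 6 → ℂ)} (hS : ∀ x ∈ S, omega • x ∈ S)
    {M : Matrix (Fin n) (Fin 6) ℂ} (hM : ∀ k, M k ∈ S) {c : Fin n → ℂ}
    (hc : ∀ k, c k ∈ eisenstein) : c ᵥ* M ∈ S := by
  rw [vecMul_eq_sum]
  refine AddSubgroup.sum_mem _ fun k _ => ?_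
  obtain ⟨a, b, hab⟩ := hc k
  have h : c k • M k = a • M k + b • (omega • M k) := by
    rw [hab]
    ext j
    simp
    ring
  rw [h]
  exact add_mem (S.zsmul_mem (hM k) a) (S.zsmul_mem (hS _ (hM k)) b)

theorem omega_smul_mem_coxeterTodd : ∀ x ∈ coxeterTodd, omega • x ∈ coxeterTodd := by
  rintro _ ⟨c, y, hc, hy, rfl⟩
  refine ⟨omega • c, omega • y, fun i => omega_mul_mem (hc i), fun j => omega_mul_mem (hy j), ?_⟩
  rw [smul_vecMul, smul_add, smul_comm omega (2 : ℂ)]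

theorem row_mem_coxeterTodd {n : ℕ} (P R : Matrix (Fin n) (Fin 3) ℤ) (S T : Matrix (Fin n) (Fin 6) ℤ)
    (k : Fin n) : (eis P R * hexacodeGen + (2 : ℂ) • eis S T) k ∈ coxeterTodd :=
  ⟨eis P R k, eis S T k, eis_mem P R k, eis_mem S T k, rfl⟩

/-- The coordinates of `hexacodeGen`. -/
def hexRe : Matrix (Fin 3) (Fin 6) ℤ := !![1, 1, 1, 1, 0, 0; 0, 0, 1, 1, 1, 1; 1, 0, 0, -1, 0, -1]

/-- The coefficients at `ω` of the generators of the hexacode. -/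
def hexOm : Matrix (Fin 3) (Fin 6) ℤ := !![0, 0, 0, 0, 0, 0; 0, 0, 0, 0, 0, 0; 0, 1, 0, -1, 0, -1]

theorem hexacodeGen_eq : hexacodeGen = eis hexRe hexOm := by
  ext i j
  rw [eis_apply]
  fin_cases i <;> fin_cases j <;> simp [hexacodeGen, hexRe, hexOm, omega_sq] <;> ring

/-- The coordinates of six vectors of `coxeterTodd` with Hermitian Gram matrix `2 E₆`. -/
def rootRe : Matrix (Fin 6) (Fin 6) ℤ :=
  !![2, 0, 0, 0, 0, 0; 0, 0, 1, 1, 1, 1; -1, 0, 0, -1, 0, 1; 0, -1, -1, 0, 0, -1;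
     0, 1, 1, 0, -1, 0; 0, 0, 0, 0, 0, 0]

/-- The coefficients at `ω` of the vectors with integral parts `rootRe`. -/
def rootOm : Matrix (Fin 6) (Fin 6) ℤ :=
  !![0, 0, 0, 0, 0, 0; 0, 0, 0, 0, 0, 0; 0, 1, 0, -1, 0, 1; 0, -1, 0, 1, 0, -1;
     0, 0, 1, -1, 0, 0; 0, 0, -1, 1, -1, 1]

/-- Six vectors of `coxeterTodd` with Hermitian Gram matrix `2 E₆`. -/
noncomputable def rootMatrix : Matrix (Fin 6) (Fin 6) ℂ := eis rootRe rootOm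

theorem rootMatrix_gram :
    rootMatrix * rootMatrixᴴ = (2 : ℂ) • E₆.map (Int.castRingHom ℂ) := by
  have h : rootMatrixᴴ = eis (rootReᵀ - rootOmᵀ) (-rootOmᵀ) := by
    ext i j
    rw [conjTranspose_apply, rootMatrix, eis_apply, eis_apply]
    simp only [star_add, star_mul', star_omega, star_intCast, Matrix.sub_apply, Matrix.neg_apply,
      transpose_apply, Int.cast_sub, Int.cast_neg]
    ring
  have h1 : rootRe * (rootReᵀ - rootOmᵀ) - rootOm * (-rootOmᵀ) = (2 : ℤ) • E₆ := by
    decide +kernel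
  have h2 : rootRe * (-rootOmᵀ) + rootOm * (rootReᵀ - rootOmᵀ) - rootOm * (-rootOmᵀ) = 0 := by
    decide +kernel
  rw [h, rootMatrix, eis_mul, h1, h2]
  ext i j
  change ((2 * E₆ i j : ℤ) : ℂ) + omega * ((0 : ℤ) : ℂ) = 2 * ((E₆ i j : ℤ) : ℂ)
  push_cast
  ring

theorem rootMatrix_mem (i : Fin 6) : rootMatrix i ∈ coxeterTodd := by
  have h : rootMatrix =
      eis !![0, 0, 0; 0, 1, 0; 0, 0, 1; 1, 0, 1; 0, 1, 0; 0, 0, 0]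
          !![0, 0, 0; 0, 0, 0; 0, 0, 0; 0, 0, 0; 1, 0, 1; 0, 1, 0] * hexacodeGen +
      (2 : ℂ) • eis
        !![1, 0, 0, 0, 0, 0; 0, 0, 0, 0, 0, 0; -1, 0, 0, 0, 0, 1; -1, -1, -1, 0, 0, 0;
           0, 1, 0, -1, -1, -1; 0, 0, 0, 0, 0, 0]
        !![0, 0, 0, 0, 0, 0; 0, 0, 0, 0, 0, 0; 0, 0, 0, 0, 0, 1; 0, -1, 0, 1, 0, 0;
           -1, 0, 0, -1, 0, 0; 0, 0, -1, 0, -1, 0] := by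
    have h2 : (2 : ℂ) = ((2 : ℤ) : ℂ) := by norm_num
    rw [hexacodeGen_eq, eis_mul, h2, intCast_smul_eis, eis_add, rootMatrix]
    congr 1 <;> decide +kernel
  rw [h]
  exact row_mem_coxeterTodd _ _ _ _ i

theorem rootMatrix_glue_mem :
    (((1 - omega) / 3) • (fun i => (E₆Glue i : ℂ))) ᵥ* rootMatrix ∈ coxeterTodd := by
  have h : ((1 - omega) / 3) • eis (Matrix.of ![E₆Glue]) 0 * rootMatrix =
      eis !![1, 0, 1] 0 * hexacodeGen +
      (2 : ℂ) • eis !![-1, -1, 0, 0, -1, 1] !![0, -1, 0, 1, -1, 1] := by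
    have h2 : (2 : ℂ) = ((2 : ℤ) : ℂ) := by norm_num
    have h3 : ((1 - omega) / 3) • eis (Matrix.of ![E₆Glue]) 0 * rootMatrix =
      ((3 : ℂ)⁻¹) • ((1 - omega) • eis (Matrix.of ![E₆Glue]) 0 * rootMatrix) := by
      rw [Matrix.smul_mul, Matrix.smul_mul, smul_smul, div_eq_inv_mul]
    rw [h3, inv_smul_eq_iff₀ (by norm_num), one_sub_omega_smul_eis, rootMatrix, eis_mul,
      hexacodeGen_eq, eis_mul, h2, intCast_smul_eis, eis_add,
      show (3 : ℂ) = ((3 : ℤ) : ℂ) by norm_num, intCast_smul_eis]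
    congr 1 <;> decide +kernel
  have h1 := row_mem_coxeterTodd !![1, 0, 1] 0 !![-1, -1, 0, 0, -1, 1] !![0, -1, 0, 1, -1, 1] 0
  rw [← h, Matrix.mul_apply_eq_vecMul] at h1
  convert h1 using 2
  ext i
  simp [eis_apply]

/-- The coefficients of an element of `modelJ` with respect to `rootMatrix`. -/
noncomputable def coxCoeff : Matrix (Fin 2) (Fin 6) ℤ →+ (Fin 6 → ℂ) where
  toFun Y := ((1 - omega) / 3) • fun i => (Y 0 i + omega * Y 1 i : ℂ)
  map_zero' := by
    ext i
    simp
  map_add' X Y := by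
    ext i
    simp
    ring

theorem coxCoeff_apply (Y : Matrix (Fin 2) (Fin 6) ℤ) (i : Fin 6) :
    coxCoeff Y i = (1 - omega) / 3 * (Y 0 i + omega * Y 1 i) :=
  rfl

/-- The embedding of `modelJ` in `ℂ⁶`. -/
noncomputable def coxEmb : modelJ →+ (Fin 6 → ℂ) where
  toFun Y := coxCoeff Y.1 ᵥ* rootMatrix
  map_zero' := by
    change coxCoeff 0 ᵥ* rootMatrix = 0
    rw [map_zero, zero_vecMul]
  map_add' X Y := by
    change coxCoeff (X.1 + Y.1) ᵥ* rootMatrix = _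
    rw [map_add, add_vecMul]

theorem coxEmb_apply (Y : modelJ) : coxEmb Y = coxCoeff Y.1 ᵥ* rootMatrix := rfl

/-- Twice the real part of the Hermitian form makes `ℤ[ω]` a copy of `A₂`, and the rows of
`rootMatrix` supply `2E₆`. The scalar `(1 - ω)/3` has squared modulus `1/3`, which accounts for the
factor 3. -/
theorem hermForm_coxEmb (X Y : modelJ) :
    3 * hermForm (coxEmb X) (coxEmb Y) = (tensorForm X.1 Y.1 : ℝ) := by
  have h1 : (∑ i, coxEmb X i * (starRingEnd ℂ) (coxEmb Y i)) =
      coxCoeff X.1 ⬝ᵥ ((2 : ℂ) • E₆.map (Int.castRingHom ℂ)) *ᵥ star (coxCoeff Y.1) := by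
    change coxEmb X ⬝ᵥ star (coxEmb Y) = _
    rw [← rootMatrix_gram, coxEmb_apply, coxEmb_apply, star_vecMul, ← dotProduct_mulVec,
      mulVec_mulVec]
  have hnorm : (1 - omega) / 3 * star ((1 - omega) / 3) = 1 / 3 := by
    rw [star_div₀, star_sub, star_omega, star_one, star_ofNat]
    linear_combination (-1 / 9 : ℂ) * omega_sq
  have hre : omega.re = -1 / 2 := rfl
  have h2 : ∀ i j, (coxCoeff X.1 i * star (coxCoeff Y.1 j)).re =
      (1 / 3) * ((X.1 0 i * Y.1 0 j + X.1 1 i * Y.1 1 j : ℤ) -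
        (1 / 2) * (X.1 0 i * Y.1 1 j + X.1 1 i * Y.1 0 j : ℤ) : ℝ) := by
    intro i j
    have h3 : coxCoeff X.1 i * star (coxCoeff Y.1 j) = ((1 / 3 : ℝ) : ℂ) *
        (((X.1 0 i * Y.1 0 j + X.1 1 i * Y.1 1 j - X.1 0 i * Y.1 1 j : ℤ) : ℂ) +
          omega * ((X.1 1 i * Y.1 0 j - X.1 0 i * Y.1 1 j : ℤ) : ℂ)) := by
      rw [coxCoeff_apply, coxCoeff_apply, star_mul', star_add, star_mul', star_omega,
        star_intCast, star_intCast]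
      push_cast
      linear_combination ((X.1 0 i + omega * X.1 1 i : ℂ) *
        (Y.1 0 j + (-1 - omega) * Y.1 1 j)) * hnorm -
        (1 / 3 : ℂ) * X.1 1 i * Y.1 1 j * omega_sq
    rw [h3, Complex.re_ofReal_mul, Complex.add_re, Complex.intCast_re, mul_comm omega,
      ← Complex.ofReal_intCast (X.1 1 i * Y.1 0 j - X.1 0 i * Y.1 1 j), Complex.re_ofReal_mul, hre]
    push_cast
    ring
  have h4 : hermForm (coxEmb X) (coxEmb Y) = ∑ i, ∑ j, 2 * (E₆ i j : ℝ) *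
      (coxCoeff X.1 i * star (coxCoeff Y.1 j)).re := by
    rw [hermForm, h1]
    simp only [dotProduct, mulVec, Finset.mul_sum, Complex.re_sum]
    refine Finset.sum_congr rfl fun i _ => Finset.sum_congr rfl fun j _ => ?_
    have h5 : coxCoeff X.1 i * (((2 : ℂ) • E₆.map (Int.castRingHom ℂ)) i j *
        star (coxCoeff Y.1) j) = ((2 * E₆ i j : ℤ) : ℂ) * (coxCoeff X.1 i *
          star (coxCoeff Y.1 j)) := by
      simp only [Matrix.smul_apply, Matrix.map_apply, smul_eq_mul, Pi.star_apply, Int.cast_mul]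
      simp
      ring
    rw [h5, ← Complex.ofReal_intCast, Complex.re_ofReal_mul]
    push_cast
    ring
  have h6 : tensorForm X.1 Y.1 = ∑ i, ∑ j, E₆ i j * (2 * (X.1 0 i * Y.1 0 j + X.1 1 i * Y.1 1 j)
      - (X.1 0 i * Y.1 1 j + X.1 1 i * Y.1 0 j)) := by
    have hsym : ∀ i j, E₆ j i = E₆ i j := fun i j => congrFun (congrFun E₆_transpose i) j
    rw [tensorForm_eq_sum, Finset.sum_comm]
    refine Finset.sum_congr rfl fun i _ => ?_
    rw [Fin.sum_univ_two, Matrix.mul_apply, Matrix.mul_apply, Finset.mul_sum, Finset.mul_sum,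
      ← Finset.sum_add_distrib]
    refine Finset.sum_congr rfl fun j _ => ?_
    rw [Matrix.mul_apply, Matrix.mul_apply, Fin.sum_univ_two, Fin.sum_univ_two, A₂_eq, hsym]
    simp
    ring
  rw [h4, h6, Finset.mul_sum]
  push_cast
  refine Finset.sum_congr rfl fun i _ => ?_
  rw [Finset.mul_sum]
  refine Finset.sum_congr rfl fun j _ => ?_
  rw [h2]
  push_cast
  ring

theorem coxEmb_injective : Function.Injective coxEmb := by
  rw [injective_iff_map_eq_zero]
  intro Y hY
  have h := hermForm_coxEmb Y Y
  rw [hY] at h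
  simp only [hermForm, Pi.zero_apply, zero_mul, Finset.sum_const_zero, Complex.zero_re,
    mul_zero] at h
  exact Subtype.ext (eq_zero_of_tensorForm (by exact_mod_cast h.symm))

theorem coxEmb_mem (Y : modelJ) : coxEmb Y ∈ coxeterTodd := by
  obtain ⟨z, hz⟩ := mem_modelJ_iff.mp Y.2
  obtain ⟨l, X, hX⟩ := exists_eq_smul_glue_add hz
  have hX' : ∀ i, Y.1 0 i = l * E₆Glue i + 3 * X i - Y.1 1 i := fun i => by
    have := congrFun hX i
    simp only [Pi.add_apply, Pi.smul_apply, smul_eq_mul] at this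
    linarith
  -- After eliminating `Y 0`, the identity `(1 - ω)(ω - 1) = 3ω` cancels the denominator everywhere
  -- except in the glue term.
  have h : coxCoeff Y.1 = l • (((1 - omega) / 3) • (fun i => (E₆Glue i : ℂ))) +
      fun i => (1 - omega) * X i + omega * Y.1 1 i := by
    ext i
    rw [coxCoeff_apply, hX']
    change _ = l • ((1 - omega) / 3 * (E₆Glue i : ℂ)) + ((1 - omega) * X i + omega * Y.1 1 i)
    rw [zsmul_eq_mul]
    push_cast
    linear_combination (-(Y.1 1 i : ℂ) / 3) * omega_sq
  rw [coxEmb_apply, h, add_vecMul, smul_vecMul]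
  refine add_mem (coxeterTodd.zsmul_mem rootMatrix_glue_mem l) ?_
  refine vecMul_mem omega_smul_mem_coxeterTodd rootMatrix_mem fun i => ?_
  exact ⟨X i, Y.1 1 i - X i, by push_cast; ring⟩

theorem omega_smul_mem_range : ∀ x ∈ coxEmb.range, omega • x ∈ coxEmb.range := by
  rintro _ ⟨Y, rfl⟩
  obtain ⟨z, hz⟩ := mem_modelJ_iff.mp Y.2
  refine ⟨⟨![-Y.1 1, Y.1 0 - Y.1 1], mem_modelJ_iff.mpr ⟨z - E₆ *ᵥ Y.1 1, ?_⟩⟩, ?_⟩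
  · rw [smul_sub, ← hz, ← mulVec_smul, ← mulVec_sub]
    congr 1
    change -Y.1 1 + (Y.1 0 - Y.1 1) = _
    module
  · rw [coxEmb_apply, coxEmb_apply, ← smul_vecMul]
    congr 1
    ext i
    rw [Pi.smul_apply, coxCoeff_apply, coxCoeff_apply, smul_eq_mul]
    simp
    linear_combination (-((1 - omega) / 3 * Y.1 1 i)) * omega_sq

/-- A certificate of membership: `P` and `R` are the two rows of the preimages, `Z` witnesses the
condition of `modelJ`, and clearing the denominator 3 leaves an integer matrix identity. -/
theorem row_mem_range {n : ℕ} {P R Z : Matrix (Fin n) (Fin 6) ℤ} {M : Matrix (Fin n) (Fin 6) ℂ}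
    (hZ : (P + R) * E₆ = (3 : ℤ) • Z)
    (hM : (1 - omega) • eis P R * rootMatrix = (3 : ℂ) • M) (k : Fin n) :
    M k ∈ coxEmb.range := by
  refine ⟨⟨![P k, R k], mem_modelJ_iff.mpr ⟨Z k, ?_⟩⟩, ?_⟩
  · rw [← E₆_transpose, mulVec_transpose]
    exact congrFun hZ k
  · have h : M = ((1 - omega) / 3) • eis P R * rootMatrix := by
      have h3 : M = (3 : ℂ)⁻¹ • (3 : ℂ) • M := by rw [smul_smul]; norm_num
      rw [h3, ← hM, Matrix.smul_mul, Matrix.smul_mul, smul_smul, div_eq_inv_mul]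
    rw [h, Matrix.mul_apply_eq_vecMul, coxEmb_apply]
    congr 1

theorem hexacodeGen_mem_range (k : Fin 3) : hexacodeGen k ∈ coxEmb.range := by
  refine row_mem_range
    (P := !![0, 0, -2, -2, 0, 0; 0, 2, 0, 0, 0, 0; 1, -1, 0, -1, -1, -1])
    (R := !![0, 0, -1, -1, 0, 0; 0, 1, 0, 0, 0, 0; 0, -2, -1, -2, -1, 0])
    (Z := !![1, 1, -1, -1, 1, 0; 0, 2, 0, -1, 0, 0; 1, -1, 0, 0, 0, 0])
    (by decide +kernel) ?_ k
  rw [one_sub_omega_smul_eis, rootMatrix, eis_mul, hexacodeGen_eq,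
    show (3 : ℂ) = ((3 : ℤ) : ℂ) by norm_num, intCast_smul_eis]
  congr 1 <;> decide +kernel

theorem two_mem_range (k : Fin 6) :
    ((2 : ℂ) • (1 : Matrix (Fin 6) (Fin 6) ℂ)) k ∈ coxEmb.range := by
  refine row_mem_range
    (P := !![2, 0, 0, 0, 0, 0; -1, -1, -2, -2, 0, 0; 0, 1, 0, 0, 1, 1; -1, 0, -2, -2, -1, -1;
             0, 1, 0, 0, -1, 0; 1, 2, 2, 2, 1, 0])
    (R := !![1, 0, 0, 0, 0, 0; 0, 1, 0, 2, 2, 1; -1, -1, -2, -3, -2, 0; 0, 0, 0, -1, 0, -1;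
             1, 2, 2, 3, 2, 2; 0, 1, 0, 1, 0, -1])
    (Z := !![2, 0, -1, 0, 0, 0; 0, 0, -1, 0, 1, 0; 0, 1, 0, -1, 0, 1; 0, 1, 0, -1, 1, -1;
             0, 1, 0, 0, -1, 1; 0, 1, 0, 0, 0, -1])
    (by decide +kernel) ?_ k
  have h1 : (2 : ℂ) • (1 : Matrix (Fin 6) (Fin 6) ℂ) = eis ((2 : ℤ) • 1) 0 := by
    ext i j
    change (2 : ℂ) * (1 : Matrix (Fin 6) (Fin 6) ℂ) i j =
      ((2 * (1 : Matrix (Fin 6) (Fin 6) ℤ) i j : ℤ) : ℂ) + omega * ((0 : ℤ) : ℂ)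
    simp only [Matrix.one_apply]
    split_ifs <;> simp
  rw [one_sub_omega_smul_eis, rootMatrix, eis_mul, h1,
    show (3 : ℂ) = ((3 : ℤ) : ℂ) by norm_num, intCast_smul_eis]
  congr 1 <;> decide +kernel

theorem range_coxEmb : coxEmb.range = coxeterTodd := by
  apply le_antisymm
  · rintro _ ⟨Y, rfl⟩
    exact coxEmb_mem Y
  · rintro _ ⟨c, y, hc, hy, rfl⟩
    refine add_mem (vecMul_mem omega_smul_mem_range hexacodeGen_mem_range hc) ?_
    have h : (2 : ℂ) • y = y ᵥ* ((2 : ℂ) • (1 : Matrix (Fin 6) (Fin 6) ℂ)) := by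
      rw [vecMul_smul, vecMul_one]
    rw [h]
    exact vecMul_mem omega_smul_mem_range two_mem_range hy

/-- The model of `J` is the Coxeter–Todd lattice. -/
theorem exists_coxeterTodd_equiv : ∃ e : modelJ ≃+ coxeterTodd,
    ∀ X Y, 3 * hermForm (e X : Fin 6 → ℂ) (e Y : Fin 6 → ℂ) = (tensorForm X.1 Y.1 : ℝ) :=
  ⟨(AddMonoidHom.ofInjective coxEmb_injective).trans (AddEquiv.addSubgroupCongr range_coxEmb),
    fun X Y => hermForm_coxEmb X Y⟩

end CoxeterToddModel

/-! ### Even binary forms of determinant `3` -/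

section Binary

/-- The Gram matrix times an integer matrix is 3 times the identity, so its determinant divides 9,
while an even binary form has determinant 0 or 3 modulo 4. -/
theorem det_eq_three_of_mul_eq {a b c p q r s : ℤ} (ha : Even a) (hc : Even c)
    (hd : 0 < a * c - b * b) (h1 : p * a + q * b = 3) (h2 : p * b + q * c = 0)
    (h3 : r * a + s * b = 0) (h4 : r * b + s * c = 3) : a * c - b * b = 3 := by
  have hdet : (a * c - b * b) * (p * s - q * r) = 9 := by
    linear_combination (r * b + s * c) * h1 + 3 * h4 - (r * a + s * b) * h2
  set d := a * c - b * b with hdef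
  have hdvd : d ∣ 9 := ⟨_, hdet.symm⟩
  have hle : d ≤ 9 := Int.le_of_dvd (by norm_num) hdvd
  have hsq : b * b % 4 = 0 ∨ b * b % 4 = 1 := by
    rcases Int.even_or_odd' b with ⟨k, hk | hk⟩
    · left
      have : b * b = 4 * (k * k) := by rw [hk]; ring
      omega
    · right
      have : b * b = 4 * (k * k + k) + 1 := by rw [hk]; ring
      omega
  obtain ⟨a', rfl⟩ := ha
  obtain ⟨c', rfl⟩ := hc
  have h6 : d + b * b = 4 * (a' * c') := by rw [hdef]; ring
  have h5 : d = 1 ∨ d = 3 ∨ d = 9 := by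
    interval_cases d <;> omega
  rcases h5 with h5 | h5 | h5
  · omega
  · exact h5
  -- With determinant 9 the form would be 3 times an even form of determinant 1, which is impossible
  -- modulo 4.
  · exfalso
    have e1 : p * d = 3 * (c' + c') := by rw [hdef]; linear_combination (c' + c') * h1 - b * h2
    have e2 : q * d = -3 * b := by rw [hdef]; linear_combination (a' + a') * h2 - b * h1
    have e3 : s * d = 3 * (a' + a') := by rw [hdef]; linear_combination (a' + a') * h4 - b * h3
    rw [h5] at e1 e2 e3
    have hp : p % 2 = 0 := by omega
    have hs : s % 2 = 0 := by omega
    obtain ⟨p', rfl⟩ : ∃ p', p = 2 * p' := ⟨p / 2, by omega⟩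
    obtain ⟨s', rfl⟩ : ∃ s', s = 2 * s' := ⟨s / 2, by omega⟩
    have hc' : c' = 3 * p' := by omega
    have ha' : a' = 3 * s' := by omega
    have hb' : b = -3 * q := by omega
    have e4 : 9 * 4 * (p' * s') - 9 * (q * q) = 9 := by
      rw [hb', ha', hc'] at hdef
      linarith
    rcases Int.even_or_odd' q with ⟨k, hk | hk⟩
    · have : q * q = 4 * (k * k) := by rw [hk]; ring
      omega
    · have : q * q = 4 * (k * k + k) + 1 := by rw [hk]; ring
      omega

/-- A reduced basis for an even binary form of determinant `3`. -/
theorem exists_reduced_basis {n : ℕ} {C : Matrix (Fin n) (Fin n) ℤ} (hC : Cᵀ = C)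
    (P : (Fin n → ℤ) → Prop) (x y : Fin n → ℤ) (ha : Even (gramForm C x x))
    (hc : Even (gramForm C y y)) (ha0 : 0 < gramForm C x x) (hc0 : 0 < gramForm C y y)
    (hd : gramForm C x x * gramForm C y y - gramForm C x y * gramForm C x y = 3)
    (hP : ∀ c, P c ↔ ∃ k l : ℤ, c = k • x + l • y) :
    ∃ x y : Fin n → ℤ, gramForm C x x = 2 ∧ gramForm C y y = 2 ∧ gramForm C x y = 1 ∧
      ∀ c, P c ↔ ∃ k l : ℤ, c = k • x + l • y := by
  induction h : (gramForm C x x + gramForm C y y).toNat using Nat.strong_induction_on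
    generalizing x y with
  | _ m ih =>
  set a := gramForm C x x with hadef
  set b := gramForm C x y with hbdef
  set c := gramForm C y y with hcdef
  have hyx : gramForm C y x = b := gramForm_comm hC y x
  by_cases hle : 2 * |b| ≤ a ∧ 2 * |b| ≤ c
  -- In the reduced case `4b² ≤ ac = b² + 3` gives `|b| ≤ 1`. Here `b = 0` would give `ac = 3`,
  -- although `a` and `c` are even.
  · have hbb : |b| * |b| = b * b := abs_mul_abs_self b
    have hb0 := abs_nonneg b
    have h1 : 4 * (|b| * |b|) ≤ a * c := by nlinarith
    have h2 : |b| ≤ 1 := by nlinarith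
    have h3 : |b| = 1 := by
      by_contra hne
      have h0 : |b| = 0 := by omega
      rw [h0] at hbb
      obtain ⟨a', ha'⟩ := ha
      obtain ⟨c', hc'⟩ := hc
      have : a * c = 4 * (a' * c') := by rw [ha', hc']; ring
      omega
    have h4 : a * c = 4 := by rw [h3] at hbb; linarith
    have ha2 : 2 ≤ a := by omega
    have hc2 : 2 ≤ c := by omega
    have ha3 : a = 2 := by nlinarith
    have hc3 : c = 2 := by nlinarith
    rcases (abs_eq (by norm_num)).mp h3 with hb | hb
    · exact ⟨x, y, ha3, hc3, hb, hP⟩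
    · refine ⟨x, -y, ha3, ?_, ?_, fun z => (hP z).trans ⟨?_, ?_⟩⟩
      · rw [gramForm_neg_left, gramForm_neg_right, neg_neg, ← hcdef, hc3]
      · rw [gramForm_neg_right, ← hbdef, hb, neg_neg]
      · rintro ⟨k, l, rfl⟩
        exact ⟨k, -l, by module⟩
      · rintro ⟨k, l, rfl⟩
        exact ⟨k, -l, by module⟩
  · obtain ⟨ε, hε, hεb⟩ : ∃ ε : ℤ, ε * ε = 1 ∧ ε * b = |b| := by
      rcases abs_cases b with ⟨hb, -⟩ | ⟨hb, -⟩
      · exact ⟨1, by norm_num, by rw [hb, one_mul]⟩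
      · exact ⟨-1, by norm_num, by rw [hb]; ring⟩
    have hpos : ∀ p q : ℤ, 0 < p → p * q - b * b = 3 → 0 < q := fun p q hp hpq => by
      by_contra hq
      have := mul_self_nonneg b
      nlinarith
    -- Gauss reduction: adding or subtracting one basis vector lowers the norm of the other by the
    -- positive amount `2|b| - a` or `2|b| - c`.
    by_cases hlt : a < 2 * |b|
    · have e1 : gramForm C (y - ε • x) (y - ε • x) = c - 2 * |b| + a := by
        simp only [gramForm_sub_left, gramForm_sub_right, gramForm_smul_left, gramForm_smul_right,
          ← hadef, ← hbdef, ← hcdef, hyx]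
        linear_combination (-2) * hεb + a * hε
      have e2 : gramForm C x (y - ε • x) = b - ε * a := by
        rw [gramForm_sub_right, gramForm_smul_right]
      have e3 : a * (c - 2 * |b| + a) - (b - ε * a) * (b - ε * a) = 3 := by
        rw [← hd, ← hεb]
        linear_combination (-(a * a)) * hε
      have e4 : 0 < c - 2 * |b| + a := by
        by_contra hq
        have := mul_self_nonneg (b - ε * a)
        nlinarith
      refine ih _ ?_ x (y - ε • x) ha ?_ ha0 ?_ ?_ (fun z => (hP z).trans ⟨?_, ?_⟩) rfl
      · rw [e1]
        omega
      · rw [e1]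
        exact (hc.sub (even_two_mul _)).add ha
      · rw [e1]
        exact e4
      · rw [e1, e2]
        exact e3
      · rintro ⟨k, l, rfl⟩
        exact ⟨k + l * ε, l, by module⟩
      · rintro ⟨k, l, rfl⟩
        exact ⟨k - l * ε, l, by module⟩
    · have hlt' : c < 2 * |b| := by omega
      have e1 : gramForm C (x - ε • y) (x - ε • y) = a - 2 * |b| + c := by
        simp only [gramForm_sub_left, gramForm_sub_right, gramForm_smul_left, gramForm_smul_right,
          ← hadef, ← hbdef, ← hcdef, hyx]
        linear_combination (-2) * hεb + c * hε
      have e2 : gramForm C (x - ε • y) y = b - ε * c := by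
        rw [gramForm_sub_left, gramForm_smul_left]
      have e3 : (a - 2 * |b| + c) * c - (b - ε * c) * (b - ε * c) = 3 := by
        rw [← hd, ← hεb]
        linear_combination (-(c * c)) * hε
      have e4 : 0 < a - 2 * |b| + c := by
        by_contra hq
        have := mul_self_nonneg (b - ε * c)
        nlinarith
      refine ih _ ?_ (x - ε • y) y ?_ hc ?_ hc0 ?_ (fun z => (hP z).trans ⟨?_, ?_⟩) rfl
      · rw [e1]
        omega
      · rw [e1]
        exact (ha.sub (even_two_mul _)).add hc
      · rw [e1]
        exact e4
      · rw [e1, e2]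
        exact e3
      · rintro ⟨k, l, rfl⟩
        exact ⟨k, l + k * ε, by module⟩
      · rintro ⟨k, l, rfl⟩
        exact ⟨k, l - k * ε, by module⟩

end Binary

/-! ### Lattices and involutions in Euclidean space -/

section Geometry

variable {V : Type*} [NormedAddCommGroup V] [InnerProductSpace ℝ V]

theorem inner_zsmul_left (k : ℤ) (x y : V) : inner ℝ (k • x) y = (k : ℝ) * inner ℝ x y := by
  rw [← Int.cast_smul_eq_zsmul ℝ, real_inner_smul_left]

theorem inner_zsmul_right (k : ℤ) (x y : V) : inner ℝ x (k • y) = (k : ℝ) * inner ℝ x y := by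
  rw [← Int.cast_smul_eq_zsmul ℝ, real_inner_smul_right]

theorem two_mul_gramForm_eq_sum {X : Type*} [AddCommGroup X] {n : ℕ}
    {C : Matrix (Fin n) (Fin n) ℤ} (b : Fin n → X) (v : X → V) (hv : ∀ c : Fin n → ℤ,
      v (∑ i, c i • b i) = ∑ i, c i • v (b i))
    (hb : ∀ i j, inner ℝ (v (b i)) (v (b j)) = 2 * (C i j : ℝ)) (c d : Fin n → ℤ) :
    inner ℝ (v (∑ i, c i • b i)) (v (∑ i, d i • b i)) = 2 * (gramForm C c d : ℝ) := by
  rw [hv, hv, sum_inner]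
  simp only [inner_sum, inner_zsmul_left, inner_zsmul_right, hb, gramForm, dotProduct, mulVec]
  push_cast
  simp only [Finset.mul_sum]
  refine Finset.sum_congr rfl fun i _ => Finset.sum_congr rfl fun j _ => ?_
  ring

/-- An `EE₈`-lattice, as an isometric image of `ℤ⁸`. -/
theorem IsEE8.exists_equiv {M : Submodule ℤ V} (hM : IsEE8 M) :
    ∃ e : (Fin 8 → ℤ) ≃ₗ[ℤ] M,
      ∀ c d, inner ℝ (e c : V) (e d : V) = 2 * (gramForm E₈ c d : ℝ) := by
  obtain ⟨b, hb⟩ := hM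
  refine ⟨b.equivFun.symm, fun c d => ?_⟩
  rw [b.equivFun_symm_apply, b.equivFun_symm_apply]
  exact two_mul_gramForm_eq_sum (b ·) (fun x : M => (x : V)) (fun c => by simp) hb c d

theorem IsEE8.finrank_eq {M : Submodule ℤ V} (hM : IsEE8 M) : Module.finrank ℤ M = 8 := by
  obtain ⟨b, -⟩ := hM
  rw [Module.finrank_eq_card_basis b, Fintype.card_fin]

theorem IsRootlessIntegral.discreteTopology {L : Submodule ℤ V} (hL : IsRootlessIntegral L) :
    DiscreteTopology L := by
  rw [discreteTopology_iff_isOpen_singleton_zero, Metric.isOpen_singleton_iff]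
  refine ⟨1, one_pos, fun y hy => ?_⟩
  by_contra h
  have h1 := hL.rootless y.1 y.2 (fun h0 => h (Subtype.ext h0))
  rw [real_inner_self_eq_norm_sq] at h1
  rw [dist_zero_right] at hy
  have h2 : ‖(y : V)‖ < 1 := hy
  have h3 := norm_nonneg (y : V)
  nlinarith

theorem IsRootlessIntegral.mono {L L' : Submodule ℤ V} (hL : IsRootlessIntegral L)
    (h : L' ≤ L) : IsRootlessIntegral L' :=
  ⟨fun x hx y hy => hL.integral x (h hx) y (h hy), fun x hx => hL.rootless x (h hx)⟩

variable [FiniteDimensional ℝ V]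

theorem IsRootlessIntegral.finrank_span {L : Submodule ℤ V} (hL : IsRootlessIntegral L) :
    Module.finrank ℝ (Submodule.span ℝ (L : Set V)) = Module.finrank ℤ L := by
  have h := Real.finrank_eq_int_finrank_of_discrete (s := (L : Set V)) (by
    rw [Submodule.span_eq]
    exact hL.discreteTopology)
  rw [Set.finrank, Set.finrank, Submodule.span_eq] at h
  exact h

theorem tInv_eq_neg_iff {M : Submodule ℤ V} {x : V} :
    tInv M x = -x ↔ x ∈ Submodule.span ℝ (M : Set V) := by
  rw [tInv, Submodule.reflection_orthogonal_apply, neg_inj, Submodule.reflection_eq_self_iff]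

theorem tInv_of_mem {M : Submodule ℤ V} {x : V} (hx : x ∈ M) : tInv M x = -x :=
  tInv_eq_neg_iff.mpr (Submodule.subset_span hx)

theorem tInv_tInv (M : Submodule ℤ V) (x : V) : tInv M (tInv M x) = x :=
  Submodule.reflection_reflection _ x

theorem inner_tInv (M : Submodule ℤ V) (x y : V) :
    inner ℝ (tInv M x) y = inner ℝ x (tInv M y) := by
  rw [← LinearIsometryEquiv.inner_map_map (tInv M) x (tInv M y), tInv_tInv]

theorem tInv_of_orthogonal {M : Submodule ℤ V} {x : V} (hx : ∀ y ∈ M, inner ℝ y x = 0) :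
    tInv M x = x := by
  rw [tInv, Submodule.reflection_eq_self_iff, Submodule.mem_orthogonal]
  intro u hu
  induction hu using Submodule.span_induction with
  | mem y hy => exact hx y hy
  | zero => exact inner_zero_left x
  | add y z _ _ hy hz => rw [inner_add_left, hy, hz, add_zero]
  | smul a y _ hy => rw [real_inner_smul_left, hy, mul_zero]

/-- An `EE₈`-sublattice of an integral lattice is semi-selfdual. -/
theorem IsRootlessIntegral.sub_tInv_mem {L M : Submodule ℤ V} (hL : IsRootlessIntegral L)
    (hML : M ≤ L) (hM : IsEE8 M) {x : V} (hx : x ∈ L) : x - tInv M x ∈ M := by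
  obtain ⟨e, he⟩ := hM.exists_equiv
  choose k hk using fun i => hL.integral x hx (e (Pi.single i 1)) (hML (e _).2)
  -- Unimodularity of `E₈` represents the products of `x` with `M` by a vector of `M`: half of `n`
  -- is the orthogonal projection of `x`, so `x - t_M x = n`.
  set n := e (E₈Inv *ᵥ k) with hn
  have hker : ∀ y ∈ M, inner ℝ y (x - (2⁻¹ : ℝ) • (n : V)) = 0 := by
    have hb : ∀ i, inner ℝ (e (Pi.single i 1) : V) (x - (2⁻¹ : ℝ) • (n : V)) = 0 := by
      intro i
      rw [inner_sub_right, real_inner_smul_right, hn, he, gramForm_single_left, mulVec_mulVec,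
        E₈_mul_E₈Inv, one_mulVec, real_inner_comm, hk]
      ring
    intro y hy
    have hy' : y = ∑ i, (e.symm ⟨y, hy⟩) i • (e (Pi.single i 1) : V) := by
      have h1 : (⟨y, hy⟩ : M) = ∑ i, (e.symm ⟨y, hy⟩) i • e (Pi.single i 1) := by
        rw [← e.symm.injective.eq_iff, map_sum]
        simp only [map_smul, e.symm_apply_apply]
        exact pi_eq_sum_univ' _
      have h2 := congrArg (fun z : M => (z : V)) h1
      simpa using h2
    rw [hy', sum_inner]
    exact Finset.sum_eq_zero fun i _ => by rw [inner_zsmul_left, hb, mul_zero]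
  have h1 : tInv M x = x - n := by
    have h2 : x = (x - (2⁻¹ : ℝ) • (n : V)) + (2⁻¹ : ℝ) • (n : V) := by abel
    conv_lhs => rw [h2, map_add, map_smul, tInv_of_orthogonal hker, tInv_of_mem n.2]
    module
  rw [h1, sub_sub_cancel]
  exact n.2

theorem braid_of_dihedral {G : Type*} [Group G] {s t : G}
    (h : Nonempty ((Subgroup.closure {s, t} : Subgroup G) ≃* DihedralGroup 3)) (hs : s ≠ 1)
    (ht : t ≠ 1) (hss : s * s = 1) (htt : t * t = 1) : s * t * s = t * s * t := by
  obtain ⟨e⟩ := h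
  have key : ∀ a b : DihedralGroup 3, a ≠ 1 → b ≠ 1 → a * a = 1 → b * b = 1 →
      a * b * a = b * a * b := by decide
  let s' : Subgroup.closure {s, t} := ⟨s, Subgroup.subset_closure (by simp)⟩
  let t' : Subgroup.closure {s, t} := ⟨t, Subgroup.subset_closure (by simp)⟩
  have h1 := key (e s') (e t')
    (fun h => hs (congrArg Subtype.val ((EmbeddingLike.map_eq_one_iff (f := e)).mp h)))
    (fun h => ht (congrArg Subtype.val ((EmbeddingLike.map_eq_one_iff (f := e)).mp h)))
    (by rw [← map_mul, EmbeddingLike.map_eq_one_iff]; exact Subtype.ext hss)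
    (by rw [← map_mul, EmbeddingLike.map_eq_one_iff]; exact Subtype.ext htt)
  rw [← map_mul, ← map_mul, ← map_mul, ← map_mul, e.injective.eq_iff] at h1
  exact congrArg Subtype.val h1

/-- A pair of `EE₈`-lattices in a rootless integral lattice whose involutions generate a dihedral
group of order `6` and whose sum has rank `14`. -/
structure IsBraidPair (L M N : Submodule ℤ V) : Prop where
  rootless : IsRootlessIntegral L
  left_le : M ≤ L
  right_le : N ≤ L
  left : IsEE8 M
  right : IsEE8 N
  braid : ∀ x, tInv M (tInv N (tInv M x)) = tInv N (tInv M (tInv N x))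
  finrank_inf : Module.finrank ℝ
    ↥(Submodule.span ℝ (M : Set V) ⊓ Submodule.span ℝ (N : Set V)) = 2

theorem IsBraidPair.symm {L M N : Submodule ℤ V} (h : IsBraidPair L M N) : IsBraidPair L N M :=
  ⟨h.rootless, h.right_le, h.left_le, h.right, h.left, fun x => (h.braid x).symm, by
    rw [inf_comm]
    exact h.finrank_inf⟩

theorem IsEE8.tInv_ne_one {M : Submodule ℤ V} (hM : IsEE8 M) : tInv M ≠ 1 := by
  obtain ⟨e, he⟩ := hM.exists_equiv
  intro h
  have h1 := tInv_of_mem (e (Pi.single 0 1)).2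
  rw [h] at h1
  have h2 : (e (Pi.single 0 1) : V) = -(e (Pi.single 0 1) : V) := h1
  have h3 := he (Pi.single 0 1) (Pi.single 0 1)
  have h4 := h3
  rw [h2, inner_neg_left, ← h2, h3, E₈_diag] at h4
  norm_num at h4

theorem IsDih6Pair14.isBraidPair {L M N : Submodule ℤ V} (h : IsDih6Pair14 M N)
    (hL : IsRootlessIntegral L) (hM : M ≤ L) (hN : N ≤ L) : IsBraidPair L M N := by
  refine ⟨hL, hM, hN, h.left, h.right, fun x => ?_, ?_⟩
  · have h1 := braid_of_dihedral h.dihedral h.left.tInv_ne_one h.right.tInv_ne_one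
      (by ext x; exact tInv_tInv M x) (by ext x; exact tInv_tInv N x)
    exact congrArg (fun f : V ≃ₗᵢ[ℝ] V => f x) h1
  · have h1 := Submodule.finrank_sup_add_finrank_inf_eq (Submodule.span ℝ (M : Set V))
      (Submodule.span ℝ (N : Set V))
    have h2 : Submodule.span ℝ (M : Set V) ⊔ Submodule.span ℝ (N : Set V) =
        Submodule.span ℝ ((M ⊔ N : Submodule ℤ V) : Set V) := by
      apply le_antisymm
      · exact sup_le (Submodule.span_mono (le_sup_left (a := M)))
          (Submodule.span_mono (le_sup_right (a := M)))
      · rw [Submodule.span_le]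
        intro x hx
        obtain ⟨y, hy, z, hz, rfl⟩ := Submodule.mem_sup.mp hx
        exact add_mem (Submodule.mem_sup_left (Submodule.subset_span hy))
          (Submodule.mem_sup_right (Submodule.subset_span hz))
    rw [h2, (hL.mono (sup_le hM hN)).finrank_span, (hL.mono hM).finrank_span,
      (hL.mono hN).finrank_span, h.rank, h.left.finrank_eq, h.right.finrank_eq] at h1
    omega

/-- The vectors of `M` that are fixed by `t_M t_N`. -/
def fixedPart (M N : Submodule ℤ V) : Submodule ℤ V where
  carrier := {x | x ∈ M ∧ tInv N x = -x}
  zero_mem' := ⟨M.zero_mem, by simp⟩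
  add_mem' := fun ⟨h1, h2⟩ ⟨g1, g2⟩ => ⟨M.add_mem h1 g1, by rw [map_add, h2, g2, neg_add]⟩
  smul_mem' := fun k _ ⟨h1, h2⟩ => ⟨M.smul_mem k h1, by rw [map_zsmul, h2, smul_neg]⟩

/-- The sum `1 + g + g²`, for `g = t_M t_N`, on `M`. -/
noncomputable def traceMap (M N : Submodule ℤ V) : V →ₗ[ℝ] V :=
  LinearMap.id + (tInv M).toLinearEquiv.toLinearMap ∘ₗ (tInv N).toLinearEquiv.toLinearMap -
    (tInv N).toLinearEquiv.toLinearMap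

theorem traceMap_apply (M N : Submodule ℤ V) (x : V) :
    traceMap M N x = x + tInv M (tInv N x) - tInv N x :=
  rfl

namespace IsBraidPair

variable {L M N : Submodule ℤ V} (h : IsBraidPair L M N)

include h

/-- Applying `1 - t_N` and then `1 - t_M` stays in `N` and then in `M`, and gives the trace plus
`m`. The braid relation makes `t_N` act as `-1` on the trace. -/
theorem traceMap_mem {m : V} (hm : m ∈ M) : traceMap M N m ∈ fixedPart M N := by
  have h1 := h.rootless.sub_tInv_mem h.right_le h.right (h.left_le hm)
  have h2 := h.rootless.sub_tInv_mem h.left_le h.left (h.right_le h1)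
  constructor
  · have h3 : traceMap M N m = (m - tInv N m) - tInv M (m - tInv N m) - m := by
      rw [traceMap_apply, map_sub, tInv_of_mem hm]
      abel
    rw [h3]
    exact sub_mem h2 hm
  · have h3 := h.braid m
    rw [tInv_of_mem hm, map_neg, map_neg] at h3
    rw [traceMap_apply, map_sub, map_add, tInv_tInv, ← h3]
    abel

omit h in
theorem inner_traceMap {x m : V} (hx : x ∈ fixedPart M N) :
    inner ℝ x (traceMap M N m) = 3 * inner ℝ x m := by
  rw [traceMap_apply, inner_sub_right, inner_add_right, ← inner_tInv, ← inner_tInv,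
    ← inner_tInv, tInv_of_mem hx.1, map_neg, hx.2, neg_neg, inner_neg_left]
  ring

/-- On the intersection of the real spans the trace is multiplication by 3, while it sends the span
of `M` into that of the fixed part. So the fixed part spans the whole intersection. -/
theorem finrank_fixedPart : Module.finrank ℤ (fixedPart M N) = 2 := by
  rw [← (h.rootless.mono (fun _ hx => h.left_le hx.1 : fixedPart M N ≤ L)).finrank_span,
    ← h.finrank_inf]
  have key : Submodule.span ℝ (fixedPart M N : Set V) =
      Submodule.span ℝ (M : Set V) ⊓ Submodule.span ℝ (N : Set V) := by
    apply le_antisymm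
    · rw [Submodule.span_le]
      exact fun x hx => ⟨Submodule.subset_span hx.1, tInv_eq_neg_iff.mp hx.2⟩
    · rintro u ⟨hu1, hu2⟩
      have h1 : ∀ y ∈ Submodule.span ℝ (M : Set V),
          traceMap M N y ∈ Submodule.span ℝ (fixedPart M N : Set V) := by
        intro y hy
        induction hy using Submodule.span_induction with
        | mem y hy => exact Submodule.subset_span (h.traceMap_mem hy)
        | zero => rw [map_zero]; exact zero_mem _
        | add y z _ _ hy hz => rw [map_add]; exact add_mem hy hz
        | smul a y _ hy => rw [map_smul]; exact Submodule.smul_mem _ a hy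
      have h2 := h1 u hu1
      rw [traceMap_apply, tInv_eq_neg_iff.mpr hu2, map_neg, tInv_eq_neg_iff.mpr hu1] at h2
      have h3 : u = (3⁻¹ : ℝ) • (u + - -u - -u) := by module
      rw [h3]
      exact Submodule.smul_mem _ _ h2
  rw [key]

/-- The fixed part, in coordinates, is spanned by two vectors that are dual to two vectors
of `M`. -/
theorem exists_dual_basis (e : (Fin 8 → ℤ) ≃ₗ[ℤ] M) :
    ∃ x y d d' : Fin 8 → ℤ, (e x : V) ∈ fixedPart M N ∧ (e y : V) ∈ fixedPart M N ∧
      (∀ c, (e c : V) ∈ fixedPart M N → ∃ k l : ℤ, c = k • x + l • y) ∧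
      gramForm E₈ x d = 1 ∧ gramForm E₈ y d = 0 ∧ gramForm E₈ x d' = 0 ∧ gramForm E₈ y d' = 1 := by
  let X : Submodule ℤ (Fin 8 → ℤ) := (fixedPart M N).comap (M.subtype ∘ₗ e.toLinearMap)
  have hX : ∀ c, c ∈ X ↔ (e c : V) ∈ fixedPart M N := fun c => Iff.rfl
  obtain ⟨n, snf⟩ := X.smithNormalForm (Pi.basisFun ℤ (Fin 8))
  have hrank : Module.finrank ℤ X = 2 := by
    rw [← h.finrank_fixedPart]
    refine LinearEquiv.finrank_eq (LinearEquiv.ofBijective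
      ((M.subtype ∘ₗ e.toLinearMap).restrict fun c hc => hc) ⟨?_, ?_⟩)
    · intro c d hcd
      have h1 : (e c.1 : V) = e d.1 := congrArg (fun z : fixedPart M N => (z : V)) hcd
      exact Subtype.ext (e.injective (Subtype.ext h1))
    · rintro ⟨v, hv⟩
      refine ⟨⟨e.symm ⟨v, hv.1⟩, ?_⟩, ?_⟩
      · rw [hX, e.apply_symm_apply]
        exact hv
      · apply Subtype.ext
        exact congrArg (fun z : M => (z : V)) (e.apply_symm_apply ⟨v, hv.1⟩)
  obtain rfl : n = 2 := by
    rw [← hrank, Module.finrank_eq_card_basis snf.bN, Fintype.card_fin]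
  have ha : ∀ i, snf.a i ≠ 0 := fun i h0 => by
    have h1 := snf.snf i
    rw [h0, zero_smul] at h1
    exact snf.bN.ne_zero i (Subtype.ext h1)
  -- The fixed part is primitive in `M`, being cut out by a linear equation, so the elementary
  -- divisors can be cancelled.
  have hmem : ∀ i, snf.bM (snf.f i) ∈ X := fun i => by
    have h1 := (snf.bN i).2
    rw [snf.snf, hX, map_smul] at h1
    rw [hX]
    refine ⟨(e _).2, ?_⟩
    have h2 := h1.2
    rw [Submodule.coe_smul, map_zsmul, ← smul_neg, ← Int.cast_smul_eq_zsmul ℝ,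
      ← Int.cast_smul_eq_zsmul ℝ] at h2
    exact smul_right_injective V (Int.cast_ne_zero.mpr (ha i)) h2
  have hdual : ∀ j, ∃ d : Fin 8 → ℤ, ∀ c, gramForm E₈ c d = snf.bM.repr c j := by
    intro j
    let f : (Fin 8 → ℤ) →ₗ[ℤ] ℤ := Finsupp.lapply j ∘ₗ snf.bM.repr.toLinearMap
    refine ⟨E₈Inv *ᵥ fun i => f fun j => if i = j then 1 else 0, fun c => ?_⟩
    rw [gramForm, mulVec_mulVec, E₈_mul_E₈Inv, one_mulVec]
    exact (LinearMap.pi_apply_eq_sum_univ f c).symm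
  obtain ⟨d, hd⟩ := hdual (snf.f 0)
  obtain ⟨d', hd'⟩ := hdual (snf.f 1)
  have h01 : snf.f 0 ≠ snf.f 1 := fun h0 => by simpa using snf.f.injective h0
  refine ⟨snf.bM (snf.f 0), snf.bM (snf.f 1), d, d', hmem 0, hmem 1, fun c hc => ?_, ?_, ?_, ?_, ?_⟩
  · refine ⟨snf.bN.repr ⟨c, hc⟩ 0 * snf.a 0, snf.bN.repr ⟨c, hc⟩ 1 * snf.a 1, ?_⟩
    have h1 := congrArg Subtype.val (snf.bN.sum_repr ⟨c, hc⟩)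
    rw [Fin.sum_univ_two] at h1
    simp only [Submodule.coe_add, Submodule.coe_smul, snf.snf, smul_smul] at h1
    exact h1.symm
  · rw [hd]; simp
  · rw [hd]; simp [h01]
  · rw [hd']; simp [h01.symm]
  · rw [hd']; simp

end IsBraidPair

end Geometry

/-! ### Coordinates on `M` adapted to the fixed part. -/

section Geometry

variable {V : Type*} [NormedAddCommGroup V] [InnerProductSpace ℝ V] [FiniteDimensional ℝ V]

namespace IsBraidPair

variable {L M N : Submodule ℤ V} (h : IsBraidPair L M N)

include h

/-- There are coordinates on `M` in which the fixed part is spanned by the highest root and the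
last simple root. -/
theorem exists_adapted_equiv : ∃ e : (Fin 8 → ℤ) ≃ₗ[ℤ] M,
    (∀ c d, inner ℝ (e c : V) (e d : V) = 2 * (gramForm E₈ c d : ℝ)) ∧
    ∀ c, (e c : V) ∈ fixedPart M N ↔ ∃ k l : ℤ, c = k • E₈Highest + l • Pi.single 7 1 := by
  obtain ⟨e, he⟩ := h.left.exists_equiv
  obtain ⟨x, y, d, d', hx, hy, hspan, h1, h2, h3, h4⟩ := h.exists_dual_basis e
  have hdef : ∀ z, gramForm E₈ z z = 0 → z = 0 := fun z hz => by
    have h5 := he z z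
    rw [hz, Int.cast_zero, mul_zero, inner_self_eq_zero] at h5
    exact e.map_eq_zero_iff.mp (Subtype.ext h5)
  -- The trace of `d` represents 3 times the functional of `d` on the fixed part. For `d` in the
  -- dual pair this puts 3 times the dual lattice inside the fixed part.
  have htr : ∀ d, ∃ k l : ℤ, ∀ z, (e z : V) ∈ fixedPart M N →
      gramForm E₈ z (k • x + l • y) = 3 * gramForm E₈ z d := by
    intro d
    have hd := h.traceMap_mem (e d).2
    have h5 : (e (e.symm ⟨_, hd.1⟩) : V) = traceMap M N (e d) := by rw [e.apply_symm_apply]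
    obtain ⟨k, l, hkl⟩ := hspan (e.symm ⟨_, hd.1⟩) (by rw [h5]; exact hd)
    refine ⟨k, l, fun z hz => ?_⟩
    have h6 := inner_traceMap (m := (e d : V)) hz
    rw [← h5, hkl, he, he] at h6
    have h7 : (gramForm E₈ z (k • x + l • y) : ℝ) = 3 * gramForm E₈ z d := by linarith
    exact_mod_cast h7
  obtain ⟨p, q, hpq⟩ := htr d
  obtain ⟨r, s, hrs⟩ := htr d'
  have e1 := hpq x hx
  have e2 := hpq y hy
  have e3 := hrs x hx
  have e4 := hrs y hy
  have hyx : gramForm E₈ y x = gramForm E₈ x y := gramForm_comm E₈_transpose y x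
  simp only [gramForm_add_right, gramForm_smul_right, hyx, h1, h2, h3, h4, mul_one, mul_zero]
    at e1 e2 e3 e4
  have ha : 0 < gramForm E₈ x x := by
    refine lt_of_le_of_ne (gramForm_E₈_nonneg x) fun h0 => ?_
    rw [hdef x h0.symm, gramForm_zero_left] at h1
    omega
  have hc : 0 < gramForm E₈ y y := by
    refine lt_of_le_of_ne (gramForm_E₈_nonneg y) fun h0 => ?_
    rw [hdef y h0.symm, gramForm_zero_left] at h4
    omega
  have hdisc : 0 < gramForm E₈ x x * gramForm E₈ y y - gramForm E₈ x y * gramForm E₈ x y := by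
    set z := gramForm E₈ x x • y - gramForm E₈ x y • x with hz
    have h5 : gramForm E₈ z z = gramForm E₈ x x *
        (gramForm E₈ x x * gramForm E₈ y y - gramForm E₈ x y * gramForm E₈ x y) := by
      simp only [hz, gramForm_sub_left, gramForm_sub_right, gramForm_smul_left,
        gramForm_smul_right, hyx]
      ring
    have h6 : 0 < gramForm E₈ z z := by
      refine lt_of_le_of_ne (gramForm_E₈_nonneg z) fun h0 => ?_
      have h7 : gramForm E₈ z d' = gramForm E₈ x x := by
        simp only [hz, gramForm_sub_left, gramForm_smul_left, h3, h4]
        ring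
      rw [hdef z h0.symm, gramForm_zero_left] at h7
      omega
    rw [h5] at h6
    exact pos_of_mul_pos_right h6 ha.le
  have hdet := det_eq_three_of_mul_eq (even_gramForm_E₈ x) (even_gramForm_E₈ y) hdisc e1 e2 e3 e4
  obtain ⟨x', y', hx', hy', hxy', hspan'⟩ := exists_reduced_basis E₈_transpose
    (fun c => (e c : V) ∈ fixedPart M N) x y (even_gramForm_E₈ x) (even_gramForm_E₈ y) ha hc hdet
    (fun c => ⟨hspan c, by
      rintro ⟨k, l, rfl⟩
      rw [map_add, map_smul, map_smul]
      exact add_mem (Submodule.smul_mem _ k hx) (Submodule.smul_mem _ l hy)⟩)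
  obtain ⟨f, hf1, hf2⟩ := exists_gramO_E₈_map_eq hx' hy' hxy'
  refine ⟨f.1.trans e, fun c d => ?_, fun c => ?_⟩
  · rw [LinearEquiv.trans_apply, LinearEquiv.trans_apply, he, gramForm_gramO]
  · rw [LinearEquiv.trans_apply, hspan', ← hf1, ← hf2]
    simp only [← map_smul, ← map_add, f.1.injective.eq_iff]
    constructor
    · rintro ⟨k, l, rfl⟩
      exact ⟨k + l, -l, by module⟩
    · rintro ⟨k, l, rfl⟩
      exact ⟨k + l, -l, by module⟩

/-- For `x` in the fixed part of `M`, twice `x` lies in that of `N`, a copy of `√2A₂`. If it is not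
twice a vector there, subtracting one leaves a vector of `L` that is half of a minimal vector, hence
of norm 1, which is excluded. -/
theorem fixedPart_le : fixedPart M N ≤ N := by
  intro x hx
  obtain ⟨e, he, hF⟩ := h.symm.exists_adapted_equiv
  have h1 : x + x ∈ fixedPart N M := by
    refine ⟨?_, ?_⟩
    · have h2 := h.rootless.sub_tInv_mem h.right_le h.right (h.left_le hx.1)
      rwa [hx.2, sub_neg_eq_add] at h2
    · rw [map_add, tInv_of_mem hx.1, neg_add]
  have h3 : (e (e.symm ⟨_, h1.1⟩) : V) = x + x := by rw [e.apply_symm_apply]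
  obtain ⟨k, l, hkl⟩ := (hF (e.symm ⟨_, h1.1⟩)).mp (by rw [h3]; exact h1)
  rw [hkl] at h3
  have hred : ∀ k' l' ε δ : ℤ, k = 2 * k' + ε → l = 2 * l' + δ →
      x - (e (k' • E₈Highest + l' • Pi.single 7 1) : V) ∈ L ∧
      (x - (e (k' • E₈Highest + l' • Pi.single 7 1) : V)) +
        (x - (e (k' • E₈Highest + l' • Pi.single 7 1) : V)) =
        (e (ε • E₈Highest + δ • Pi.single 7 1) : V) := by
    intro k' l' ε δ hk hl
    refine ⟨sub_mem (h.left_le hx.1) (h.right_le (e _).2), ?_⟩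
    have h4 : x + x = (e (k' • E₈Highest + l' • Pi.single 7 1) : V) +
        (e (k' • E₈Highest + l' • Pi.single 7 1) : V) +
        (e (ε • E₈Highest + δ • Pi.single 7 1) : V) := by
      rw [← h3, ← Submodule.coe_add, ← Submodule.coe_add, ← map_add, ← map_add]
      congr 2
      rw [hk, hl]
      module
    rw [sub_add_sub_comm, h4]
    abel
  have hnorm : ∀ ε δ : ℤ, inner ℝ (e (ε • E₈Highest + δ • Pi.single 7 1) : V)
      (e (ε • E₈Highest + δ • Pi.single 7 1) : V) = 4 * ((ε * ε + ε * δ + δ * δ : ℤ) : ℝ) := by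
    intro ε δ
    have h5 : gramForm E₈ (ε • E₈Highest + δ • Pi.single 7 1)
        (ε • E₈Highest + δ • Pi.single 7 1) = 2 * (ε * ε + ε * δ + δ * δ) := by
      have h6 : gramForm E₈ (Pi.single 7 1) E₈Highest = 1 := by decide
      have h7 : gramForm E₈ (Pi.single 7 1) (Pi.single 7 1) = 2 := by decide
      simp only [gramForm_add_left, gramForm_add_right, gramForm_smul_left, gramForm_smul_right,
        gramForm_E₈Highest, h6, h7]
      simp [E₈Highest]
      ring
    rw [he, h5]
    push_cast
    ring
  have hcontra : ∀ k' l' ε δ : ℤ, k = 2 * k' + ε → l = 2 * l' + δ →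
      ε * ε + ε * δ + δ * δ = 1 → False := by
    intro k' l' ε δ hk hl hεδ
    obtain ⟨h4, h5⟩ := hred k' l' ε δ hk hl
    have h6 := hnorm ε δ
    rw [← h5, hεδ] at h6
    set y := x - (e (k' • E₈Highest + l' • Pi.single 7 1) : V)
    simp only [inner_add_left, inner_add_right] at h6
    have h7 : inner ℝ y y = (1 : ℝ) := by push_cast at h6; linarith
    have h8 := h.rootless.rootless y h4 (fun h0 => by rw [h0, inner_zero_left] at h7; norm_num at h7)
    rw [h7] at h8
    norm_num at h8
  rcases Int.even_or_odd' k with ⟨k', hk | hk⟩ <;> rcases Int.even_or_odd' l with ⟨l', hl | hl⟩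
  · obtain ⟨-, h5⟩ := hred k' l' 0 0 (by omega) (by omega)
    rw [zero_smul, zero_smul, add_zero, map_zero, Submodule.coe_zero, ← two_smul ℝ,
      smul_eq_zero_iff_right two_ne_zero, sub_eq_zero] at h5
    rw [h5]
    exact (e _).2
  · exact (hcontra k' l' 0 1 (by omega) hl (by norm_num)).elim
  · exact (hcontra k' l' 1 0 hk (by omega) (by norm_num)).elim
  -- The residue `-1` replaces 1, because the form `ε² + εδ + δ²` is 1 at `(1, -1)` but 3 at `(1,
  -- 1)`.
  · exact (hcontra k' (l' + 1) 1 (-1) hk (by omega) (by norm_num)).elim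

theorem tInv_tInv_mem {m : V} (hm : m ∈ M) : tInv M (tInv N m) ∈ N := by
  have h1 := h.fixedPart_le (h.traceMap_mem hm)
  have h2 := h.rootless.sub_tInv_mem h.right_le h.right (h.left_le hm)
  have h3 : tInv M (tInv N m) = traceMap M N m - (m - tInv N m) := by
    rw [traceMap_apply]
    abel
  rw [h3]
  exact sub_mem h1 h2

end IsBraidPair

end Geometry

/-! ### Coordinates on `M + N` -/

section Coordinates

theorem mul_E₆_apply (X : Matrix (Fin 2) (Fin 6) ℤ) (a : Fin 2) : (X * E₆) a = E₆ *ᵥ X a := by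
  rw [Matrix.mul_apply_eq_vecMul]
  conv_lhs => rw [← E₆_transpose]
  rw [vecMul_transpose]

theorem tensorForm_of (u v u' v' : Fin 6 → ℤ) :
    tensorForm (Matrix.of ![u, v]) (Matrix.of ![u', v']) =
      2 * gramForm E₆ u u' - gramForm E₆ u v' - gramForm E₆ v u' + 2 * gramForm E₆ v v' := by
  rw [tensorForm_eq_sum, Fin.sum_univ_two]
  have h : ∀ a, (A 2 * Matrix.of ![u', v'] * E₆) a = E₆ *ᵥ (A 2 a 0 • u' + A 2 a 1 • v') := by
    intro a
    rw [mul_E₆_apply]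
    congr 1
    ext i
    rw [Matrix.mul_apply, Fin.sum_univ_two]
    simp
  have h0 : ∀ (a : Fin 2) (w : Fin 6 → ℤ), ∑ i, w i * (A 2 * Matrix.of ![u', v'] * E₆) a i =
      A 2 a 0 * gramForm E₆ w u' + A 2 a 1 * gramForm E₆ w v' := fun a w => by
    rw [← gramForm_smul_right, ← gramForm_smul_right, ← gramForm_add_right, h]
    rfl
  refine (congrArg₂ (· + ·) (h0 0 u) (h0 1 v)).trans ?_
  rw [show A 2 0 0 = 2 by decide, show A 2 0 1 = -1 by decide, show A 2 1 0 = -1 by decide,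
    show A 2 1 1 = 2 by decide]
  ring

/-- The inner product of a vector of `M` with the image of a vector of `M` under `t_M t_N`. -/
def crossForm (c d : Fin 8 → ℤ) : ℤ :=
  d 6 * c 7 + (3 * d 7 - 2 * d 6) * (2 * c 7 - c 6) - gramForm E₈ c d

/-- The form of `M + N`, pulled back to `M × M` by `(x, y) ↦ x + t_M t_N y`. -/
def pairForm (x y : (Fin 8 → ℤ) × (Fin 8 → ℤ)) : ℤ :=
  2 * gramForm E₈ x.1 y.1 + 2 * gramForm E₈ x.2 y.2 + crossForm x.1 y.2 +
    crossForm y.1 x.2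

/-- Three times the projection to the span of the first six simple roots of `E₈`, along the span of
the highest root and the last simple root. -/
def sixPart : (Fin 8 → ℤ) →ₗ[ℤ] Fin 6 → ℤ where
  toFun c i := 3 * c (i.castLE (by norm_num)) - c 6 * E₆Glue i
  map_add' c d := by
    ext i
    simp only [Pi.add_apply]
    ring
  map_smul' k c := by
    ext i
    simp only [Pi.smul_apply, smul_eq_mul, RingHom.id_apply]
    ring

theorem sixPart_eq (c : Fin 8 → ℤ) : sixPart c = ![3 * c 0 - c 6 * 2, 3 * c 1 - c 6 * 3,
    3 * c 2 - c 6 * 4, 3 * c 3 - c 6 * 6, 3 * c 4 - c 6 * 5, 3 * c 5 - c 6 * 4] := by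
  ext i
  fin_cases i <;> rfl

theorem gramForm_sixPart (c d : Fin 8 → ℤ) : gramForm E₆ (sixPart c) (sixPart d) =
    9 * gramForm E₈ c d - 6 * (c 6 * d 6) + 9 * (c 6 * d 7) + 9 * (c 7 * d 6)
      - 18 * (c 7 * d 7) := by
  rw [sixPart_eq, sixPart_eq, gramForm_E₆, gramForm_E₈]
  simp
  ring

/-- The coordinates of `x + t_M t_N y` in `modelQ`. -/
def toModelFun : (Fin 8 → ℤ) × (Fin 8 → ℤ) →ₗ[ℤ] (Fin 3 → ℤ) × Matrix (Fin 2) (Fin 6) ℤ where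
  toFun x :=
    (![2 * (x.1 6 + x.2 6) - 3 * (x.1 7 + x.2 7), -(x.1 6 + x.2 6) + 3 * (x.1 7 + x.2 7),
      -(x.1 6 + x.2 6)],
    Matrix.of ![(2 : ℤ) • sixPart x.1 - sixPart x.2, sixPart x.1 + sixPart x.2])
  map_add' x y := by
    ext a b
    · fin_cases a <;> simp <;> ring
    · fin_cases a <;> simp <;> ring
  map_smul' k x := by
    ext a b
    · fin_cases a <;> simp <;> ring
    · rw [Prod.smul_fst, Prod.smul_snd, map_smul, map_smul]
      fin_cases a
      · simp
        ring
      · simp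

theorem toModelFun_apply (x : (Fin 8 → ℤ) × (Fin 8 → ℤ)) : toModelFun x =
    (![2 * (x.1 6 + x.2 6) - 3 * (x.1 7 + x.2 7), -(x.1 6 + x.2 6) + 3 * (x.1 7 + x.2 7),
      -(x.1 6 + x.2 6)],
    Matrix.of ![(2 : ℤ) • sixPart x.1 - sixPart x.2, sixPart x.1 + sixPart x.2]) :=
  rfl

/-- On the complement of the fixed part, `x` becomes `(2, 1) ⊗ sixPart x` and `g y` becomes `(-1, 1)
⊗ sixPart y`. These two vectors of `A₂` have norm 6 and product `-3`, as a rotation of order 3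
demands. The fixed components simply add. -/
theorem modelForm_toModelFun (x y : (Fin 8 → ℤ) × (Fin 8 → ℤ)) :
    modelForm (toModelFun x) (toModelFun y) = 27 * pairForm x y := by
  obtain ⟨c, d⟩ := x
  obtain ⟨c', d'⟩ := y
  rw [modelForm, toModelFun_apply, toModelFun_apply, tensorForm_of]
  simp only [gramForm_add_left, gramForm_add_right, gramForm_sub_left, gramForm_sub_right,
    gramForm_smul_left, gramForm_smul_right, gramForm_sixPart, pairForm, crossForm,
    gramForm_comm E₈_transpose c' d, dotProduct, Fin.sum_univ_three]
  simp
  ring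

theorem toModelFun_mem (x : (Fin 8 → ℤ) × (Fin 8 → ℤ)) : toModelFun x ∈ modelQ := by
  obtain ⟨c, d⟩ := x
  have h : ∀ c : Fin 8 → ℤ, ∃ z, E₆ *ᵥ sixPart c = (3 : ℤ) • z := by
    intro c
    refine ⟨E₆ *ᵥ (fun i => c (i.castLE (by norm_num))) - c 6 • Pi.single 5 1, ?_⟩
    have h1 : sixPart c = (3 : ℤ) • (fun i : Fin 6 => c (i.castLE (by norm_num))) - c 6 • E₆Glue :=
      rfl
    have h2 : E₆ *ᵥ E₆Glue = (3 : ℤ) • Pi.single 5 1 := by decide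
    rw [h1, mulVec_sub, mulVec_smul, mulVec_smul, h2, smul_sub, smul_comm (3 : ℤ)]
  obtain ⟨z, hz⟩ := h c
  obtain ⟨w, hw⟩ := h d
  rw [toModelFun_apply, mem_modelQ]
  refine ⟨⟨?_, ?_⟩, Matrix.of ![z - w, w], ?_⟩
  · simp
    ring
  · intro i
    rw [sixPart_eq, sixPart_eq]
    fin_cases i <;> simp <;> omega
  · refine funext fun a => ?_
    refine (mul_E₆_apply _ a).trans ?_
    have h3 : (A 2 * Matrix.of ![(2 : ℤ) • sixPart c - sixPart d, sixPart c + sixPart d]) a =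
        (3 : ℤ) • (![sixPart c - sixPart d, sixPart d] a) := by
      ext i
      rw [Matrix.mul_apply, Fin.sum_univ_two]
      fin_cases a <;> simp [A₂_eq] <;> ring
    refine (congrArg (E₆ *ᵥ ·) h3).trans ?_
    refine (mulVec_smul E₆ 3 _).trans ?_
    fin_cases a
    · change (3 : ℤ) • (E₆ *ᵥ (sixPart c - sixPart d)) = (9 : ℤ) • (z - w)
      rw [mulVec_sub, hz, hw]
      module
    · change (3 : ℤ) • (E₆ *ᵥ sixPart d) = (9 : ℤ) • w
      rw [hw]
      module

/-- The coordinates of `x + t_M t_N y` in `modelQ`. -/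
def toModel : (Fin 8 → ℤ) × (Fin 8 → ℤ) →ₗ[ℤ] modelQ :=
  toModelFun.codRestrict modelQ toModelFun_mem

theorem toModel_surjective : Function.Surjective toModel := by
  rintro ⟨⟨c, Y⟩, ⟨hc, hcY⟩, Z, hZ⟩
  change c 0 + c 1 + c 2 = 0 at hc
  change ∀ i, 3 ∣ c i - Y 0 0 at hcY
  change A 2 * Y * E₆ = _ at hZ
  have hrow : ∀ a, E₆ *ᵥ (A 2 * Y) a = (9 : ℤ) • Z a := by
    intro a
    rw [← mul_E₆_apply, hZ]
    rfl
  have hA : (A 2 * Y) 0 = (2 : ℤ) • Y 0 - Y 1 ∧ (A 2 * Y) 1 = (2 : ℤ) • Y 1 - Y 0 := by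
    constructor <;> ext i <;> rw [Matrix.mul_apply, Fin.sum_univ_two] <;> simp [A₂_eq] <;> ring
  have hglue : ∀ i, glueMatrix 1 i = -glueMatrix 0 i := by decide
  have hdvd : ∀ i, 3 ∣ Y 0 i + Y 1 i ∧ 3 ∣ 2 * Y 1 i - Y 0 i := by
    intro i
    have h0 := three_dvd_sub_glue hZ 0 i
    have h1 := three_dvd_sub_glue hZ 1 i
    rw [hglue] at h1
    set t := Y 0 0 * glueMatrix 0 i with ht
    have h3 : Y 0 0 * -glueMatrix 0 i = -t := by rw [ht]; ring
    rw [h3] at h1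
    omega
  choose u hu using fun i => (hdvd i).1
  choose v hv using fun i => (hdvd i).2
  have hu' : Y 0 + Y 1 = (3 : ℤ) • u := funext hu
  have hv' : (2 : ℤ) • Y 1 - Y 0 = (3 : ℤ) • v := funext hv
  have hEu : E₆ *ᵥ u = (3 : ℤ) • (Z 0 + Z 1) := by
    apply smul_right_injective _ (show (3 : ℤ) ≠ 0 by norm_num)
    change (3 : ℤ) • (E₆ *ᵥ u) = (3 : ℤ) • ((3 : ℤ) • (Z 0 + Z 1))
    rw [← mulVec_smul, ← hu', show Y 0 + Y 1 = (A 2 * Y) 0 + (A 2 * Y) 1 by rw [hA.1, hA.2]; module,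
      mulVec_add, hrow, hrow]
    module
  have hEv : E₆ *ᵥ v = (3 : ℤ) • Z 1 := by
    apply smul_right_injective _ (show (3 : ℤ) ≠ 0 by norm_num)
    change (3 : ℤ) • (E₆ *ᵥ v) = (3 : ℤ) • ((3 : ℤ) • Z 1)
    rw [← mulVec_smul, ← hv', ← hA.2, hrow]
    module
  obtain ⟨l, y, hy⟩ := exists_eq_smul_glue_add hEu
  obtain ⟨l', y', hy'⟩ := exists_eq_smul_glue_add hEv
  have hY0 : ∀ i, Y 0 i = 2 * (l * E₆Glue i + 3 * y i) - (l' * E₆Glue i + 3 * y' i) := by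
    intro i
    have h1 := hu i
    have h2 := hv i
    rw [hy] at h1
    rw [hy'] at h2
    simp only [Pi.add_apply, Pi.smul_apply, smul_eq_mul] at h1 h2
    linarith
  have hY1 : ∀ i, Y 1 i = (l * E₆Glue i + 3 * y i) + (l' * E₆Glue i + 3 * y' i) := by
    intro i
    have h1 := hu i
    rw [hy] at h1
    simp only [Pi.add_apply, Pi.smul_apply, smul_eq_mul] at h1
    linarith [hY0 i]
  have h0 := hY0 0
  rw [show E₆Glue 0 = 2 from rfl] at h0
  obtain ⟨t, ht⟩ : ∃ t, l + l' - c 2 = 3 * t := by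
    have := hcY 2
    exact ⟨(l + l' - c 2) / 3, by omega⟩
  obtain ⟨w, hw⟩ : ∃ w, c 1 - c 2 = 3 * w := by
    have := hcY 2
    have := hcY 1
    exact ⟨(c 1 - c 2) / 3, by omega⟩
  -- The vectors `u` and `v` must be the `sixPart` values of the two entries. Each entry is fixed up
  -- to multiples of `E₆Glue`, and `t` adjusts the first so that the seventh coordinates add up to
  -- `-c 2`.
  refine ⟨(![y 0 + t * 2, y 1 + t * 3, y 2 + t * 4, y 3 + t * 6, y 4 + t * 5, y 5 + t * 4,
    l' - c 2, w], ![y' 0, y' 1, y' 2, y' 3, y' 4, y' 5, -l', 0]), ?_⟩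
  have hc2 : c 2 = l + l' - 3 * t := by linarith
  apply Subtype.ext
  change toModelFun _ = (c, Y)
  rw [toModelFun_apply, sixPart_eq, sixPart_eq]
  refine Prod.ext ?_ ?_
  · ext i
    fin_cases i <;> simp <;> linarith
  · ext a i
    fin_cases a
    · change _ = Y 0 i
      rw [hY0]
      fin_cases i <;> simp [E₆Glue, hc2] <;> ring
    · change _ = Y 1 i
      rw [hY1]
      fin_cases i <;> simp [E₆Glue, hc2] <;> ring

theorem modelForm_self_eq_zero {q : modelQ} (h : modelForm q.1 q.1 = 0) : q = 0 := by
  have h1 := tensorForm_nonneg q.1.2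
  have h2 : 0 ≤ q.1.1 ⬝ᵥ q.1.1 := Finset.sum_nonneg fun i _ => mul_self_nonneg _
  rw [modelForm] at h
  apply Subtype.ext
  refine Prod.ext ?_ ?_
  · exact dotProduct_self_eq_zero.mp (by omega)
  · exact eq_zero_of_tensorForm (by omega)

/-- Two surjective maps with the same kernel have isomorphic targets. -/
theorem exists_equiv_of_ker_eq {P X Y : Type*} [AddCommGroup P] [AddCommGroup X] [AddCommGroup Y]
    (f : P →ₗ[ℤ] X) (g : P →ₗ[ℤ] Y) (hf : Function.Surjective f) (hg : Function.Surjective g)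
    (h : ∀ p, f p = 0 ↔ g p = 0) : ∃ e : X ≃ₗ[ℤ] Y, ∀ p, e (f p) = g p := by
  have hk : LinearMap.ker f = LinearMap.ker g := by
    ext p
    exact h p
  refine ⟨(f.quotKerEquivOfSurjective hf).symm.trans ((Submodule.quotEquivOfEq _ _ hk).trans
    (g.quotKerEquivOfSurjective hg)), fun p => ?_⟩
  have h1 : (f.quotKerEquivOfSurjective hf).symm (f p) = Submodule.Quotient.mk p := by
    rw [LinearEquiv.symm_apply_eq]
    rfl
  rw [LinearEquiv.trans_apply, h1]
  rfl

/-- The coordinates of the vectors of `M + N` that are orthogonal to the fixed vectors. -/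
theorem toModel_fst_eq_zero (x : (Fin 8 → ℤ) × (Fin 8 → ℤ)) :
    (toModel x).1.1 = 0 ↔ x.1 6 + x.2 6 = 0 ∧ x.1 7 + x.2 7 = 0 := by
  change ![_, _, _] = (0 : Fin 3 → ℤ) ↔ _
  constructor
  · intro h
    have h0 := congrFun h 0
    have h2 := congrFun h 2
    simp at h0 h2
    omega
  · rintro ⟨h1, h2⟩
    rw [h1, h2]
    ext i
    fin_cases i <;> simp

end Coordinates

/-! ### Isotropic vectors of `E₆` modulo three times the dual lattice -/

section Isotropic

/-- Pairs of roots of `E₆` with inner product `-1`, such that the differences represent, up to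
sign, the nonzero isotropic classes modulo three times the dual lattice. -/
def rootPairs : List ((Fin 6 → ℤ) × (Fin 6 → ℤ)) :=
  [(![0, 0, 0, 0, -1, 0], ![0, 0, 0, 0, 0, -1]),
   (![0, 0, 0, -1, -1, 0], ![0, 0, 0, 0, 0, -1]),
   (![0, 0, 0, -1, 0, 0], ![0, 0, 0, 0, -1, 0]),
   (![0, 0, 0, -1, 0, 0], ![0, 0, 0, 0, -1, -1]),
   (![0, 0, -1, -1, -1, 0], ![0, 0, 0, 0, 0, -1]),
   (![0, 0, -1, -1, 0, 0], ![0, 0, 0, 0, -1, 0]),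
   (![0, 0, -1, -1, 0, 0], ![0, 0, 0, 0, -1, -1]),
   (![0, 0, -1, 0, 0, 0], ![0, 0, 0, -1, 0, 0]),
   (![0, 0, -1, 0, 0, 0], ![0, 0, 0, -1, -1, 0]),
   (![0, 0, -1, 0, 0, 0], ![0, 0, 0, -1, -1, -1]),
   (![0, -1, 0, -1, -1, 0], ![0, 0, 0, 0, 0, -1]),
   (![0, -1, 0, -1, 0, 0], ![0, 0, 0, 0, -1, 0]),
   (![0, -1, 0, -1, 0, 0], ![0, 0, 0, 0, -1, -1]),
   (![0, -1, 0, 0, 0, 0], ![0, 0, 0, -1, 0, 0]),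
   (![0, -1, 0, 0, 0, 0], ![0, 0, 0, -1, -1, 0]),
   (![0, -1, 0, 0, 0, 0], ![0, 0, 0, -1, -1, -1]),
   (![0, -1, -1, -1, -1, -1], ![0, 0, 0, -1, -1, 0]),
   (![0, -1, -1, -1, -1, 0], ![0, 0, 0, -1, -1, -1]),
   (![0, -1, -1, -1, -1, 0], ![0, 0, 0, -1, 0, 0]),
   (![0, -1, -1, -1, -1, -1], ![0, 0, 0, -1, 0, 0]),
   (![0, -1, -1, -1, 0, 0], ![0, 0, 0, -1, -1, 0]),
   (![0, -1, -1, -1, 0, 0], ![0, 0, 0, -1, -1, -1]),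
   (![0, -1, -1, -1, -1, 0], ![0, 0, 0, 0, 0, -1]),
   (![0, -1, -1, -1, 0, 0], ![0, 0, 0, 0, -1, 0]),
   (![0, -1, -1, -1, 0, 0], ![0, 0, 0, 0, -1, -1]),
   (![0, -1, -1, -2, -1, -1], ![0, 0, 0, 0, -1, 0]),
   (![0, -1, -1, -2, -1, 0], ![0, 0, 0, 0, -1, -1]),
   (![0, -1, -1, -2, -1, 0], ![0, 0, 0, 0, 0, -1]),
   (![0, -1, 0, -1, -1, -1], ![0, 0, -1, -1, -1, 0]),
   (![0, -1, 0, -1, -1, 0], ![0, 0, -1, -1, -1, -1]),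
   (![0, -1, 0, -1, -1, 0], ![0, 0, -1, -1, 0, 0]),
   (![0, -1, 0, -1, -1, -1], ![0, 0, -1, -1, 0, 0]),
   (![0, -1, 0, -1, 0, 0], ![0, 0, -1, -1, -1, 0]),
   (![0, -1, 0, -1, 0, 0], ![0, 0, -1, -1, -1, -1]),
   (![0, -1, 0, -1, 0, 0], ![0, 0, -1, 0, 0, 0]),
   (![0, -1, 0, -1, -1, 0], ![0, 0, -1, 0, 0, 0]),
   (![0, -1, 0, -1, -1, -1], ![0, 0, -1, 0, 0, 0]),
   (![0, -1, 0, 0, 0, 0], ![0, 0, -1, -1, 0, 0]),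
   (![0, -1, 0, 0, 0, 0], ![0, 0, -1, -1, -1, 0]),
   (![0, -1, 0, 0, 0, 0], ![0, 0, -1, -1, -1, -1])]

theorem gramForm_rootPairs : ∀ t ∈ rootPairs, gramForm E₆ t.1 t.1 = 2 ∧ gramForm E₆ t.2 t.2 = 2 ∧
    gramForm E₆ t.1 t.2 = -1 := by
  decide +kernel

/-- The quotient of `E₆` by `3E₆*` is a five-dimensional quadratic space over the field of three
elements, with 80 nonzero isotropic vectors: the 40 listed pairs up to sign. The first coordinate
can be normalised to 0 because that of `E₆Glue` is prime to 3. -/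
theorem exists_rootPairs : ∀ a b c d e : Fin 3,
    let x : Fin 6 → ℤ := ![0, (a : ℕ), (b : ℕ), (c : ℕ), (d : ℕ), (e : ℕ)]
    3 ∣ gramForm E₆ x x → x = 0 ∨ ∃ t ∈ rootPairs,
      (∀ i, 3 ∣ x i - (t.2 i - t.1 i)) ∨ (∀ i, 3 ∣ x i + (t.2 i - t.1 i)) := by
  decide +kernel

/-- An isotropic vector of `E₆` modulo `3` is, up to three times the dual lattice, either zero or
the difference of two roots with inner product `-1`. -/
theorem exists_root_pair {x : Fin 6 → ℤ} (h : 3 ∣ gramForm E₆ x x) :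
    ∃ (p q : Fin 6 → ℤ) (l : ℤ) (y : Fin 6 → ℤ), x = q - p + l • E₆Glue + (3 : ℤ) • y ∧
      (p = q ∨ gramForm E₆ p p = 2 ∧ gramForm E₆ q q = 2 ∧ gramForm E₆ p q = -1) := by
  have hr : ∀ i : Fin 6, ∃ (r : Fin 3) (y : ℤ), x i - 2 * x 0 * E₆Glue i = ((r : ℕ) : ℤ) + 3 * y := by
    intro i
    refine ⟨⟨((x i - 2 * x 0 * E₆Glue i) % 3).toNat, by omega⟩, (x i - 2 * x 0 * E₆Glue i) / 3, ?_⟩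
    simp only
    omega
  choose r y hy using hr
  have hr0 : r 0 = 0 := by
    have h1 := hy 0
    rw [show E₆Glue 0 = 2 from rfl] at h1
    omega
  set a : Fin 6 → ℤ := ![0, (r 1 : ℕ), (r 2 : ℕ), (r 3 : ℕ), (r 4 : ℕ), (r 5 : ℕ)] with ha
  have hx : x = a + (2 * x 0) • E₆Glue + (3 : ℤ) • y := by
    ext i
    have h1 := hy i
    have h2 : a i = ((r i : ℕ) : ℤ) := by
      fin_cases i <;> simp [ha, hr0]
    simp only [Pi.add_apply, Pi.smul_apply, smul_eq_mul, h2]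
    linarith
  have hθ : ∀ z, gramForm E₆ E₆Glue z = 3 * z 5 := by
    intro z
    rw [gramForm_E₆]
    simp [E₆Glue]
    ring
  have ha3 : 3 ∣ gramForm E₆ a a := by
    have h1 : gramForm E₆ x x - gramForm E₆ a a = 3 *
        (2 * (2 * x 0) * a 5 + 2 * gramForm E₆ a y + (2 * x 0) * (2 * x 0) * 4
          + 6 * (2 * x 0) * y 5 + 3 * gramForm E₆ y y) := by
      conv_lhs => rw [hx]
      simp only [gramForm_add_left, gramForm_add_right, gramForm_smul_left, gramForm_smul_right,
        gramForm_comm E₆_transpose _ E₆Glue, gramForm_comm E₆_transpose y a, hθ,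
        Pi.add_apply, Pi.smul_apply, smul_eq_mul, show E₆Glue 5 = 4 from rfl]
      ring
    omega
  rcases exists_rootPairs (r 1) (r 2) (r 3) (r 4) (r 5) ha3 with h1 | ⟨⟨p, q⟩, ht, h1 | h1⟩
  · refine ⟨0, 0, 2 * x 0, y, ?_, Or.inl rfl⟩
    conv_lhs => rw [hx]
    change a = 0 at h1
    rw [h1, sub_zero]
  · choose w hw using h1
    refine ⟨p, q, 2 * x 0, w + y, ?_, Or.inr (gramForm_rootPairs _ ht)⟩
    conv_lhs => rw [hx]
    have h2 : a = q - p + (3 : ℤ) • w := by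
      ext i
      have := hw i
      simp only [Pi.add_apply, Pi.sub_apply, Pi.smul_apply, smul_eq_mul]
      linarith
    rw [h2]
    module
  · choose w hw using h1
    obtain ⟨h3, h4, h5⟩ := gramForm_rootPairs _ ht
    refine ⟨q, p, 2 * x 0, w + y, ?_, Or.inr ⟨h4, h3, (gramForm_comm E₆_transpose q p).trans h5⟩⟩
    conv_lhs => rw [hx]
    have h2 : a = p - q + (3 : ℤ) • w := by
      ext i
      have := hw i
      simp only [Pi.add_apply, Pi.sub_apply, Pi.smul_apply, smul_eq_mul]
      linarith
    rw [h2]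
    module

end Isotropic

/-! ### The Gram matrix of `M + N`, and the inclusion of `J`. -/

section Geometry

variable {V : Type*} [NormedAddCommGroup V] [InnerProductSpace ℝ V] [FiniteDimensional ℝ V]

omit [FiniteDimensional ℝ V] in
theorem eq_of_three_smul_eq {x y : V} (h : (3 : ℤ) • x = (3 : ℤ) • y) : x = y := by
  rw [← Int.cast_smul_eq_zsmul ℝ, ← Int.cast_smul_eq_zsmul ℝ] at h
  exact smul_right_injective V (by norm_num) h

/-- The sum `1 + g + g⁻¹`, for `g = t_M t_N`. -/
noncomputable def cyclicSum (M N : Submodule ℤ V) : V →ₗ[ℝ] V :=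
  LinearMap.id + (tInv M).toLinearEquiv.toLinearMap ∘ₗ (tInv N).toLinearEquiv.toLinearMap +
    (tInv N).toLinearEquiv.toLinearMap ∘ₗ (tInv M).toLinearEquiv.toLinearMap

theorem cyclicSum_apply (M N : Submodule ℤ V) (x : V) :
    cyclicSum M N x = x + tInv M (tInv N x) + tInv N (tInv M x) :=
  rfl

theorem cyclicSum_of_mem {M : Submodule ℤ V} (N : Submodule ℤ V) {m : V} (hm : m ∈ M) :
    cyclicSum M N m = traceMap M N m := by
  rw [cyclicSum_apply, traceMap_apply, tInv_of_mem hm, map_neg]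
  abel

theorem cyclicSum_tInv_left (M N : Submodule ℤ V) (x : V) :
    cyclicSum M N (tInv M x) = tInv M (cyclicSum M N x) := by
  simp only [cyclicSum_apply, map_add, tInv_tInv]
  abel

theorem cyclicSum_tInv_right (M N : Submodule ℤ V) (x : V) :
    cyclicSum M N (tInv N x) = tInv N (cyclicSum M N x) := by
  simp only [cyclicSum_apply, map_add, tInv_tInv]
  abel

/-- The map `(x, y) ↦ x + t_M t_N y`, in coordinates. -/
noncomputable def pairMap {M : Submodule ℤ V} (N : Submodule ℤ V) (e : (Fin 8 → ℤ) ≃ₗ[ℤ] M) :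
    (Fin 8 → ℤ) × (Fin 8 → ℤ) →ₗ[ℤ] V where
  toFun x := e x.1 + tInv M (tInv N (e x.2))
  map_add' x y := by
    simp only [Prod.fst_add, Prod.snd_add, map_add, Submodule.coe_add]
    abel
  map_smul' k x := by
    simp only [Prod.smul_fst, Prod.smul_snd, map_smul, Submodule.coe_smul, map_zsmul,
      RingHom.id_apply, smul_add]

theorem pairMap_apply {M : Submodule ℤ V} (N : Submodule ℤ V) (e : (Fin 8 → ℤ) ≃ₗ[ℤ] M)
    (x : (Fin 8 → ℤ) × (Fin 8 → ℤ)) :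
    pairMap N e x = e x.1 + tInv M (tInv N (e x.2)) :=
  rfl

/-- Coordinates on `M` in which the part fixed by `t_M t_N` is spanned by the highest root and the
last simple root. -/
structure IsAdapted (M N : Submodule ℤ V) (e : (Fin 8 → ℤ) ≃ₗ[ℤ] M) : Prop where
  inner_eq : ∀ c d, inner ℝ (e c : V) (e d : V) = 2 * (gramForm E₈ c d : ℝ)
  mem_iff : ∀ c, (e c : V) ∈ fixedPart M N ↔ ∃ k l : ℤ, c = k • E₈Highest + l • Pi.single 7 1

/-- The inclusion of `E₆` in `E₈`. -/
def extendSix : (Fin 6 → ℤ) →ₗ[ℤ] Fin 8 → ℤ where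
  toFun u := ![u 0, u 1, u 2, u 3, u 4, u 5, 0, 0]
  map_add' u v := by
    ext i
    fin_cases i <;> simp
  map_smul' k u := by
    ext i
    fin_cases i <;> simp

theorem extendSix_apply (u : Fin 6 → ℤ) : extendSix u = ![u 0, u 1, u 2, u 3, u 4, u 5, 0, 0] :=
  rfl

theorem gramForm_extendSix (u v : Fin 6 → ℤ) :
    gramForm E₈ (extendSix u) (extendSix v) = gramForm E₆ u v := by
  rw [gramForm_E₈, gramForm_E₆]
  simp [extendSix_apply]

theorem exists_extendSix_eq {c : Fin 8 → ℤ} (h6 : c 6 = 0) (h7 : c 7 = 0) :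
    ∃ u, c = extendSix u := by
  refine ⟨![c 0, c 1, c 2, c 3, c 4, c 5], ?_⟩
  ext i
  fin_cases i <;> simp [extendSix_apply, h6, h7]

theorem pairForm_extendSix (u v u' v' : Fin 6 → ℤ) :
    pairForm (extendSix u, extendSix v) (extendSix u', extendSix v') =
      2 * gramForm E₆ u u' + 2 * gramForm E₆ v v' - gramForm E₆ u v' - gramForm E₆ u' v := by
  simp only [pairForm, crossForm, gramForm_extendSix]
  simp [extendSix_apply]
  ring

namespace IsBraidPair

variable {L M N : Submodule ℤ V} (h : IsBraidPair L M N)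

include h

theorem tInv_left_mem {x : V} (hx : x ∈ L) : tInv M x ∈ L := by
  have h1 := sub_mem hx (h.left_le (h.rootless.sub_tInv_mem h.left_le h.left hx))
  rwa [sub_sub_cancel] at h1

theorem tInv_right_mem {x : V} (hx : x ∈ L) : tInv N x ∈ L :=
  h.symm.tInv_left_mem hx

theorem tInv_cube (x : V) : tInv M (tInv N (tInv M (tInv N x))) = tInv N (tInv M x) := by
  rw [h.braid, tInv_tInv]

theorem cyclicSum_rotate (x : V) : cyclicSum M N (tInv M (tInv N x)) = cyclicSum M N x := by
  simp only [cyclicSum_apply, tInv_tInv, h.tInv_cube]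
  abel

theorem rotate_cyclicSum (x : V) : tInv M (tInv N (cyclicSum M N x)) = cyclicSum M N x := by
  rw [← cyclicSum_tInv_right, ← cyclicSum_tInv_left, h.cyclicSum_rotate]

omit h in
theorem inner_cyclicSum (x : V) {y : V} (hy : tInv M (tInv N y) = y) :
    inner ℝ (cyclicSum M N x) y = 3 * inner ℝ x y := by
  have h1 : inner ℝ (tInv M (tInv N x)) y = inner ℝ x y := by
    conv_lhs => rw [← hy]
    rw [LinearIsometryEquiv.inner_map_map, LinearIsometryEquiv.inner_map_map]
  have h2 : inner ℝ (tInv N (tInv M x)) y = inner ℝ x y := by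
    rw [inner_tInv, inner_tInv, hy]
  rw [cyclicSum_apply, inner_add_left, inner_add_left, h1, h2]
  ring

/-- The operator `1 + g + g⁻¹` preserves `L` and is 3 times the orthogonal projection to the vectors
fixed by `g`. -/
theorem mem_latticeJ_iff {x : V} : x ∈ latticeJ L M N ↔ x ∈ L ∧ cyclicSum M N x = 0 := by
  constructor
  · rintro ⟨hx, h1⟩
    refine ⟨hx, ?_⟩
    have h2 : cyclicSum M N x ∈ fixLattice L (tInv M * tInv N) :=
      ⟨add_mem (add_mem hx (h.tInv_left_mem (h.tInv_right_mem hx)))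
        (h.tInv_right_mem (h.tInv_left_mem hx)), h.rotate_cyclicSum x⟩
    have h3 := inner_cyclicSum x h2.2
    rw [h1 _ h2, mul_zero, inner_self_eq_zero] at h3
    exact h3
  · rintro ⟨hx, h1⟩
    refine ⟨hx, fun y hy => ?_⟩
    have h3 := inner_cyclicSum x hy.2
    rw [h1, inner_zero_left] at h3
    linarith

theorem exists_isAdapted : ∃ e : (Fin 8 → ℤ) ≃ₗ[ℤ] M, IsAdapted M N e := by
  obtain ⟨e, h1, h2⟩ := h.exists_adapted_equiv
  exact ⟨e, h1, h2⟩

variable {e : (Fin 8 → ℤ) ≃ₗ[ℤ] M} (he : IsAdapted M N e)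

include he

/-- The trace lies in the fixed part, so its products with the two generators determine it; they are
3 times those of `d`. -/
theorem traceMap_adapted (d : Fin 8 → ℤ) : traceMap M N (e d) =
    e (d 6 • E₈Highest + (3 * d 7 - 2 * d 6) • Pi.single 7 1) := by
  have hd := h.traceMap_mem (e d).2
  have h1 : (e (e.symm ⟨_, hd.1⟩) : V) = traceMap M N (e d) := by rw [e.apply_symm_apply]
  obtain ⟨k, l, hkl⟩ := (he.mem_iff (e.symm ⟨_, hd.1⟩)).mp (by rw [h1]; exact hd)
  rw [hkl] at h1
  have h2 : ∀ z, (e z : V) ∈ fixedPart M N →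
      gramForm E₈ z (k • E₈Highest + l • Pi.single 7 1) = 3 * gramForm E₈ z d := by
    intro z hz
    have h3 := inner_traceMap (m := (e d : V)) hz
    rw [← h1, he.inner_eq, he.inner_eq] at h3
    have h4 : (gramForm E₈ z (k • E₈Highest + l • Pi.single 7 1) : ℝ) = 3 * gramForm E₈ z d := by
      linarith
    exact_mod_cast h4
  have h3 := h2 E₈Highest ((he.mem_iff _).mpr ⟨1, 0, by module⟩)
  have h4 := h2 (Pi.single 7 1) ((he.mem_iff _).mpr ⟨0, 1, by module⟩)
  rw [gramForm_E₈Highest, gramForm_E₈Highest] at h3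
  rw [gramForm_E₈, gramForm_E₈] at h4
  simp [E₈Highest] at h3 h4
  have h5 : k = d 6 := by omega
  have h6 : l = 3 * d 7 - 2 * d 6 := by omega
  rw [← h1, h5, h6]

/-- For `c` and `d` in `M`, `(c, gd) = -(c, t_N d)`, so the product of `c` with the trace of `d` is
`(c, d) + 2(c, gd)`. -/
theorem inner_rotate (c d : Fin 8 → ℤ) :
    inner ℝ (e c : V) (tInv M (tInv N (e d))) = (crossForm c d : ℝ) := by
  have h1 : inner ℝ (e c : V) (traceMap M N (e d)) =
      2 * ((d 6 * c 7 + (3 * d 7 - 2 * d 6) * (2 * c 7 - c 6) : ℤ) : ℝ) := by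
    rw [h.traceMap_adapted he, he.inner_eq]
    congr 2
    rw [gramForm_add_right, gramForm_smul_right, gramForm_smul_right,
      gramForm_comm E₈_transpose c E₈Highest, gramForm_E₈Highest, gramForm_comm E₈_transpose c,
      gramForm_E₈ (Pi.single 7 1)]
    simp
  have h2 : inner ℝ (e c : V) (tInv M (tInv N (e d))) = -inner ℝ (e c : V) (tInv N (e d)) := by
    rw [← inner_tInv, tInv_of_mem (e c).2, inner_neg_left]
  rw [traceMap_apply, inner_sub_right, inner_add_right, he.inner_eq] at h1
  rw [crossForm, Int.cast_sub]
  linarith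

theorem inner_pairMap (x y : (Fin 8 → ℤ) × (Fin 8 → ℤ)) :
    inner ℝ (pairMap N e x) (pairMap N e y) = (pairForm x y : ℝ) := by
  rw [pairMap_apply, pairMap_apply, inner_add_left, inner_add_right, inner_add_right,
    h.inner_rotate he, real_inner_comm (e y.1 : V) (tInv M _), h.inner_rotate he, LinearIsometryEquiv.inner_map_map,
    LinearIsometryEquiv.inner_map_map, he.inner_eq, he.inner_eq, pairForm]
  push_cast
  ring

omit he in
theorem range_pairMap (e : (Fin 8 → ℤ) ≃ₗ[ℤ] M) : LinearMap.range (pairMap N e) = M ⊔ N := by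
  apply le_antisymm
  · rintro _ ⟨x, rfl⟩
    exact Submodule.add_mem_sup (e x.1).2 (h.tInv_tInv_mem (e x.2).2)
  · intro v hv
    obtain ⟨m, hm, n, hn, rfl⟩ := Submodule.mem_sup.mp hv
    refine ⟨(e.symm ⟨m, hm⟩, e.symm ⟨_, h.symm.tInv_tInv_mem hn⟩), ?_⟩
    rw [pairMap_apply, e.apply_symm_apply, e.apply_symm_apply, tInv_tInv, tInv_tInv]

theorem cyclicSum_pairMap_eq_zero (x : (Fin 8 → ℤ) × (Fin 8 → ℤ)) :
    cyclicSum M N (pairMap N e x) = 0 ↔ x.1 6 + x.2 6 = 0 ∧ x.1 7 + x.2 7 = 0 := by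
  have h1 : cyclicSum M N (pairMap N e x) = traceMap M N (e (x.1 + x.2)) := by
    rw [pairMap_apply, map_add, h.cyclicSum_rotate, cyclicSum_of_mem N (e x.1).2,
      cyclicSum_of_mem N (e x.2).2, map_add, Submodule.coe_add, map_add]
  rw [h1, h.traceMap_adapted he, Submodule.coe_eq_zero, e.map_eq_zero_iff]
  simp only [Pi.add_apply]
  constructor
  · intro h2
    have h3 := congrFun h2 0
    have h4 := congrFun h2 7
    simp [E₈Highest] at h3 h4
    omega
  · rintro ⟨h2, h3⟩
    rw [h2, h3]
    simp

/-- Adding `3 • Pi.single 6 1` to the extended glue vector gives `E₈Highest - 2 • Pi.single 7 1`,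
which `g` fixes. So the `E₆*`-classes contribute nothing outside `M + N`. -/
theorem glue_eq : pairMap N e (extendSix E₆Glue, (2 : ℤ) • extendSix E₆Glue) =
    (3 : ℤ) • pairMap N e (![2, 3, 4, 6, 5, 4, 2, 0], ![0, 0, 0, 0, 0, 0, -2, 0]) := by
  rw [← (pairMap N e).map_smul, ← sub_eq_zero, ← (pairMap N e).map_sub, ← inner_self_eq_zero (𝕜 := ℝ), h.inner_pairMap he]
  have : pairForm ((extendSix E₆Glue, (2 : ℤ) • extendSix E₆Glue) -
      (3 : ℤ) • (![2, 3, 4, 6, 5, 4, 2, 0], ![0, 0, 0, 0, 0, 0, -2, 0]))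
      ((extendSix E₆Glue, (2 : ℤ) • extendSix E₆Glue) -
      (3 : ℤ) • (![2, 3, 4, 6, 5, 4, 2, 0], ![0, 0, 0, 0, 0, 0, -2, 0])) = 0 := by
    decide +kernel
  rw [this, Int.cast_zero]

theorem mem_range_pairMap_of_cyclicSum_eq_zero {z : V} (hz : z ∈ L) (hz0 : cyclicSum M N z = 0) :
    z ∈ LinearMap.range (pairMap N e) := by
  have hmem : ∀ x, pairMap N e x ∈ L := fun x => by
    have h1 : pairMap N e x ∈ LinearMap.range (pairMap N e) := ⟨x, rfl⟩
    rw [h.range_pairMap] at h1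
    exact sup_le h.left_le h.right_le h1
  have hext : ∀ m : M, cyclicSum M N m = 0 → ∃ u, (m : V) = e (extendSix u) := by
    intro m hm
    have h1 : pairMap N e (e.symm m, 0) = m := by
      rw [pairMap_apply, e.apply_symm_apply, map_zero]
      simp
    rw [← h1, h.cyclicSum_pairMap_eq_zero he] at hm
    obtain ⟨u, hu⟩ := exists_extendSix_eq (c := e.symm m) (by simpa using hm.1)
      (by simpa using hm.2)
    exact ⟨u, by rw [← hu, e.apply_symm_apply]⟩
  have hm := h.rootless.sub_tInv_mem h.left_le h.left hz
  have hn := h.rootless.sub_tInv_mem h.right_le h.right hz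
  have hm' := h.symm.tInv_tInv_mem hn
  obtain ⟨u, hu⟩ := hext ⟨_, hm⟩ (by
    rw [map_sub, cyclicSum_tInv_left, hz0, map_zero, sub_zero])
  obtain ⟨v, hv⟩ := hext ⟨_, hm'⟩ (by
    rw [← h.cyclicSum_rotate, tInv_tInv, tInv_tInv, map_sub, cyclicSum_tInv_right, hz0, map_zero,
      sub_zero])
  simp only at hu hv
  -- With `1 + g + g⁻¹` zero on `z`, the vectors `z - t_M z` and `g(z - t_N z)`, both in the
  -- `E₆`-part of `M`, suffice to recover `3z`.
  have key : (3 : ℤ) • z = pairMap N e (extendSix ((2 : ℤ) • u + v), extendSix (u + (2 : ℤ) • v)) := by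
    have h1 : tInv N (tInv M z) = -z - tInv M (tInv N z) := by
      rw [cyclicSum_apply] at hz0
      rw [← sub_eq_zero, ← hz0]
      abel
    have h2 : tInv M (tInv N (tInv M z)) = -tInv M z - tInv N z := by
      rw [h1, map_sub, map_neg, tInv_tInv]
    simp only [pairMap_apply, map_add, map_smul, Submodule.coe_add, Submodule.coe_smul, map_zsmul,
      ← hu, ← hv, tInv_tInv, map_sub]
    rw [← h.braid, h2, h1]
    module
  -- The norm of `3z` is `6((u,u) + (u,v) + (v,v))` and also 9 times an integer.
  have hint : 3 ∣ gramForm E₆ (v - u) (v - u) := by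
    obtain ⟨k, hk⟩ := h.rootless.integral z hz z hz
    have h1 := h.inner_pairMap he (extendSix ((2 : ℤ) • u + v), extendSix (u + (2 : ℤ) • v))
      (extendSix ((2 : ℤ) • u + v), extendSix (u + (2 : ℤ) • v))
    rw [← key, inner_zsmul_left, inner_zsmul_right, hk, pairForm_extendSix] at h1
    rw [← Int.cast_mul, ← Int.cast_mul, Int.cast_inj] at h1
    simp only [gramForm_add_left, gramForm_add_right, gramForm_sub_left, gramForm_sub_right,
      gramForm_smul_left, gramForm_smul_right, gramForm_comm E₆_transpose v u] at h1 ⊢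
    omega
  obtain ⟨p, q, l, y, hvu, hpq⟩ := exists_root_pair hint
  obtain ⟨w, hw⟩ : ∃ w, (3 : ℤ) • (z - pairMap N e w) =
      pairMap N e (extendSix (q - p), (2 : ℤ) • extendSix (q - p)) := by
    refine ⟨(extendSix (u + y), extendSix (u + (2 : ℤ) • y)) +
      l • (![2, 3, 4, 6, 5, 4, 2, 0], ![0, 0, 0, 0, 0, 0, -2, 0]), ?_⟩
    obtain rfl : v = u + (q - p + l • E₆Glue + (3 : ℤ) • y) := by rw [← hvu]; abel
    have h1 : (extendSix ((2 : ℤ) • u + (u + (q - p + l • E₆Glue + (3 : ℤ) • y))),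
        extendSix (u + (2 : ℤ) • (u + (q - p + l • E₆Glue + (3 : ℤ) • y)))) =
        (3 : ℤ) • (extendSix (u + y), extendSix (u + (2 : ℤ) • y)) +
        (l • (extendSix E₆Glue, (2 : ℤ) • extendSix E₆Glue) +
          (extendSix (q - p), (2 : ℤ) • extendSix (q - p))) := by
      refine Prod.ext ?_ ?_
      · simp only [Prod.fst_add, Prod.smul_fst, map_add, map_sub, map_smul]
        module
      · simp only [Prod.snd_add, Prod.smul_snd, map_add, map_sub, map_smul]
        module
    rw [smul_sub, key, h1]
    simp only [(pairMap N e).map_add, (pairMap N e).map_smul]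
    rw [h.glue_eq he]
    module
  rcases hpq with rfl | ⟨hp, hq, hpq⟩
  · refine ⟨w, ?_⟩
    rw [sub_self, map_zero, smul_zero, ← Prod.zero_eq_mk, map_zero, ← smul_zero (3 : ℤ)] at hw
    exact (sub_eq_zero.mp (eq_of_three_smul_eq hw)).symm
  · exfalso
    -- This shift replaces `u` and `v` by `p` and `q`, so that `3z'` has norm `6(2 - 1 + 2) = 18`
    -- and `z'` has norm 2.
    set z' := z - pairMap N e w + pairMap N e (extendSix p, extendSix p) with hz'
    have h1 : (3 : ℤ) • z' = pairMap N e (extendSix ((2 : ℤ) • p + q), extendSix (p + (2 : ℤ) • q)) := by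
      rw [hz', smul_add, hw, ← (pairMap N e).map_smul, ← (pairMap N e).map_add]
      congr 1
      refine Prod.ext ?_ ?_
      · simp only [Prod.fst_add, Prod.smul_fst, map_add, map_sub, map_smul]
        module
      · simp only [Prod.snd_add, Prod.smul_snd, map_add, map_sub, map_smul]
        module
    have h2 := h.inner_pairMap he (extendSix ((2 : ℤ) • p + q), extendSix (p + (2 : ℤ) • q))
      (extendSix ((2 : ℤ) • p + q), extendSix (p + (2 : ℤ) • q))
    rw [← h1, inner_zsmul_left, inner_zsmul_right, pairForm_extendSix] at h2
    simp only [gramForm_add_left, gramForm_add_right, gramForm_smul_left, gramForm_smul_right,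
      gramForm_comm E₆_transpose q p, hp, hq, hpq] at h2
    have h3 : inner ℝ z' z' = (2 : ℝ) := by
      push_cast at h2
      linarith
    have h4 := h.rootless.rootless z' (add_mem (sub_mem hz (hmem _)) (hmem _)) fun h0 => by
      rw [h0, inner_zero_left] at h3
      norm_num at h3
    rw [h3] at h4
    exact lt_irrefl _ h4

omit he in
/-- The lattice `M + N` and its sublattice `J` in coordinates. -/
theorem exists_model_equiv : latticeJ L M N ≤ M ⊔ N ∧
    ∃ (ψ : modelQ ≃ₗ[ℤ] ↥(M ⊔ N)) (χ : modelJ ≃ₗ[ℤ] latticeJ L M N),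
      (∀ q q', 27 * inner ℝ (ψ q : V) (ψ q' : V) = (modelForm q.1 q'.1 : ℝ)) ∧
      ∀ Y, (χ Y : V) = ψ (modelIncl Y) := by
  obtain ⟨e, he⟩ := h.exists_isAdapted
  have hmem : ∀ p, pairMap N e p ∈ M ⊔ N := fun p => by
    rw [← h.range_pairMap e]
    exact ⟨p, rfl⟩
  have hrange : ∀ {z : V}, z ∈ latticeJ L M N → ∃ p, pairMap N e p = z := fun hz =>
    h.mem_range_pairMap_of_cyclicSum_eq_zero he (h.mem_latticeJ_iff.mp hz).1
      (h.mem_latticeJ_iff.mp hz).2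
  have hform : ∀ p p', (modelForm (toModel p).1 (toModel p').1 : ℝ) =
      27 * inner ℝ (pairMap N e p) (pairMap N e p') := fun p p' => by
    rw [h.inner_pairMap he]
    exact_mod_cast modelForm_toModelFun p p'
  -- Both maps carry `pairForm`, up to scaling, to a positive definite form, so both kernels equal
  -- its radical.
  obtain ⟨ψ, hψ⟩ := exists_equiv_of_ker_eq toModel ((pairMap N e).codRestrict (M ⊔ N) hmem)
    toModel_surjective (by
      rintro ⟨v, hv⟩
      rw [← h.range_pairMap e] at hv
      obtain ⟨p, rfl⟩ := hv
      exact ⟨p, rfl⟩) (by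
      intro p
      have h1 := hform p p
      refine Iff.trans ?_ (Submodule.coe_eq_zero (x := (pairMap N e).codRestrict (M ⊔ N) hmem p))
      change _ ↔ pairMap N e p = 0
      constructor
      · intro h2
        have h3 : modelForm (toModel p).1 (toModel p).1 = 0 := by rw [h2]; decide +kernel
        rw [h3, Int.cast_zero, zero_eq_mul, inner_self_eq_zero] at h1
        exact h1.resolve_left (by norm_num)
      · intro h2
        rw [h2, inner_zero_left, mul_zero, Int.cast_eq_zero] at h1
        exact modelForm_self_eq_zero h1)
  have hψ' : ∀ p, (ψ (toModel p) : V) = pairMap N e p := fun p => congrArg Subtype.val (hψ p)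
  have hmemJ : ∀ Y, (ψ (modelIncl Y) : V) ∈ latticeJ L M N := by
    intro Y
    obtain ⟨p, hp⟩ := toModel_surjective (modelIncl Y)
    rw [← hp, hψ', h.mem_latticeJ_iff, h.cyclicSum_pairMap_eq_zero he, ← toModel_fst_eq_zero, hp]
    exact ⟨sup_le h.left_le h.right_le (hmem p), rfl⟩
  refine ⟨fun z hz => ?_, ψ, LinearEquiv.ofBijective
    (((M ⊔ N).subtype ∘ₗ ψ.toLinearMap ∘ₗ modelIncl).codRestrict _ hmemJ) ⟨?_, ?_⟩, ?_, ?_⟩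
  · obtain ⟨p, rfl⟩ := hrange hz
    exact hmem p
  · intro X Y hXY
    exact modelIncl_injective (ψ.injective (Subtype.ext
      (congrArg (fun z : latticeJ L M N => (z : V)) hXY)))
  · rintro ⟨z, hz⟩
    obtain ⟨p, rfl⟩ := hrange hz
    have h1 := (h.mem_latticeJ_iff.mp hz).2
    rw [h.cyclicSum_pairMap_eq_zero he, ← toModel_fst_eq_zero] at h1
    obtain ⟨Y, hY⟩ := exists_modelIncl_eq h1
    exact ⟨Y, Subtype.ext ((congrArg (fun q => (ψ q : V)) hY.symm).trans (hψ' p))⟩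
  · intro q q'
    obtain ⟨p, rfl⟩ := toModel_surjective q
    obtain ⟨p', rfl⟩ := toModel_surjective q'
    rw [hψ', hψ', hform]
  · exact fun Y => rfl

end IsBraidPair

end Geometry

end DihSix

/-! ### Transport of the results from the model to `Q` and `J`. -/

theorem mainTheorem9 {V : Type*} [NormedAddCommGroup V] [InnerProductSpace ℝ V]
    [FiniteDimensional ℝ V] (L M N Q J : Submodule ℤ V)
    (hL : DihSix.IsRootlessIntegral L) (hM : M ≤ L) (hN : N ≤ L)
    (hMN : DihSix.IsDih6Pair14 M N) (hQ : Q = M ⊔ N) (hJ : J = DihSix.latticeJ L M N) :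
    J ≤ Q ∧ DihSix.IsCoxeterTodd J ∧
    ∃ φ : DihSix.latticeO Q →* DihSix.latticeO J,
      -- `φ` is the restriction map
      (∀ (f : DihSix.latticeO Q) (x : Q) (y : J), (x : V) = y →
        ((φ f).1 y : V) = (f.1 x : V)) ∧
      Nonempty (φ.range ≃*
        DihSix.CentralProductO (CartanMatrix.A 2) CartanMatrix.E₆) ∧
      Nonempty (φ.ker ≃* Equiv.Perm (Fin 3)) ∧
      DihSix.HasShape (DihSix.latticeO Q) (Equiv.Perm (Fin 3))
        (DihSix.CentralProductO (CartanMatrix.A 2) CartanMatrix.E₆) := by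
  subst hQ hJ
  obtain ⟨hJQ, ψ, χ, hψ, hχ⟩ := (hMN.isBraidPair hL hM hN).exists_model_equiv
  have hχ' : ∀ X Y, 3 * inner ℝ (χ X : V) (χ Y : V) = (DihSix.tensorForm X.1 Y.1 : ℝ) := by
    intro X Y
    have h1 := hψ (DihSix.modelIncl X) (DihSix.modelIncl Y)
    rw [← hχ, ← hχ, DihSix.modelForm_modelIncl] at h1
    push_cast at h1
    linarith
  have hQ : ∀ q r q' r', inner ℝ (ψ q : V) (ψ r : V) = inner ℝ (ψ q' : V) (ψ r' : V) ↔
      DihSix.modelForm q.1 r.1 = DihSix.modelForm q'.1 r'.1 := by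
    intro q r q' r'
    rw [← Int.cast_inj (α := ℝ), ← hψ, ← hψ]
    exact (mul_right_inj' (by norm_num)).symm
  have hJ : ∀ q r q' r', inner ℝ (χ q : V) (χ r : V) = inner ℝ (χ q' : V) (χ r' : V) ↔
      DihSix.tensorForm q.1 r.1 = DihSix.tensorForm q'.1 r'.1 := by
    intro q r q' r'
    rw [← Int.cast_inj (α := ℝ), ← hχ', ← hχ']
    exact (mul_right_inj' (by norm_num)).symm
  let eQ : DihSix.modelOQ ≃* DihSix.latticeO (M ⊔ N) := DihSix.isometryGroupCongr ψ hQ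
  let eJ : DihSix.modelOJ ≃* DihSix.latticeO (DihSix.latticeJ L M N) :=
    DihSix.isometryGroupCongr χ hJ
  obtain ⟨φ₀, hφ₀⟩ := DihSix.exists_modelRestriction
  let φ : DihSix.latticeO (M ⊔ N) →* DihSix.latticeO (DihSix.latticeJ L M N) :=
    eJ.toMonoidHom.comp (φ₀.comp eQ.symm.toMonoidHom)
  have hrange : Nonempty (φ.range ≃*
      DihSix.CentralProductO (CartanMatrix.A 2) CartanMatrix.E₆) := by
    let Ψ : DihSix.gramO (CartanMatrix.A 2) × DihSix.gramO CartanMatrix.E₆ →*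
        DihSix.latticeO (DihSix.latticeJ L M N) := eJ.toMonoidHom.comp DihSix.modelTensor
    have h1 : Ψ.ker = DihSix.negNeg (CartanMatrix.A 2) CartanMatrix.E₆ := by
      rw [← DihSix.ker_modelTensor]
      ext x
      exact eJ.map_eq_one_iff
    have h2 : Ψ.range = φ.range := by
      rw [MonoidHom.range_comp, DihSix.range_modelTensor hφ₀]
      change _ = (eJ.toMonoidHom.comp (φ₀.comp eQ.symm.toMonoidHom)).range
      rw [MonoidHom.range_comp, MonoidHom.range_comp φ₀,
        (MonoidHom.range_eq_top (f := eQ.symm.toMonoidHom)).mpr eQ.symm.surjective,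
        MonoidHom.range_eq_map φ₀]
    exact ⟨((QuotientGroup.quotientMulEquivOfEq h1.symm).trans
      ((QuotientGroup.quotientKerEquivRange Ψ).trans (MulEquiv.subgroupCongr h2))).symm⟩
  have hker : Nonempty (φ.ker ≃* Equiv.Perm (Fin 3)) := by
    let σ : Equiv.Perm (Fin 3) →* DihSix.latticeO (M ⊔ N) := eQ.toMonoidHom.comp DihSix.modelPerm
    have h1 : Function.Injective σ := eQ.injective.comp DihSix.modelPerm_injective
    have h2 : σ.range = φ.ker := by
      rw [MonoidHom.range_comp, DihSix.range_modelPerm hφ₀]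
      ext f
      constructor
      · rintro ⟨f, hf, rfl⟩
        change eJ (φ₀ (eQ.symm (eQ f))) = 1
        rw [eQ.symm_apply_apply, MonoidHom.mem_ker.mp hf, map_one]
      · intro hf
        exact ⟨eQ.symm f, eJ.map_eq_one_iff.mp hf, eQ.apply_symm_apply f⟩
    exact ⟨((MonoidHom.ofInjective h1).trans (MulEquiv.subgroupCongr h2)).symm⟩
  refine ⟨hJQ, ?_, φ, ?_, hrange, hker, φ.ker, inferInstance, hker,
    ⟨(QuotientGroup.quotientKerEquivRange φ).trans hrange.some⟩⟩
  · obtain ⟨e, he⟩ := DihSix.exists_coxeterTodd_equiv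
    refine ⟨χ.symm.toAddEquiv.trans e, fun x y => ?_⟩
    have h1 := he (χ.symm x) (χ.symm y)
    rw [← hχ', χ.apply_symm_apply, χ.apply_symm_apply] at h1
    exact mul_left_cancel₀ (by norm_num) h1
  · intro f x y hxy
    have h1 : ψ (DihSix.modelIncl (χ.symm y)) = x := by
      apply Subtype.ext
      rw [← hχ, χ.apply_symm_apply, hxy]
    change (χ ((φ₀ (eQ.symm f)).1 (χ.symm y)) : V) = _
    rw [hχ, hφ₀]
    change (ψ (ψ.symm (f.1 (ψ (DihSix.modelIncl (χ.symm y))))) : V) = _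
    rw [ψ.apply_symm_apply, h1]
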